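/- Let $K$ be an infinite field. A *variety* is a Zariski-closed subset of a finite-dimensional $K$-vector space. For $\dim V=p+n$, a *Hodge dual* is a linear map $\star:\bigwedge^pV\to\bigwedge^nV^*\cong(\bigwedge^nV)^*$ of the form $\star(\omega)(\omega')=\psi(\omega\wedge\omega')$ with $\psi:\bigwedge^{p+n}V\to K$ an isomorphism; here $\bigwedge^n V^*\cong(\bigwedge^n V)^*$ via $(y_1\wedge\cdots\wedge y_n)(v_1\wedge\cdots\wedge v_n)=\det(y_i(v_j))$. A *Plücker variety* $X$ assigns to every $p\in\mathbb Z_{\ge0}$ and every finite-dimensional $K$-vector space $V$ a Zariski-closed subset $X_p(V)\subseteq\bigwedge^pV$ such that (i) for every linear map $\varphi:V\to W$, $\bigwedge^p\varphi$ maps $X_p(V)$ into $X_p(W)$, and (ii) if $\dim V=p+n$, every Hodge dual $\star:\bigwedge^pV\to\bigwedge^nV^*$ maps $X_p(V)$ into $X_n(V^*)$. It is *bounded* if $X_2(V)\neq\bigwedge^2V$ for some $V$. Let $V_\infty$ be the $K$-vector space with basis $x_i$, $i\in\mathbb Z\setminus\{0\}$, and for $n,p\in\mathbb Z_{\ge0}$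 let $V_{n,p}=\langle x_{-n},\dots,x_{-1},x_1,\dots,x_p\rangle$. The (charge-zero) *infinite wedge* $\bigwedge^{\infty/2}V_\infty$ is the direct limit of the spaces $\bigwedge^pV_{n,p}$ along the inclusions $\bigwedge^pV_{n,p}\to\bigwedge^pV_{n+1,p}$ and the maps $\bigwedge^pV_{n,p}\to\bigwedge^{p+1}V_{n,p+1}$, $\omega\mapsto\omega\wedge x_{p+1}$. The group $G_\infty=\bigcup_{n,p}\mathrm{GL}(V_{n,p})$, where $\mathrm{GL}(V_{n,p})$ acts on $V_\infty$ fixing the $x_i\notin V_{n,p}$, acts on the infinite wedge: $g\in \mathrm{GL}(V_{n,p})$ acts on the image of $\bigwedge^pV_{n,p}$ through $\bigwedge^p(g|_{V_{n,p}})$. Hence it acts by algebra automorphisms on the symmetric algebra of the infinite wedge, which is the ring of polynomial functions on the dual infinite wedge $(\bigwedge^{\infty/2}V_\infty)^*$. The *limit* $X_\infty\subseteq(\bigwedge^{\infty/2}V_\infty)^*$ of $X$ is the set of all $\omega$ such that for all $n,p$ the restriction of $\omega$ to $\bigwedge^pV_{n,p}$, viewed as an element of $\bigwedge^pV_{n,p}^*$,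 lies in $X_p(V_{n,p}^*)$. **Corollary.** Let $X$ be a bounded Plücker variety over $K$. Then there are finitely many polynomials $f_1,\dots,f_k\in\mathrm{Sym}(\bigwedge^{\infty/2}V_\infty)$ such that $$X_\infty=\{\omega\in(\textstyle\bigwedge^{\infty/2}V_\infty)^* : (g f_i)(\omega)=0\text{ for all } g\in G_\infty\text{ and } i=1,\dots,k\}.$$ -/

import Mathlib

open scoped exteriorPower

noncomputable section

namespace PluckerLimit

universe u

section FiniteDimensional

variable (K : Type u) [Field K]

/-- A subset of a finite-dimensional vector space `W` is Zariski-closed if it is the common zero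
set of a collection of polynomial functions; the coordinate ring of `W` is the symmetric algebra
of `W*`, and a polynomial is evaluated at `w` by extending `ℓ ↦ ℓ w` to an algebra
homomorphism. -/
def IsZariskiClosed {W : Type u} [AddCommGroup W] [Module K W] (Z : Set W) : Prop :=
  ∃ S : Set (SymmetricAlgebra K (Module.Dual K W)),
    Z = {w | ∀ f ∈ S, SymmetricAlgebra.lift (Module.Dual.eval K W w) f = 0}

variable {K}

/-- The product `⋀^p V × ⋀^n V → ⋀^{p+n} V`. -/
def wedge {V : Type u} [AddCommGroup V] [Module K V] {p n : ℕ}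
    (ω : ⋀[K]^p V) (η : ⋀[K]^n V) : ⋀[K]^(p + n) V :=
  ⟨ω.1 * η.1, SetLike.mul_mem_graded ω.2 η.2⟩

/-- `star : ⋀^p V → ⋀^n V*` is a Hodge dual if `(star ω)(ω') = ψ (ω ∧ ω')` for some isomorphism
`ψ : ⋀^{p+n} V ≃ K`. Here `⋀^n V*` is identified with `(⋀^n V)*` through the determinant pairing
`⟨x₁ ∧ ⋯ ∧ xₙ, v₁ ∧ ⋯ ∧ vₙ⟩ = det (x_i (v_j))`. -/
def IsHodgeDual {V : Type u} [AddCommGroup V] [Module K V] {p n : ℕ}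
    (star : ⋀[K]^p V →ₗ[K] ⋀[K]^n (Module.Dual K V)) : Prop :=
  Module.finrank K V = p + n ∧
    ∃ ψ : ⋀[K]^(p + n) V ≃ₗ[K] K, ∀ (ω : ⋀[K]^p V) (η : ⋀[K]^n V),
      exteriorPower.pairingDual K V n (star ω) η = ψ (wedge ω η)

variable (K)

/-- A Plücker variety. The functor `V ↦ X_p(V)` is recorded through its values on objects, since
its value on a linear map is prescribed to be the restriction of `⋀^p φ`. -/
structure PluckerVariety where
  /-- The instance `X_p(V)`. -/
  inst (p : ℕ) (V : Type u) [AddCommGroup V] [Module K V] [FiniteDimensional K V] :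
    Set (⋀[K]^p V)
  isZariskiClosed (p : ℕ) (V : Type u) [AddCommGroup V] [Module K V] [FiniteDimensional K V] :
    IsZariskiClosed K (inst p V)
  map_mem (p : ℕ) (V W : Type u) [AddCommGroup V] [Module K V] [FiniteDimensional K V]
    [AddCommGroup W] [Module K W] [FiniteDimensional K W] (φ : V →ₗ[K] W) :
    Set.MapsTo (exteriorPower.map p φ) (inst p V) (inst p W)
  hodge_mem (p n : ℕ) (V : Type u) [AddCommGroup V] [Module K V] [FiniteDimensional K V]
    (star : ⋀[K]^p V →ₗ[K] ⋀[K]^n (Module.Dual K V)) (hstar : IsHodgeDual star) :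
    Set.MapsTo star (inst p V) (inst n (Module.Dual K V))

variable {K} in
/-- A Plücker variety `X` is bounded if `X_2(V) ≠ ⋀^2 V` for some `V`. -/
def PluckerVariety.IsBounded (X : PluckerVariety K) : Prop :=
  ∃ (V : Type u) (_ : AddCommGroup V) (_ : Module K V) (_ : FiniteDimensional K V),
    X.inst 2 V ≠ Set.univ

end FiniteDimensional

section InfiniteWedge

/-- The index set `-ℕ ∪ ℕ`, i.e. the nonzero integers. -/
abbrev Idx : Type := {i : ℤ // i ≠ 0}

variable (K : Type u) [Field K]

/-- The space `V_∞` with basis `x_i`, `i` a nonzero integer. -/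
def VInf : Type u := Idx →₀ K

instance : AddCommGroup (VInf K) := inferInstanceAs (AddCommGroup (Idx →₀ K))

instance : Module K (VInf K) := inferInstanceAs (Module K (Idx →₀ K))

/-- The basis vector `x_i` of `V_∞`. -/
def x (i : Idx) : VInf K := Finsupp.single i 1

/-- `V_{n,p} = ⟨x_{-n}, …, x_{-1}, x_1, …, x_p⟩`. -/
def Vnp (n p : ℕ) : Submodule K (VInf K) :=
  Submodule.span K (x K '' {i : Idx | -(n : ℤ) ≤ i ∧ (i : ℤ) ≤ p})

instance (n p : ℕ) : FiniteDimensional K (Vnp K n p) := by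
  refine FiniteDimensional.span_of_finite K (Set.Finite.image _ ?_)
  exact Set.Finite.of_finite_image
    ((Set.finite_Icc (-(n : ℤ)) p).subset (by rintro _ ⟨i, hi, rfl⟩; exact hi))
    Subtype.val_injective.injOn

variable {K} in
theorem x_mem_Vnp {n p : ℕ} {i : Idx} (h₁ : -(n : ℤ) ≤ i) (h₂ : (i : ℤ) ≤ p) :
    x K i ∈ Vnp K n p :=
  Submodule.subset_span ⟨i, ⟨h₁, h₂⟩, rfl⟩

theorem Vnp_mono {n p n' p' : ℕ} (hn : n ≤ n') (hp : p ≤ p') : Vnp K n p ≤ Vnp K n' p' := by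
  refine Submodule.span_mono (Set.image_mono ?_)
  rintro i ⟨h₁, h₂⟩
  exact ⟨by omega, by omega⟩

/-- The index `k + 1` for a natural number `k`. -/
def posIdx (k : ℕ) : Idx := ⟨(k : ℤ) + 1, by omega⟩

/-- `x_{k+1}` as an element of `V_{n,p}`, for `k < p`. -/
def xpos (n p k : ℕ) (hk : k < p) : Vnp K n p :=
  ⟨x K (posIdx k), x_mem_Vnp (by simp only [posIdx]; omega) (by simp only [posIdx]; omega)⟩

/-- The map `⋀^p V_{n,p} → ⋀^{p'} V_{n',p'}`, `ω ↦ ω ∧ x_{p+1} ∧ ⋯ ∧ x_{p'}`, which is the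
composition of vertical and horizontal arrows of the two-dimensional diagram; the pair `(n, p)`
is recorded as a single index in `ℕ × ℕ` with its product order. -/
def trans (a b : ℕ × ℕ) (h : a ≤ b) :
    ⋀[K]^a.2 (Vnp K a.1 a.2) →ₗ[K] ⋀[K]^b.2 (Vnp K b.1 b.2) where
  toFun ω :=
    ⟨(exteriorPower.map a.2 (Submodule.inclusion (Vnp_mono K h.1 h.2)) ω).1 *
        (exteriorPower.ιMulti K (b.2 - a.2)
          (fun k => xpos K b.1 b.2 (a.2 + k) (by omega))).1, by
      have := SetLike.mul_mem_graded
        (exteriorPower.map a.2 (Submodule.inclusion (Vnp_mono K h.1 h.2)) ω).2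
        (exteriorPower.ιMulti K (b.2 - a.2)
          (fun k => xpos K b.1 b.2 (a.2 + k) (by omega))).2
      rwa [Nat.add_sub_cancel' h.2] at this⟩
  map_add' ω η := by ext; simp [add_mul]
  map_smul' c ω := by ext; simp

/-- The (charge zero part of the) infinite wedge, the direct limit of the `⋀^p V_{n,p}`. -/
def InfWedge : Type u :=
  Module.DirectLimit (fun a : ℕ × ℕ => ⋀[K]^a.2 (Vnp K a.1 a.2)) (trans K)

instance : AddCommGroup (InfWedge K) := inferInstanceAs (AddCommGroup
  (Module.DirectLimit (fun a : ℕ × ℕ => ⋀[K]^a.2 (Vnp K a.1 a.2)) (trans K)))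

instance : Module K (InfWedge K) := inferInstanceAs (Module K
  (Module.DirectLimit (fun a : ℕ × ℕ => ⋀[K]^a.2 (Vnp K a.1 a.2)) (trans K)))

/-- The canonical map `⋀^p V_{n,p} → ⋀^{∞/2} V_∞`, with `a = (n, p)`. -/
def toInfWedge (a : ℕ × ℕ) : ⋀[K]^a.2 (Vnp K a.1 a.2) →ₗ[K] InfWedge K :=
  Module.DirectLimit.of K (ℕ × ℕ) (fun a : ℕ × ℕ => ⋀[K]^a.2 (Vnp K a.1 a.2)) (trans K) a

variable {K} in
/-- The limit `X_∞` of a Plücker variety: all elements `ω` of the dual infinite wedge such that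
for all `n, p` the image of `ω` in `⋀^p V_{n,p}^*` (that is, its restriction to `⋀^p V_{n,p}`)
lies in `X_{n,p} = X_p(V_{n,p}^*)`. -/
def PluckerVariety.limit (X : PluckerVariety K) : Set (Module.Dual K (InfWedge K)) :=
  {ω | ∀ n p : ℕ, ∃ η ∈ X.inst p (Module.Dual K (Vnp K n p)),
    exteriorPower.pairingDual K (Vnp K n p) p η = ω ∘ₗ toInfWedge K (n, p)}

end InfiniteWedge

section Group

variable (K : Type u) [Field K]

/-- `G_{n,p} = GL(V_{n,p})` as a group of automorphisms of `V_∞`: those preserving `V_{n,p}` and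
fixing the basis vectors outside `V_{n,p}`. -/
def Gnp (a : ℕ × ℕ) : Subgroup (VInf K ≃ₗ[K] VInf K) where
  carrier := {g | (Vnp K a.1 a.2).map g.toLinearMap = Vnp K a.1 a.2 ∧
    ∀ i : Idx, ¬ (-(a.1 : ℤ) ≤ i ∧ (i : ℤ) ≤ a.2) → g (x K i) = x K i}
  one_mem' := ⟨Submodule.map_id _, fun _ _ => rfl⟩
  mul_mem' := by
    rintro g h ⟨hg, hg'⟩ ⟨hh, hh'⟩
    refine ⟨?_, fun i hi => ?_⟩
    · change Submodule.map (g.toLinearMap ∘ₗ h.toLinearMap) _ = _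
      rw [Submodule.map_comp, hh, hg]
    · rw [LinearEquiv.mul_apply, hh' i hi, hg' i hi]
  inv_mem' := by
    rintro g ⟨hg, hg'⟩
    refine ⟨?_, fun i hi => ?_⟩
    · conv_lhs => rw [← hg]
      rw [← Submodule.map_comp]
      convert Submodule.map_id _
      ext1 v
      exact g.symm_apply_apply _
    · change g.symm (x K i) = x K i
      rw [LinearEquiv.symm_apply_eq, hg' i hi]

variable {K}

theorem Gnp_mono {a b : ℕ × ℕ} (h : a ≤ b) : Gnp K a ≤ Gnp K b := by
  rintro g ⟨hg, hg'⟩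
  have hn := h.1
  have hp := h.2
  refine ⟨?_, fun i hi => hg' i fun ⟨h₁, h₂⟩ => hi ⟨by omega, by omega⟩⟩
  have key : Vnp K b.1 b.2 = Vnp K a.1 a.2 ⊔ Submodule.span K
      (x K '' {i : Idx | (-(b.1 : ℤ) ≤ i ∧ (i : ℤ) ≤ b.2) ∧
        ¬ (-(a.1 : ℤ) ≤ i ∧ (i : ℤ) ≤ a.2)}) := by
    rw [Vnp, Vnp, ← Submodule.span_union, ← Set.image_union]
    congr 2
    ext i
    simp only [Set.mem_ofPred_eq, Set.mem_union]
    omega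
  rw [key, Submodule.map_sup, hg, Submodule.map_span]
  congr 2
  ext v
  constructor
  · rintro ⟨_, ⟨i, hi, rfl⟩, rfl⟩
    exact ⟨i, hi, (hg' i hi.2).symm⟩
  · rintro ⟨i, hi, rfl⟩
    exact ⟨_, ⟨i, hi, rfl⟩, hg' i hi.2⟩

variable (K) in
/-- `G_∞ = ⋃ G_{n,p}`. -/
def GInf : Subgroup (VInf K ≃ₗ[K] VInf K) where
  carrier := {g | ∃ a : ℕ × ℕ, g ∈ Gnp K a}
  one_mem' := ⟨0, one_mem _⟩
  mul_mem' := by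
    rintro g h ⟨a, ha⟩ ⟨b, hb⟩
    exact ⟨a ⊔ b, mul_mem (Gnp_mono le_sup_left ha) (Gnp_mono le_sup_right hb)⟩
  inv_mem' := by
    rintro g ⟨a, ha⟩
    exact ⟨a, inv_mem ha⟩

/-- The restriction of `g ∈ G_{n,p}` to `V_{n,p}`. -/
def restr (a : ℕ × ℕ) (g : VInf K ≃ₗ[K] VInf K) (hg : g ∈ Gnp K a) :
    Vnp K a.1 a.2 →ₗ[K] Vnp K a.1 a.2 :=
  g.toLinearMap.restrict fun v hv => by
    have h : (Vnp K a.1 a.2).map g.toLinearMap = Vnp K a.1 a.2 := hg.1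
    rw [← h]
    exact ⟨v, hv, rfl⟩

/-- The action of `g ∈ G_{n,p}` on `⋀^p V_{n,p}`. -/
def extAct (a : ℕ × ℕ) (g : VInf K ≃ₗ[K] VInf K) (hg : g ∈ Gnp K a) :
    ⋀[K]^a.2 (Vnp K a.1 a.2) →ₗ[K] ⋀[K]^a.2 (Vnp K a.1 a.2) :=
  exteriorPower.map a.2 (restr a g hg)

theorem map_subtype_injective (a : ℕ × ℕ) :
    Function.Injective (ExteriorAlgebra.map (Vnp K a.1 a.2).subtype) :=
  ExteriorAlgebra.map_injective_field (Submodule.ker_subtype _)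

theorem coe_map {M N : Type u} [AddCommGroup M] [Module K M] [AddCommGroup N] [Module K N]
    (n : ℕ) (f : M →ₗ[K] N) (ω : ⋀[K]^n M) :
    (exteriorPower.map n f ω : ExteriorAlgebra K N) = ExteriorAlgebra.map f ω.1 := by
  have h : (⋀[K]^n N).subtype ∘ₗ exteriorPower.map n f =
      (ExteriorAlgebra.map f).toLinearMap ∘ₗ (⋀[K]^n M).subtype := by
    ext v
    simp [ExteriorAlgebra.map_apply_ιMulti]
  exact congr($h ω)

/-- The product `x_{p+1} ∧ ⋯ ∧ x_{p+m}` in the exterior algebra of `V_∞`. -/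
def tail (K : Type u) [Field K] (p m : ℕ) : ExteriorAlgebra K (VInf K) :=
  ((List.range' p m).map fun k => ExteriorAlgebra.ι K (x K (posIdx k))).prod

theorem tail_mul_tail (p m l : ℕ) : tail K p m * tail K (p + m) l = tail K p (m + l) := by
  rw [tail, tail, tail, ← List.prod_append, ← List.map_append]
  congr 2
  simp

theorem map_subtype_trans (a b : ℕ × ℕ) (h : a ≤ b) (ω : ⋀[K]^a.2 (Vnp K a.1 a.2)) :
    ExteriorAlgebra.map (Vnp K b.1 b.2).subtype (trans K a b h ω).1 =
      ExteriorAlgebra.map (Vnp K a.1 a.2).subtype ω.1 * tail K a.2 (b.2 - a.2) := by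
  simp only [trans, LinearMap.coe_mk, AddHom.coe_mk, map_mul, coe_map]
  congr 1
  · rw [← AlgHom.comp_apply, ExteriorAlgebra.map_comp_map, Submodule.subtype_comp_inclusion]
  · rw [exteriorPower.ιMulti_apply_coe, ExteriorAlgebra.map_apply_ιMulti,
      ExteriorAlgebra.ιMulti_apply, tail]
    congr 1
    apply List.ext_getElem
    · simp
    · intro i h₁ h₂
      simp [xpos]

theorem map_subtype_extAct (a : ℕ × ℕ) (g : VInf K ≃ₗ[K] VInf K) (hg : g ∈ Gnp K a)
    (ω : ⋀[K]^a.2 (Vnp K a.1 a.2)) :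
    ExteriorAlgebra.map (Vnp K a.1 a.2).subtype (extAct a g hg ω).1 =
      ExteriorAlgebra.map g.toLinearMap (ExteriorAlgebra.map (Vnp K a.1 a.2).subtype ω.1) := by
  rw [extAct, coe_map, ← AlgHom.comp_apply, ← AlgHom.comp_apply, ExteriorAlgebra.map_comp_map,
    ExteriorAlgebra.map_comp_map]
  rfl

theorem map_tail (a : ℕ × ℕ) (g : VInf K ≃ₗ[K] VInf K) (hg : g ∈ Gnp K a) (m : ℕ) :
    ExteriorAlgebra.map g.toLinearMap (tail K a.2 m) = tail K a.2 m := by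
  rw [tail, map_list_prod, List.map_map]
  congr 1
  refine List.map_congr_left fun k hk => ?_
  have h : g (x K (posIdx k)) = x K (posIdx k) := by
    refine hg.2 _ fun h => ?_
    have h₁ := h.2
    simp only [posIdx] at h₁
    rw [List.mem_range'_1] at hk
    omega
  simp [h]

theorem trans_trans (a b c : ℕ × ℕ) (hab : a ≤ b) (hbc : b ≤ c)
    (ω : ⋀[K]^a.2 (Vnp K a.1 a.2)) :
    trans K b c hbc (trans K a b hab ω) = trans K a c (hab.trans hbc) ω := by
  apply Subtype.ext
  apply map_subtype_injective
  have h₁ := hab.2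
  have h₂ := hbc.2
  rw [map_subtype_trans, map_subtype_trans, map_subtype_trans, mul_assoc]
  congr 1
  have := tail_mul_tail (K := K) a.2 (b.2 - a.2) (c.2 - b.2)
  rwa [Nat.add_sub_cancel' h₁, show b.2 - a.2 + (c.2 - b.2) = c.2 - a.2 by omega] at this

theorem trans_extAct (a b : ℕ × ℕ) (h : a ≤ b) (g : VInf K ≃ₗ[K] VInf K) (hg : g ∈ Gnp K a)
    (ω : ⋀[K]^a.2 (Vnp K a.1 a.2)) :
    trans K a b h (extAct a g hg ω) = extAct b g (Gnp_mono h hg) (trans K a b h ω) := by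
  apply Subtype.ext
  apply map_subtype_injective
  rw [map_subtype_trans, map_subtype_extAct, map_subtype_extAct, map_subtype_trans, map_mul,
    map_tail a g hg]

theorem toInfWedge_trans (a b : ℕ × ℕ) (h : a ≤ b) (ω : ⋀[K]^a.2 (Vnp K a.1 a.2)) :
    toInfWedge K b (trans K a b h ω) = toInfWedge K a ω :=
  Module.DirectLimit.of_f

/-- For `g ∈ G_{n',p'}` and `ω ∈ ⋀^{p''} V_{n'',p''}`, the element `g ω` of the infinite wedge:
one regards `g` as an element of `G_{n,p}` and `ω` as an element of `⋀^p V_{n,p}`, where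
`n = max n' n''` and `p = max p' p''`, and acts there. Here `c = (n', p')`, `a = (n'', p'')`. -/
def actAt (g : VInf K ≃ₗ[K] VInf K) (c : ℕ × ℕ) (hg : g ∈ Gnp K c) (a : ℕ × ℕ) :
    ⋀[K]^a.2 (Vnp K a.1 a.2) →ₗ[K] InfWedge K :=
  toInfWedge K (a ⊔ c) ∘ₗ extAct (a ⊔ c) g (Gnp_mono le_sup_right hg) ∘ₗ
    trans K a (a ⊔ c) le_sup_left

theorem actAt_trans (g : VInf K ≃ₗ[K] VInf K) (c : ℕ × ℕ) (hg : g ∈ Gnp K c) (a b : ℕ × ℕ)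
    (hab : a ≤ b) (ω : ⋀[K]^a.2 (Vnp K a.1 a.2)) :
    actAt g c hg b (trans K a b hab ω) = actAt g c hg a ω := by
  have h : a ⊔ c ≤ b ⊔ c := sup_le_sup_right hab _
  rw [actAt, actAt, LinearMap.comp_apply, LinearMap.comp_apply, LinearMap.comp_apply,
    LinearMap.comp_apply, ← toInfWedge_trans _ _ h, trans_extAct, trans_trans, trans_trans]

/-- The action of `g ∈ G_∞` on the infinite wedge. -/
def act (g : GInf K) : InfWedge K →ₗ[K] InfWedge K :=
  Module.DirectLimit.lift K (ℕ × ℕ) (fun a : ℕ × ℕ => ⋀[K]^a.2 (Vnp K a.1 a.2)) (trans K)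
    (actAt g.1 g.2.choose g.2.choose_spec) (actAt_trans g.1 g.2.choose g.2.choose_spec)

/-- The action does not depend on the level at which it is computed. -/
theorem act_toInfWedge (g : GInf K) (a : ℕ × ℕ) (hg : g.1 ∈ Gnp K a)
    (ω : ⋀[K]^a.2 (Vnp K a.1 a.2)) :
    act g (toInfWedge K a ω) = toInfWedge K a (extAct a g.1 hg ω) := by
  have h : act g (toInfWedge K a ω) = actAt g.1 g.2.choose g.2.choose_spec a ω :=
    Module.DirectLimit.lift_of _ _ _
  rw [h, actAt, LinearMap.comp_apply, LinearMap.comp_apply, ← trans_extAct (hg := hg),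
    toInfWedge_trans]

theorem exists_toInfWedge (b : ℕ × ℕ) (z : InfWedge K) :
    ∃ a, b ≤ a ∧ ∃ ω, toInfWedge K a ω = z := by
  obtain ⟨a, ω, rfl⟩ := Module.DirectLimit.exists_of z
  exact ⟨a ⊔ b, le_sup_right, trans K a _ le_sup_left ω, toInfWedge_trans _ _ _ _⟩

theorem extAct_one (a : ℕ × ℕ) : extAct a 1 (one_mem (Gnp K a)) = LinearMap.id :=
  exteriorPower.map_id

theorem extAct_mul (a : ℕ × ℕ) (g h : VInf K ≃ₗ[K] VInf K) (hg : g ∈ Gnp K a)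
    (hh : h ∈ Gnp K a) :
    extAct a (g * h) (mul_mem hg hh) = extAct a g hg ∘ₗ extAct a h hh := by
  rw [extAct, extAct, extAct, ← exteriorPower.map_comp]
  rfl

variable (K) in
/-- The infinite wedge as a representation of `G_∞`. -/
def infWedgeRep : Representation K (GInf K) (InfWedge K) where
  toFun := act
  map_one' := by
    ext1 z
    obtain ⟨a, -, ω, rfl⟩ := exists_toInfWedge 0 z
    rw [act_toInfWedge 1 a (one_mem _)]
    exact congr(toInfWedge K a ($(extAct_one a) ω))
  map_mul' g h := by
    ext1 z
    obtain ⟨b, hb⟩ := g.2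
    obtain ⟨c, hc⟩ := h.2
    obtain ⟨a, ha, ω, rfl⟩ := exists_toInfWedge (b ⊔ c) z
    have hg : g.1 ∈ Gnp K a := Gnp_mono (le_sup_left.trans ha) hb
    have hh : h.1 ∈ Gnp K a := Gnp_mono (le_sup_right.trans ha) hc
    rw [act_toInfWedge (g * h) a (mul_mem hg hh), Module.End.mul_apply, act_toInfWedge h a hh,
      act_toInfWedge g a hg]
    exact congr(toInfWedge K a ($(extAct_mul a g.1 h.1 hg hh) ω))

end Group

section Polynomials

variable (K : Type u) [Field K]

/-- The coordinate ring of the dual infinite wedge: the symmetric algebra generated by the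
infinite wedge, i.e. the polynomial ring in the variables `x_I`. -/
abbrev CoordRing : Type u := SymmetricAlgebra K (InfWedge K)

variable {K}

/-- Evaluation of polynomials at a point of the dual infinite wedge. -/
def evalAt (ω : Module.Dual K (InfWedge K)) : CoordRing K →ₐ[K] K :=
  SymmetricAlgebra.lift ω

/-- The action of `g ∈ G_∞` on polynomials, by algebra automorphisms. -/
def polyAct (g : GInf K) : CoordRing K →ₐ[K] CoordRing K :=
  SymmetricAlgebra.lift (SymmetricAlgebra.ι K (InfWedge K) ∘ₗ infWedgeRep K g)

instance : MulAction (GInf K) (CoordRing K) where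
  smul g f := polyAct g f
  one_smul f := by
    have h : polyAct (1 : GInf K) = AlgHom.id K _ := by
      apply SymmetricAlgebra.algHom_ext
      ext1 z
      simp [polyAct]
    exact congr($h f)
  mul_smul g g' f := by
    have h : polyAct (g * g') = (polyAct g).comp (polyAct g') := by
      apply SymmetricAlgebra.algHom_ext
      ext1 z
      simp [polyAct]
    exact congr($h f)

/-- The common zero set in the dual infinite wedge of a set of polynomials. -/
def zeroSet (T : Set (CoordRing K)) : Set (Module.Dual K (InfWedge K)) :=
  {ω | ∀ f ∈ T, evalAt ω f = 0}

end Polynomials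

end PluckerLimit

end

/-!
The semi-infinite monomials form a basis of the infinite wedge. They are recorded by the finite sets
`D` of indices in which they differ from the vacuum, and in the dual coordinates `z_D` the
transvection `x_k ↦ x_k + t x_i` becomes `z_D ↦ z_D ± t z_{D'}`, where `D'` arises from `D` by
moving one particle from `k` to `i`.

Since `X` is bounded, a nonzero polynomial `f` in the coordinates of `⋀² V_{n,2}`, for some `n`,
vanishes on the limit. It suffices that the largest `G_∞`-stable set on which `f` vanishes is
Noetherian up to `G_∞`. By induction on the degree of `f`, this reduces to the locus where a Hasse
derivative of `f`, of the least order `q` for which it does not vanish identically, is invertible.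
Comparing coefficients in `f` along a sequence of transvections with common parameter shows that
there the `q`-th power of every coordinate is determined by lower ones. The `q`-th power map is
additive, so all coordinates are determined by those in which at most one particle is far out on the
negative side. For these the sets `D` have bounded size, and the space with these coordinates is
Noetherian up to the transvections far out: the same elimination, by induction on the orbit types of
the sets `D`, reduces this to finitely many coordinates and Hilbert's basis theorem.
-/

noncomputable section

namespace PluckerLimit

section Noetherianity

open Set

variable {R P P' : Type*}

section

variable [Zero R]

/-- The largest `G`-stable set on which `f` vanishes. -/
def stableZeros (G : Subgroup (Equiv.Perm P)) (f : P → R) : Set P := {z | ∀ g ∈ G, f (g z) = 0}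

/-- `Z` is Noetherian up to `G` for the closed sets cut out by the functions in `F`. This is encoded
as the absence of bad sequences: if every `f j` vanishes on the orbits of all later points `z i`,
then some `f i` vanishes at `z i` too. -/
def NoetherianUpTo (G : Subgroup (Equiv.Perm P)) (F : Set (P → R)) (Z : Set P) : Prop :=
  ∀ (z : ℕ → P) (f : ℕ → P → R), (∀ i, z i ∈ Z) → (∀ i, f i ∈ F) →
    (∀ i, ∀ j < i, z i ∈ stableZeros G (f j)) → ∃ i, f i (z i) = 0

variable {G : Subgroup (Equiv.Perm P)} {F F' : Set (P → R)} {Z Z' : Set P}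

theorem apply_mem_stableZeros {f : P → R} {g : Equiv.Perm P} (hg : g ∈ G) {z : P}
    (hz : z ∈ stableZeros G f) : g z ∈ stableZeros G f :=
  fun g' hg' => hz (g' * g) (mul_mem hg' hg)

theorem inter_stableZeros_congr {f f' : P → R} (hZ : ∀ g ∈ G, MapsTo g Z Z) (h : EqOn f f' Z) :
    Z ∩ stableZeros G f = Z ∩ stableZeros G f' := by
  ext z
  exact and_congr_right fun hz => forall₂_congr fun g hg => by rw [h (hZ g hg hz)]

namespace NoetherianUpTo

theorem mono (h : NoetherianUpTo G F' Z') (hF : F ⊆ F') (hZ : Z ⊆ Z') : NoetherianUpTo G F Z :=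
  fun z f hz hf => h z f (fun i => hZ (hz i)) (fun i => hF (hf i))

theorem empty : NoetherianUpTo G F ∅ := fun _ _ hz _ => (hz 0).elim

theorem exists_apply_eq_zero_of_infinite (h : NoetherianUpTo G F Z) {z : ℕ → P} {f : ℕ → P → R}
    (hz : {i | z i ∈ Z}.Infinite) (hf : ∀ i, f i ∈ F)
    (hzf : ∀ i, ∀ j < i, z i ∈ stableZeros G (f j)) : ∃ i, f i (z i) = 0 := by
  obtain ⟨φ, hφ, hφZ⟩ := Nat.exists_strictMono_subsequence
    (P := fun i => z i ∈ Z) (fun N => (hz.exists_gt N).imp fun n hn => ⟨hn.2, hn.1⟩)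
  obtain ⟨i, hi⟩ := h (z ∘ φ) (f ∘ φ) hφZ (fun i => hf _) (fun i j hj => hzf _ _ (hφ hj))
  exact ⟨φ i, hi⟩

theorem union (h : NoetherianUpTo G F Z) (h' : NoetherianUpTo G F Z') :
    NoetherianUpTo G F (Z ∪ Z') := by
  intro z f hz hf hzf
  by_cases hinf : {i | z i ∈ Z}.Infinite
  · exact h.exists_apply_eq_zero_of_infinite hinf hf hzf
  · refine h'.exists_apply_eq_zero_of_infinite ?_ hf hzf
    exact (not_infinite.1 hinf).infinite_compl.mono fun i hi => (hz i).resolve_left hi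

theorem of_orbit (h : NoetherianUpTo G F Z') (hF : ∀ g ∈ G, ∀ f ∈ F, (fun z => f (g z)) ∈ F)
    (hZ : ∀ z ∈ Z, ∃ g ∈ G, g z ∈ Z') : NoetherianUpTo G F Z := by
  intro z f hz hf hzf
  choose g hg hgz using fun i => hZ (z i) (hz i)
  obtain ⟨i, hi⟩ := h (fun i => g i (z i)) (fun i w => f i ((g i)⁻¹ w)) hgz
    (fun i => hF _ (inv_mem (hg i)) _ (hf i)) fun i j hj g' hg' =>
      hzf i j hj _ (mul_mem (mul_mem (inv_mem (hg j)) hg') (hg i))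
  exact ⟨i, by simpa using hi⟩

theorem of_inter_stableZeros
    (h : ∀ f ∈ F, (∃ z ∈ Z, f z ≠ 0) → NoetherianUpTo G F (Z ∩ stableZeros G f)) :
    NoetherianUpTo G F Z := by
  intro z f hz hf hzf
  by_cases hne : ∃ w ∈ Z, f 0 w ≠ 0
  · obtain ⟨i, hi⟩ := h (f 0) (hf 0) hne (fun i => z (i + 1)) (fun i => f (i + 1))
      (fun i => ⟨hz _, hzf _ 0 i.succ_pos⟩) (fun i => hf _)
      fun i j hj => hzf _ _ (Nat.succ_lt_succ hj)
    exact ⟨i + 1, hi⟩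
  · push Not at hne
    exact ⟨0, hne _ (hz 0)⟩

theorem of_stableZeros_of_ne_zero {f : P → R} (hF : ∀ g ∈ G, ∀ f ∈ F, (fun z => f (g z)) ∈ F)
    (hZ : ∀ g ∈ G, MapsTo g Z Z) (hclosed : NoetherianUpTo G F (Z ∩ stableZeros G f))
    (hopen : NoetherianUpTo G F {z ∈ Z | f z ≠ 0}) : NoetherianUpTo G F Z := by
  have horbit : NoetherianUpTo G F {z | ∃ g ∈ G, g z ∈ {z ∈ Z | f z ≠ 0}} :=
    hopen.of_orbit hF fun z hz => hz
  refine (hclosed.union horbit).mono subset_rfl fun z hz => ?_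
  by_cases hzf : z ∈ stableZeros G f
  · exact Or.inl ⟨hz, hzf⟩
  · obtain ⟨g, hg, hgz⟩ : ∃ g ∈ G, f (g z) ≠ 0 := by simpa [stableZeros] using hzf
    exact Or.inr ⟨g, hg, hZ g hg hz, hgz⟩

theorem comap {G' : Subgroup (Equiv.Perm P')} {F' : Set (P' → R)} {Z' : Set P'}
    (h : NoetherianUpTo G' F' Z') (φ : P → P') (hφ : MapsTo φ Z Z')
    (hG : ∀ g' ∈ G', ∃ g ∈ G, ∀ z ∈ Z, g z ∈ Z ∧ φ (g z) = g' (φ z))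
    (hF : ∀ f ∈ F, ∃ f' ∈ F', ∀ z ∈ Z, f z = 0 ↔ f' (φ z) = 0) : NoetherianUpTo G F Z := by
  intro z f hz hf hzf
  choose f' hf' hff' using fun i => hF (f i) (hf i)
  obtain ⟨i, hi⟩ := h (fun i => φ (z i)) f' (fun i => hφ (hz i)) hf' fun i j hj g' hg' => by
    obtain ⟨g, hg, hgz⟩ := hG g' hg'
    obtain ⟨hgZ, hgφ⟩ := hgz _ (hz i)
    rw [← hgφ, ← hff' j _ hgZ]
    exact hzf i j hj g hg
  exact ⟨i, (hff' i _ (hz i)).2 hi⟩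

theorem induction (h : NoetherianUpTo G F univ) (Q : Set P → Prop)
    (step : ∀ X, (∀ f ∈ F, (∃ z ∈ X, f z ≠ 0) → Q (X ∩ stableZeros G f)) → Q X) : Q univ := by
  by_contra hQ
  have descend : ∀ X : {X // ¬ Q X}, ∃ f ∈ F, (∃ z ∈ X.1, f z ≠ 0) ∧
      ¬ Q (X.1 ∩ stableZeros G f) := by
    rintro ⟨X, hX⟩
    by_contra! hcon
    exact hX (step X fun f hf ⟨z, hz, hfz⟩ => hcon f hf ⟨z, hz, hfz⟩)
  choose f hf hz hfQ using descend
  choose z hzX hzf using hz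
  let X : ℕ → {X // ¬ Q X} := Nat.rec ⟨univ, hQ⟩ fun _ Y => ⟨Y.1 ∩ stableZeros G (f Y), hfQ Y⟩
  have hanti : Antitone fun n => (X n).1 := antitone_nat_of_succ_le fun _ => inter_subset_left
  obtain ⟨i, hi⟩ := h (fun n => z (X n)) (fun n => f (X n)) (fun _ => mem_univ _)
    (fun _ => hf _) fun i j hj => by
      have hmem : z (X i) ∈ (X (j + 1)).1 := hanti (Nat.succ_le_of_lt hj) (hzX _)
      exact hmem.2
  exact hzf _ hi

theorem exists_finset (h : NoetherianUpTo G F Z) (hZ : ∀ g ∈ G, MapsTo g Z Z) {S : Set (P → R)}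
    (hS : S ⊆ F) : ∃ T : Finset (P → R), (T : Set (P → R)) ⊆ S ∧
      ∀ z ∈ Z, (∀ f ∈ T, z ∈ stableZeros G f) → ∀ f ∈ S, z ∈ stableZeros G f := by
  classical
  by_contra! hcon
  have extend : ∀ s : Finset (P × (P → R)), (∀ x ∈ s, x.1 ∈ Z ∧ x.2 ∈ S ∧ x.2 x.1 ≠ 0) →
      ∃ y : P × (P → R), (y.1 ∈ Z ∧ y.2 ∈ S ∧ y.2 y.1 ≠ 0) ∧
        ∀ x ∈ s, y.1 ∈ stableZeros G x.2 := by
    intro s hs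
    obtain ⟨z, hz, hzs, f, hf, hzf⟩ := hcon (s.image Prod.snd) (by
      rw [Finset.coe_image]
      rintro _ ⟨x, hx, rfl⟩
      exact (hs x hx).2.1)
    obtain ⟨g, hg, hgz⟩ : ∃ g ∈ G, f (g z) ≠ 0 := by simpa [stableZeros] using hzf
    exact ⟨(g z, f), ⟨hZ g hg hz, hf, hgz⟩,
      fun x hx => apply_mem_stableZeros hg (hzs _ (Finset.mem_image_of_mem _ hx))⟩
  obtain ⟨s, hs, hsv⟩ := exists_seq_of_forall_finset_exists _
    (fun x y : P × (P → R) => y.1 ∈ stableZeros G x.2) extend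
  obtain ⟨i, hi⟩ := h (fun i => (s i).1) (fun i => (s i).2) (fun i => (hs i).1)
    (fun i => hS (hs i).2.1) fun i j hj => hsv j i hj
  exact (hs i).2.2 hi

end NoetherianUpTo

end

section PolynomialFunctions

open MvPolynomial

variable [CommRing R] {σ : Type*} {S : Set σ}

variable (R) in
/-- The functions on `σ → R` which are polynomial in the coordinates indexed by `S`. -/
def polyFun (S : Set σ) : Subalgebra R ((σ → R) → R) :=
  Algebra.adjoin R ((fun (s : σ) (z : σ → R) => z s) '' S)

theorem coord_mem_polyFun {s : σ} (hs : s ∈ S) : (fun z : σ → R => z s) ∈ polyFun R S :=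
  Algebra.subset_adjoin ⟨s, hs, rfl⟩

theorem polyFun_le_iff {A : Subalgebra R ((σ → R) → R)} :
    polyFun R S ≤ A ↔ ∀ s ∈ S, (fun z : σ → R => z s) ∈ A := by
  rw [polyFun, Algebra.adjoin_le_iff, image_subset_iff]
  rfl

theorem polyFun_mono {S' : Set σ} (h : S ⊆ S') : polyFun R S ≤ polyFun R S' :=
  Algebra.adjoin_mono (image_mono h)

theorem aeval_coord_apply (f : MvPolynomial σ R) (z : σ → R) :
    (aeval (fun (s : σ) (z : σ → R) => z s) f : (σ → R) → R) z = eval z f := by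
  have h : (Pi.evalAlgHom R (fun _ : σ → R => R) z).comp
      (aeval fun (s : σ) (z : σ → R) => z s) = aeval z := by
    ext s
    simp
  exact congr($h f)

theorem mem_polyFun {F : (σ → R) → R} :
    F ∈ polyFun R S ↔ ∃ f ∈ supported R S, ∀ z, F z = eval z f := by
  have h : polyFun R S = (supported R S).map (aeval fun (s : σ) (z : σ → R) => z s) := by
    rw [polyFun, supported, AlgHom.map_adjoin, image_image]
    simp only [aeval_X]
  simp only [h, Subalgebra.mem_map, funext_iff, aeval_coord_apply, eq_comm]

theorem eval_congr_of_mem_supported {f : MvPolynomial σ R} (hf : f ∈ supported R S) {z w : σ → R}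
    (h : EqOn z w S) : eval z f = eval w f :=
  eval₂Hom_congr' rfl (fun _ hs _ => h (mem_supported.1 hf hs)) rfl

theorem polyFun_congr {F : (σ → R) → R} (hF : F ∈ polyFun R S) {z w : σ → R} (h : EqOn z w S) :
    F z = F w := by
  obtain ⟨f, hf, hFf⟩ := mem_polyFun.1 hF
  rw [hFf, hFf, eval_congr_of_mem_supported hf h]

theorem NoetherianUpTo.of_finite [IsNoetherianRing R] (G : Subgroup (Equiv.Perm (σ → R)))
    (hS : S.Finite) : NoetherianUpTo G (polyFun R S : Set ((σ → R) → R)) univ := by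
  intro z F _ hF hzF
  have : Finite S := hS
  have exists_eval : ∀ i, ∃ f : MvPolynomial S R, ∀ z, F i z = eval (fun s : S => z s) f := by
    intro i
    obtain ⟨f, hf, hfF⟩ := mem_polyFun.1 (hF i)
    rw [supported_eq_range_rename] at hf
    obtain ⟨f', rfl⟩ := hf
    exact ⟨f', fun z => (hfF z).trans (eval_rename _ _ _)⟩
  choose f hf using exists_eval
  let I : ℕ →o Ideal (MvPolynomial S R) :=
    ⟨fun n => Ideal.span (f '' Iio n),
      fun _ _ hmn => Ideal.span_mono (image_mono (Iio_subset_Iio hmn))⟩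
  obtain ⟨n, hn⟩ := monotone_stabilizes_iff_noetherian.2
    (inferInstance : IsNoetherianRing (MvPolynomial S R)) I
  have hmem : f n ∈ I n := hn (n + 1) n.le_succ ▸ Ideal.subset_span ⟨n, n.lt_succ_self, rfl⟩
  have hker : I n ≤ RingHom.ker (eval (fun s : S => z n s)) := by
    refine Ideal.span_le.2 ?_
    rintro _ ⟨j, hj, rfl⟩
    exact (hf j _).symm.trans (hzF n j hj 1 (one_mem _))
  exact ⟨n, (hf n _).trans (hker hmem)⟩

end PolynomialFunctions

end Noetherianity

section HasseDerivative

open MvPolynomial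

variable {R σ : Type*} [CommRing R]

theorem aeval_mem_of_mem_supported {A : Type*} [CommRing A] [Algebra R A] {B : Subalgebra R A}
    {S : Set σ} {f : MvPolynomial σ R} (hf : f ∈ supported R S) {b : σ → A}
    (hb : ∀ s ∈ S, b s ∈ B) : aeval b f ∈ B := by
  have h : supported R S ≤ B.comap (aeval b) := by
    rw [supported, Algebra.adjoin_le_iff]
    rintro _ ⟨s, hs, rfl⟩
    simpa using hb s hs
  exact h hf

/-- The polynomials with coefficients in a subalgebra. -/
def coeffsIn {A : Type*} [CommRing A] [Algebra R A] (B : Subalgebra R A) :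
    Subalgebra R (Polynomial A) :=
  (Polynomial.mapAlgHom B.val).range

section CoeffsIn

variable {A : Type*} [CommRing A] [Algebra R A] {B : Subalgebra R A}

theorem coeff_mem_of_mem_coeffsIn {p : Polynomial A} (hp : p ∈ coeffsIn B) (d : ℕ) :
    p.coeff d ∈ B := by
  obtain ⟨p, rfl⟩ := hp
  simp

theorem C_mem_coeffsIn {a : A} (ha : a ∈ B) : Polynomial.C a ∈ coeffsIn B :=
  ⟨Polynomial.C ⟨a, ha⟩, by simp⟩

theorem X_mem_coeffsIn : (Polynomial.X : Polynomial A) ∈ coeffsIn B :=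
  ⟨Polynomial.X, by simp⟩

end CoeffsIn

variable [DecidableEq σ]

/-- The Taylor expansion of a polynomial in the direction of the variable `s`; the polynomial
variable is the increment. -/
def taylorAlgHom (s : σ) : MvPolynomial σ R →ₐ[R] Polynomial (MvPolynomial σ R) :=
  aeval ((fun r => Polynomial.C (X r)) + Pi.single s Polynomial.X)

/-- The Hasse derivative of order `d` with respect to the variable `s`. -/
def hasseDeriv (s : σ) (d : ℕ) (f : MvPolynomial σ R) : MvPolynomial σ R :=
  (taylorAlgHom s f).coeff d

theorem aeval_add_single {A : Type*} [CommRing A] [Algebra R A] (s : σ) (b : σ → A) (y : A)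
    (f : MvPolynomial σ R) :
    aeval (b + Pi.single s y) f =
      (taylorAlgHom s f).eval₂ (aeval b : MvPolynomial σ R →ₐ[R] A).toRingHom y := by
  have h : aeval (b + Pi.single s y) =
      (Polynomial.eval₂AlgHom (aeval (R := R) b) y fun _ => Commute.all _ _).comp
        (taylorAlgHom s) := by
    ext r
    rcases eq_or_ne r s with rfl | hr <;> simp [taylorAlgHom, *]
  exact congr($h f)

theorem hasseDeriv_monomial (s : σ) (d : ℕ) (m : σ →₀ ℕ) (a : R) :
    hasseDeriv s d (monomial m a) = monomial (m - Finsupp.single s d) (a * (m s).choose d) := by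
  have hsplit : monomial m a = monomial (m.erase s) a * X s ^ m s := by
    rw [X_pow_eq_monomial, monomial_mul, mul_one, Finsupp.erase_add_single]
  have hrest : taylorAlgHom s (monomial (m.erase s) a) =
      Polynomial.C (monomial (m.erase s) a) := by
    rw [taylorAlgHom, aeval_monomial, monomial_eq, Polynomial.C_mul, Polynomial.algebraMap_apply]
    congr 1
    rw [Finsupp.prod, Finsupp.prod, map_prod]
    refine Finset.prod_congr rfl fun r hr => ?_
    have hrs : r ≠ s := by rintro rfl; simp at hr
    simp [hrs]
  have hexp : m.erase s + Finsupp.single s (m s - d) = m - Finsupp.single s d := by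
    ext r
    rcases eq_or_ne r s with rfl | hr <;> simp [*]
  have hvar : taylorAlgHom s (X s : MvPolynomial σ R) = Polynomial.X + Polynomial.C (X s) := by
    simp [taylorAlgHom, add_comm]
  rw [hasseDeriv, hsplit, map_mul, map_pow, hrest, hvar, Polynomial.coeff_C_mul,
    Polynomial.coeff_X_add_C_pow, X_pow_eq_monomial, ← map_natCast C, mul_comm _ (C _), ← mul_assoc,
    mul_comm _ (C _), C_mul_monomial, monomial_mul, mul_one, hexp, mul_comm]

theorem coeff_hasseDeriv (s : σ) (d : ℕ) (f : MvPolynomial σ R) (n : σ →₀ ℕ) :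
    coeff n (hasseDeriv s d f) = coeff (n + Finsupp.single s d) f * ((n s + d).choose d : R) := by
  induction f using MvPolynomial.induction_on' with
  | add p q hp hq =>
    rw [hasseDeriv, map_add, Polynomial.coeff_add, coeff_add, coeff_add, add_mul, ← hp, ← hq]
    rfl
  | monomial m a =>
    rw [hasseDeriv_monomial, coeff_monomial, coeff_monomial]
    by_cases hm : m = n + Finsupp.single s d
    · subst hm
      simp
    · rw [if_neg hm, zero_mul, ite_eq_right_iff]
      rintro rfl
      have hlt : m s < d := by
        by_contra! hd
        exact hm (tsub_add_cancel_of_le (Finsupp.single_le_iff.2 hd)).symm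
      rw [Nat.choose_eq_zero_of_lt hlt, Nat.cast_zero, mul_zero]

theorem hasseDeriv_zero (s : σ) (f : MvPolynomial σ R) : hasseDeriv s 0 f = f := by
  ext n
  simp [coeff_hasseDeriv]

theorem hasseDeriv_eq_zero_of_notMem_vars {s : σ} {f : MvPolynomial σ R} (hs : s ∉ f.vars)
    {d : ℕ} (hd : d ≠ 0) : hasseDeriv s d f = 0 := by
  ext n
  rw [coeff_hasseDeriv, coeff_zero]
  by_cases hn : n + Finsupp.single s d ∈ f.support
  · exact (hs ((mem_vars_iff_mem_support _).2 ⟨_, hn, by simp [hd]⟩)).elim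
  · rw [notMem_support_iff.1 hn, zero_mul]

theorem totalDegree_hasseDeriv_lt {s : σ} {f : MvPolynomial σ R} {d : ℕ} (hd : d ≠ 0)
    (h : hasseDeriv s d f ≠ 0) : (hasseDeriv s d f).totalDegree < f.totalDegree := by
  have degree_lt : ∀ n ∈ (hasseDeriv s d f).support, n.degree < f.totalDegree := by
    intro n hn
    rw [mem_support_iff, coeff_hasseDeriv] at hn
    have hle := le_totalDegree (mem_support_iff.2 (left_ne_zero_of_mul hn))
    change (n + Finsupp.single s d).degree ≤ _ at hle
    rw [map_add, Finsupp.degree_single] at hle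
    omega
  obtain ⟨n, hn⟩ := support_nonempty.2 h
  exact (Finset.sup_lt_iff ((Nat.zero_le _).trans_lt (degree_lt n hn))).2 degree_lt

theorem hasseDeriv_mem_supported {S : Set σ} {f : MvPolynomial σ R} (hf : f ∈ supported R S)
    (s : σ) (d : ℕ) : hasseDeriv s d f ∈ supported R S := by
  refine coeff_mem_of_mem_coeffsIn (aeval_mem_of_mem_supported hf fun r hr => ?_) d
  have hC : Polynomial.C (X r) ∈ coeffsIn (supported R S) :=
    C_mem_coeffsIn (Algebra.subset_adjoin ⟨r, hr, rfl⟩)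
  rw [Pi.add_apply]
  rcases eq_or_ne r s with rfl | hrs
  · simpa only [Pi.single_eq_same] using add_mem hC X_mem_coeffsIn
  · simpa only [Pi.single_eq_of_ne hrs, add_zero] using hC

/-- The restriction of `f` to the line through `z` in the direction `s`. -/
def linePoly (s : σ) (z : σ → R) (f : MvPolynomial σ R) : Polynomial R :=
  (taylorAlgHom s f).map (eval z)

theorem coeff_linePoly (s : σ) (z : σ → R) (f : MvPolynomial σ R) (d : ℕ) :
    (linePoly s z f).coeff d = eval z (hasseDeriv s d f) :=
  Polynomial.coeff_map _ _

theorem eval_linePoly (s : σ) (z : σ → R) (f : MvPolynomial σ R) (y : R) :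
    (linePoly s z f).eval y = eval (z + Pi.single s y) f := by
  rw [linePoly, Polynomial.eval_map, ← aeval_eq_eval, aeval_add_single]
  rfl

theorem linePoly_add_single (s : σ) (z : σ → R) (f : MvPolynomial σ R) (y : R) :
    linePoly s (z + Pi.single s y) f = Polynomial.taylor y (linePoly s z f) := by
  have h : (Polynomial.mapAlgHom (aeval (z + Pi.single s y))).comp (taylorAlgHom s) =
      (Polynomial.taylorAlgHom y).comp
        ((Polynomial.mapAlgHom (aeval z)).comp (taylorAlgHom (R := R) s)) := by
    ext r : 1
    rcases eq_or_ne r s with rfl | hr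
    · simp [taylorAlgHom, add_comm, add_left_comm]
    · simp [taylorAlgHom, hr]
  exact congr($h f)

theorem eval_add_single_of_hasseDeriv_vanish {s : σ} {f : MvPolynomial σ R} {z : σ → R}
    (h : ∀ d ≠ 0, eval z (hasseDeriv s d f) = 0) (y : R) :
    eval (z + Pi.single s y) f = eval z f := by
  have hline : linePoly s z f = Polynomial.C (eval z f) := by
    ext d
    rw [coeff_linePoly, Polynomial.coeff_C]
    split_ifs with hd
    · rw [hd, hasseDeriv_zero]
    · exact h d hd
  rw [← eval_linePoly, hline, Polynomial.eval_C]

theorem eval_eq_of_hasseDeriv_vanish {S : Set σ} {f : MvPolynomial σ R} {Y : Set (σ → R)}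
    (hY : ∀ z ∈ Y, ∀ w, Set.EqOn z w Sᶜ → w ∈ Y)
    (h : ∀ s ∈ S, ∀ d ≠ 0, ∀ z ∈ Y, eval z (hasseDeriv s d f) = 0)
    {z w : σ → R} (hz : z ∈ Y) (hzw : Set.EqOn z w Sᶜ) : eval w f = eval z f := by
  classical
  have eval_piecewise : ∀ T : Finset σ, (T : Set σ) ⊆ S →
      eval (T.piecewise w z) f = eval z f := by
    intro T
    induction T using Finset.induction_on with
    | empty => simp
    | insert s T hs ih =>
      intro hT
      rw [Finset.coe_insert, Set.insert_subset_iff] at hT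
      have hmem : T.piecewise w z ∈ Y := hY z hz _ fun r hr => by
        rw [Finset.piecewise_eq_of_notMem _ _ _ fun hrT => hr (hT.2 hrT)]
      have hinsert : (insert s T).piecewise w z = T.piecewise w z + Pi.single s (w s - z s) := by
        ext r
        rcases eq_or_ne r s with rfl | hr <;> simp [Finset.piecewise, *]
      rw [hinsert, eval_add_single_of_hasseDeriv_vanish (fun d hd => h s hT.1 d hd _ hmem),
        ih hT.2]
  rw [← eval_piecewise (f.vars.filter (· ∈ S)) fun r hr => (Finset.mem_filter.1 hr).2]
  refine eval_congr_of_mem_supported (mem_supported.2 subset_rfl) fun r hr => ?_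
  by_cases hrS : r ∈ S
  · simp [Finset.piecewise, Finset.mem_coe.1 hr, hrS]
  · simpa [Finset.piecewise, hrS] using (hzw hrS).symm

section Additivity

variable [IsDomain R] [Infinite R] {s : σ} {f : MvPolynomial σ R} {Y : Set (σ → R)} {q : ℕ}

theorem choose_eq_zero_of_hasseDeriv_vanish (hY : ∀ z ∈ Y, ∀ y, z + Pi.single s y ∈ Y)
    (hlow : ∀ d ≠ 0, d < q → ∀ z ∈ Y, eval z (hasseDeriv s d f) = 0)
    {z : σ → R} (hz : z ∈ Y) (hzq : eval z (hasseDeriv s q f) ≠ 0) {d : ℕ} (hd : d ≠ 0)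
    (hdq : d < q) : (q.choose d : R) = 0 := by
  have h : Polynomial.hasseDeriv d (linePoly s z f) = 0 := by
    refine Polynomial.funext fun y => ?_
    rw [← Polynomial.taylor_coeff, ← linePoly_add_single, coeff_linePoly,
      hlow d hd hdq _ (hY z hz y), Polynomial.eval_zero]
  have hcoeff := congr(($h).coeff (q - d))
  rw [Polynomial.hasseDeriv_coeff, Nat.sub_add_cancel hdq.le, coeff_linePoly,
    Polynomial.coeff_zero] at hcoeff
  exact (mul_eq_zero.1 hcoeff).resolve_right hzq

/-- In characteristic `p` this makes `q` a power of `p`, and in characteristic zero `q = 1`. -/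
theorem add_pow_of_hasseDeriv_vanish (hY : ∀ z ∈ Y, ∀ y, z + Pi.single s y ∈ Y) (hq : q ≠ 0)
    (hlow : ∀ d ≠ 0, d < q → ∀ z ∈ Y, eval z (hasseDeriv s d f) = 0)
    {z : σ → R} (hz : z ∈ Y) (hzq : eval z (hasseDeriv s q f) ≠ 0) (a b : R) :
    (a + b) ^ q = a ^ q + b ^ q := by
  rw [add_pow, Finset.sum_range_succ, Finset.sum_eq_single_of_mem 0 (by simp; omega)]
  · simp [add_comm]
  · intro d hd hd0
    rw [choose_eq_zero_of_hasseDeriv_vanish hY hlow hz hzq hd0 (Finset.mem_range.1 hd), mul_zero]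

end Additivity

end HasseDerivative

section Elimination

open MvPolynomial

variable {K σ : Type*}

theorem polynomial_eval_aeval [CommRing K] (t : K) (b : σ → Polynomial K) (f : MvPolynomial σ K) :
    (aeval b f).eval t = eval (fun r => (b r).eval t) f := by
  rw [← aeval_eq_eval, ← Polynomial.coe_aeval_eq_eval]
  exact comp_aeval_apply _ (Polynomial.aeval t : Polynomial K →ₐ[K] K) f

theorem coeff_aeval_add_single [CommRing K] [DecidableEq σ] {f : MvPolynomial σ K} {s : σ}
    {q N : ℕ} (hq : q ≠ 0) (hN : N ≠ 0) (b : σ → Polynomial K) (ζ : K)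
    (hlow : ∀ d ≠ 0, d < q → aeval b (hasseDeriv s d f) = 0) :
    (aeval (b + Pi.single s (Polynomial.C ζ * Polynomial.X ^ N)) f).coeff (N * q) =
      (aeval b f).coeff (N * q) + (aeval b (hasseDeriv s q f)).coeff 0 * ζ ^ q := by
  have hsum : aeval (b + Pi.single s (Polynomial.C ζ * Polynomial.X ^ N)) f =
      ∑ d ∈ Finset.range (max (taylorAlgHom s f).natDegree q + 1),
        aeval b (hasseDeriv s d f) * (Polynomial.C ζ * Polynomial.X ^ N) ^ d := by
    rw [aeval_add_single, Polynomial.eval₂_eq_sum_range' _ (Nat.lt_succ_of_le (le_max_left _ q))]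
    rfl
  have hterm : ∀ d, (aeval b (hasseDeriv s d f) *
        (Polynomial.C ζ * Polynomial.X ^ N) ^ d).coeff (N * q) =
      if N * d ≤ N * q then (aeval b (hasseDeriv s d f)).coeff (N * q - N * d) * ζ ^ d
      else 0 := by
    intro d
    rw [mul_pow, ← pow_mul, ← Polynomial.C_pow, ← mul_assoc, Polynomial.coeff_mul_X_pow',
      Polynomial.coeff_mul_C]
  have hsub : ({0, q} : Finset ℕ) ⊆
      Finset.range (max (taylorAlgHom s f).natDegree q + 1) := by
    simp [Finset.insert_subset_iff]
  rw [hsum, Polynomial.finsetSum_coeff, ← Finset.sum_subset hsub, Finset.sum_pair hq.symm,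
    hterm, hterm]
  · simp [hasseDeriv_zero]
  · intro d _ hd
    simp only [Finset.mem_insert, Finset.mem_singleton, not_or] at hd
    rcases lt_or_gt_of_ne hd.2 with hlt | hgt
    · rw [hlow d hd.1 hlt, zero_mul, Polynomial.coeff_zero]
    · rw [hterm, if_neg (not_le.2 (Nat.mul_lt_mul_of_pos_left hgt hN.bot_lt))]

/-- The value at the point `z` and the parameter `t` of a polynomial whose coefficients are
functions on the space of points. -/
def evalAtPoint [CommRing K] (z : σ → K) (t : K) : Polynomial ((σ → K) → K) →+* K :=
  Polynomial.eval₂RingHom (Pi.evalRingHom _ z) t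

theorem evalAtPoint_C [CommRing K] (z : σ → K) (t : K) (F : (σ → K) → K) :
    evalAtPoint z t (Polynomial.C F) = F z := by
  simp [evalAtPoint]

theorem evalAtPoint_X [CommRing K] (z : σ → K) (t : K) : evalAtPoint z t Polynomial.X = t := by
  simp [evalAtPoint]

section

variable [CommRing K] [IsDomain K] [Infinite K]

/-- If `f` vanishes along all deformations of points of `Z` whose leading term `ζ z * t ^ N` only
occurs in the coordinate `s`, then comparing coefficients of `t ^ (N * q)` expresses `ζ ^ q` times a
Hasse derivative of `f` through the lower terms of the deformation. -/
theorem exists_elimination [DecidableEq σ] {A : Subalgebra K ((σ → K) → K)} {Z : Set (σ → K)}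
    {S : Set σ} {f : MvPolynomial σ K} (hf : f ∈ supported K S) {s : σ} {q N : ℕ} (hq : q ≠ 0)
    (hN : N ≠ 0) (B : σ → Polynomial ((σ → K) → K)) (ζ : (σ → K) → K)
    (hB : ∀ r ∈ S, B r ∈ coeffsIn A) (hB0 : ∀ r ∈ S, (B r).coeff 0 = fun z => z r)
    (hvanish : ∀ z ∈ Z, ∀ t,
      eval ((fun r => evalAtPoint z t (B r)) + Pi.single s (ζ z * t ^ N)) f = 0)
    (hlow : ∀ d ≠ 0, d < q → ∀ z ∈ Z, ∀ t,
      eval (fun r => evalAtPoint z t (B r)) (hasseDeriv s d f) = 0) :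
    ∃ p ∈ A, ∀ z ∈ Z, eval z (hasseDeriv s q f) * ζ z ^ q = p z := by
  refine ⟨-(aeval B f).coeff (N * q),
    neg_mem (coeff_mem_of_mem_coeffsIn (aeval_mem_of_mem_supported hf hB) _), fun z hz => ?_⟩
  let b : σ → Polynomial K := fun r => (B r).map (Pi.evalRingHom (fun _ : σ → K => K) z)
  have eval_b : ∀ (t : K) (r : σ), (b r).eval t = evalAtPoint z t (B r) :=
    fun t r => Polynomial.eval_map _ _
  have hlow' : ∀ d ≠ 0, d < q → aeval b (hasseDeriv s d f) = 0 := fun d hd hdq =>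
    Polynomial.funext fun t => by
      simpa only [polynomial_eval_aeval, eval_b, Polynomial.eval_zero] using hlow d hd hdq z hz t
  have hvanish' : aeval (b + Pi.single s (Polynomial.C (ζ z) * Polynomial.X ^ N)) f = 0 := by
    refine Polynomial.funext fun t => ?_
    rw [polynomial_eval_aeval, Polynomial.eval_zero, ← hvanish z hz t]
    congr 2
    ext r
    rcases eq_or_ne r s with rfl | hr <;> simp [*]
  have haeval : aeval b f = (aeval B f).map (Pi.evalRingHom (fun _ : σ → K => K) z) :=
    (comp_aeval_apply _ (Polynomial.mapAlgHom (Pi.evalAlgHom K (fun _ : σ → K => K) z)) f).symm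
  have hconst : (aeval b (hasseDeriv s q f)).coeff 0 = eval z (hasseDeriv s q f) := by
    rw [Polynomial.coeff_zero_eq_eval_zero, polynomial_eval_aeval]
    refine eval_congr_of_mem_supported (hasseDeriv_mem_supported hf s q) fun r hr => ?_
    rw [← Polynomial.coeff_zero_eq_eval_zero, Polynomial.coeff_map, hB0 r hr]
    rfl
  have hcoeff := coeff_aeval_add_single hq hN b (ζ z) hlow'
  rw [hvanish', Polynomial.coeff_zero, hconst, haeval, Polynomial.coeff_map] at hcoeff
  exact eq_neg_of_add_eq_zero_right hcoeff.symm

end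

/-- The functions which agree, on `Z`, up to powers of `h` and iterated `q`-th roots, with elements
of `A`. The `q`-th power map is assumed to be additive. -/
def rootClosure [CommRing K] (A : Subalgebra K ((σ → K) → K)) (Z : Set (σ → K)) (h : (σ → K) → K)
    (hh : h ∈ A) (q : ℕ) (hq : ∀ a b : K, (a + b) ^ q = a ^ q + b ^ q) :
    Subalgebra K ((σ → K) → K) where
  carrier := {F | ∃ e M : ℕ, ∃ F' ∈ A, ∀ z ∈ Z, F' z = h z ^ M * F z ^ q ^ e}
  mul_mem' := by
    rintro F₁ F₂ ⟨e₁, M₁, F₁', hF₁', h₁⟩ ⟨e₂, M₂, F₂', hF₂', h₂⟩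
    refine ⟨e₁ + e₂, M₁ * q ^ e₂ + M₂ * q ^ e₁, F₁' ^ q ^ e₂ * F₂' ^ q ^ e₁,
      mul_mem (pow_mem hF₁' _) (pow_mem hF₂' _), fun z hz => ?_⟩
    simp only [Pi.mul_apply, Pi.pow_apply, h₁ z hz, h₂ z hz]
    ring
  add_mem' := by
    rintro F₁ F₂ ⟨e₁, M₁, F₁', hF₁', h₁⟩ ⟨e₂, M₂, F₂', hF₂', h₂⟩
    have add_pow_pow : ∀ (e : ℕ) (a b : K), (a + b) ^ q ^ e = a ^ q ^ e + b ^ q ^ e := by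
      intro e
      induction e with
      | zero => simp
      | succ e ih => intro a b; rw [pow_succ, pow_mul, pow_mul, pow_mul, ih, hq]
    refine ⟨e₁ + e₂, M₁ * q ^ e₂ + M₂ * q ^ e₁,
      h ^ (M₂ * q ^ e₁) * F₁' ^ q ^ e₂ + h ^ (M₁ * q ^ e₂) * F₂' ^ q ^ e₁,
      add_mem (mul_mem (pow_mem hh _) (pow_mem hF₁' _)) (mul_mem (pow_mem hh _) (pow_mem hF₂' _)),
      fun z hz => ?_⟩
    simp only [Pi.add_apply, Pi.mul_apply, Pi.pow_apply, h₁ z hz, h₂ z hz, add_pow_pow]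
    ring
  algebraMap_mem' a := ⟨0, 0, algebraMap K _ a, A.algebraMap_mem a, fun z _ => by simp⟩

section RootClosure

variable [CommRing K] {A : Subalgebra K ((σ → K) → K)} {Z : Set (σ → K)} {h : (σ → K) → K}
    {hh : h ∈ A} {q : ℕ} {hq : ∀ a b : K, (a + b) ^ q = a ^ q + b ^ q}

theorem mem_rootClosure {F : (σ → K) → K} : F ∈ rootClosure A Z h hh q hq ↔
    ∃ e M : ℕ, ∃ F' ∈ A, ∀ z ∈ Z, F' z = h z ^ M * F z ^ q ^ e := Iff.rfl

theorem le_rootClosure : A ≤ rootClosure A Z h hh q hq := fun F hF =>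
  mem_rootClosure.2 ⟨0, 0, F, hF, fun z _ => by simp⟩

theorem mem_rootClosure_of_mul_pow {F p : (σ → K) → K} (hp : p ∈ rootClosure A Z h hh q hq)
    (hF : ∀ z ∈ Z, h z * F z ^ q = p z) : F ∈ rootClosure A Z h hh q hq := by
  obtain ⟨e, M, p', hp', hpp'⟩ := mem_rootClosure.1 hp
  refine mem_rootClosure.2 ⟨e + 1, M + q ^ e, p', hp', fun z hz => ?_⟩
  rw [hpp' z hz, ← hF z hz]
  ring

theorem exists_zero_iff_of_mem_rootClosure [IsDomain K] (hZ : ∀ z ∈ Z, h z ≠ 0) (hq0 : q ≠ 0)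
    {F : (σ → K) → K} (hF : F ∈ rootClosure A Z h hh q hq) :
    ∃ F' ∈ A, ∀ z ∈ Z, (F z = 0 ↔ F' z = 0) := by
  obtain ⟨e, M, F', hF', hFF'⟩ := mem_rootClosure.1 hF
  refine ⟨F', hF', fun z hz => ?_⟩
  rw [hFF' z hz, mul_eq_zero, or_iff_right (pow_ne_zero _ (hZ z hz)),
    pow_eq_zero_iff (pow_ne_zero _ hq0)]

end RootClosure

end Elimination

section Moves

/-- A semi-infinite monomial `x_I` is recorded by the symmetric difference `D` of `I` and
`{1, 2, 3, …}`. The index `k` is occupied if it lies in `I`. -/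
def Occupied (k : Idx) (D : Finset Idx) : Prop := k ∈ D ↔ k.1 < 0

instance (k : Idx) (D : Finset Idx) : Decidable (Occupied k D) :=
  inferInstanceAs (Decidable (k ∈ D ↔ k.1 < 0))

/-- The move `m` replaces the occupied index `m.1` by the vacant index `m.2`; since the empty set
stands for the vacuum, this toggles both indices. -/
def move (m : Idx × Idx) (D : Finset Idx) : Finset Idx := symmDiff D {m.1, m.2}

/-- The move `m` replaces an occupied index by a vacant one. -/
def CanMove (m : Idx × Idx) (D : Finset Idx) : Prop := Occupied m.1 D ∧ ¬ Occupied m.2 D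

instance (m : Idx × Idx) (D : Finset Idx) : Decidable (CanMove m D) :=
  inferInstanceAs (Decidable (_ ∧ _))

variable {m : Idx × Idx} {D D' : Finset Idx} {k : Idx}

theorem mem_move :
    k ∈ move m D ↔ (k ∈ D ∧ k ≠ m.1 ∧ k ≠ m.2) ∨ (k ∉ D ∧ (k = m.1 ∨ k = m.2)) := by
  simp only [move, Finset.mem_symmDiff, Finset.mem_insert, Finset.mem_singleton]
  tauto

theorem move_move (m : Idx × Idx) (D : Finset Idx) : move m (move m D) = D := by
  simp [move]

theorem occupied_move_of_ne (h1 : k ≠ m.1) (h2 : k ≠ m.2) :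
    Occupied k (move m D) ↔ Occupied k D := by
  simp only [Occupied, mem_move]
  tauto

theorem occupied_move_fst : Occupied m.1 (move m D) ↔ ¬ Occupied m.1 D := by
  simp only [Occupied, mem_move]
  tauto

theorem occupied_move_snd : Occupied m.2 (move m D) ↔ ¬ Occupied m.2 D := by
  simp only [Occupied, mem_move]
  tauto

theorem not_canMove_move (h : CanMove m D) : ¬ CanMove m (move m D) :=
  fun h' => occupied_move_fst.1 h'.1 h.1

theorem ext_occupied (h : ∀ k, Occupied k D ↔ Occupied k D') : D = D' := by
  ext k
  have hk := h k
  simp only [Occupied] at hk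
  tauto

/-- All moves of the list can be carried out, in order, starting from `D` and ending at `D'`. -/
def IsPath : List (Idx × Idx) → Finset Idx → Finset Idx → Prop
  | [], D, D' => D = D'
  | m :: ps, D, D' => CanMove m D ∧ IsPath ps (move m D) D'

theorem IsPath.append_singleton {ps : List (Idx × Idx)} (h : IsPath ps D D') (hm : CanMove m D') :
    IsPath (ps ++ [m]) D (move m D') := by
  induction ps generalizing D with
  | nil =>
    obtain rfl : D = D' := h
    exact ⟨hm, rfl⟩
  | cons a ps ih => exact ⟨h.1, ih h.2⟩

theorem IsPath.exists_symmDiff (ps : List (Idx × Idx)) :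
    ∃ X : Finset Idx, ∀ D D', IsPath ps D D' → D' = symmDiff D X := by
  induction ps with
  | nil =>
    refine ⟨∅, fun D D' h => ?_⟩
    rw [← Finset.bot_eq_empty, symmDiff_bot]
    exact Eq.symm h
  | cons m ps ih =>
    obtain ⟨X, hX⟩ := ih
    refine ⟨symmDiff {m.1, m.2} X, fun D D' h => ?_⟩
    rw [hX _ _ h.2, move, symmDiff_assoc]

/-- A grading of a set `W` of monomials which is stable under the moves in `ps`, for which each of
these moves is homogeneous of positive weight. -/
structure IsGraded (ps : List (Idx × Idx)) (W : Set (Finset Idx)) (v : Finset Idx → ℕ)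
    (wt : Idx × Idx → ℕ) : Prop where
  move_mem : ∀ m ∈ ps, ∀ D ∈ W, CanMove m D → move m D ∈ W
  degree_move : ∀ m ∈ ps, ∀ D ∈ W, CanMove m D → v (move m D) = v D + wt m
  weight_pos : ∀ m ∈ ps, 0 < wt m

section IsGraded

variable {ps : List (Idx × Idx)} {W : Set (Finset Idx)} {v : Finset Idx → ℕ} {wt : Idx × Idx → ℕ}

theorem IsGraded.tail (h : IsGraded (m :: ps) W v wt) : IsGraded ps W v wt :=
  ⟨fun a ha => h.move_mem a (List.mem_cons_of_mem _ ha),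
    fun a ha => h.degree_move a (List.mem_cons_of_mem _ ha),
    fun a ha => h.weight_pos a (List.mem_cons_of_mem _ ha)⟩

theorem IsGraded.target (h : IsGraded ps W v wt) (hD : D ∈ W) (hp : IsPath ps D D') :
    D' ∈ W ∧ v D' = v D + (ps.map wt).sum := by
  induction ps generalizing D with
  | nil =>
    obtain rfl : D = D' := hp
    exact ⟨hD, by simp⟩
  | cons m ps ih =>
    obtain ⟨hW, hv⟩ := ih h.tail (h.move_mem m List.mem_cons_self D hD hp.1) hp.2
    rw [h.degree_move m List.mem_cons_self D hD hp.1] at hv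
    rw [hv, List.map_cons, List.sum_cons, add_assoc]
    exact ⟨hW, rfl⟩

end IsGraded

end Moves

section Transvections

open MvPolynomial

variable {K : Type*}

/-- The action of the transvection `x_k ↦ x_k + t x_i`, with `m = (k, i)`, on the points of the dual
infinite wedge, given by their coordinates. The signs `ε` come from reordering the wedge factors. -/
def transvection [CommRing K] (ε : Idx × Idx → Finset Idx → K) (m : Idx × Idx) (t : K) :
    Equiv.Perm (Finset Idx → K) where
  toFun z D := z D + if CanMove m D then t * ε m D * z (move m D) else 0
  invFun z D := z D + if CanMove m D then -t * ε m D * z (move m D) else 0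
  left_inv z := by
    ext D
    by_cases h : CanMove m D <;> simp [h, not_canMove_move]
  right_inv z := by
    ext D
    by_cases h : CanMove m D <;> simp [h, not_canMove_move]

section

variable [CommRing K] {ε : Idx × Idx → Finset Idx → K}

theorem transvection_apply (m : Idx × Idx) (t : K) (z : Finset Idx → K) (D : Finset Idx) :
    transvection ε m t z D = z D + if CanMove m D then t * ε m D * z (move m D) else 0 := rfl

theorem inv_transvection (m : Idx × Idx) (t : K) :
    (transvection ε m t)⁻¹ = transvection ε m (-t) := Equiv.ext fun _ => rfl

variable (ε) in
/-- The product of a sequence of transvections with common parameter. -/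
def pathPerm (t : K) (ps : List (Idx × Idx)) : Equiv.Perm (Finset Idx → K) :=
  (ps.map fun m => transvection ε m t).prod

variable (ε) in
/-- The coordinate indexed by `D` after a sequence of transvections with common parameter, as a
polynomial in that parameter. -/
def pathPoly : List (Idx × Idx) → Finset Idx → Polynomial ((Finset Idx → K) → K)
  | [], D => Polynomial.C fun z => z D
  | m :: ps, D => pathPoly ps D +
      if CanMove m D then
        Polynomial.X * Polynomial.C (algebraMap K _ (ε m D)) * pathPoly ps (move m D)
      else 0

theorem evalAtPoint_pathPoly (ps : List (Idx × Idx)) (D : Finset Idx) (z : Finset Idx → K)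
    (t : K) : evalAtPoint z t (pathPoly ε ps D) = pathPerm ε t ps z D := by
  induction ps generalizing D with
  | nil => simp [pathPoly, pathPerm, evalAtPoint_C]
  | cons m ps ih =>
    have hcons : pathPerm ε t (m :: ps) z = transvection ε m t (pathPerm ε t ps z) := by
      simp [pathPerm, Equiv.Perm.mul_apply]
    rw [hcons, transvection_apply, ← ih, pathPoly, map_add]
    congr 1
    split_ifs
    · rw [map_mul, map_mul, evalAtPoint_X, evalAtPoint_C, ih]
      rfl
    · exact map_zero _

theorem coeff_zero_pathPoly (ps : List (Idx × Idx)) (D : Finset Idx) :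
    (pathPoly ε ps D).coeff 0 = fun z => z D := by
  induction ps generalizing D with
  | nil => simp [pathPoly]
  | cons m ps ih =>
    rw [pathPoly, Polynomial.coeff_add, ih]
    split_ifs
    · simp [mul_assoc]
    · simp

variable {A : Subalgebra K ((Finset Idx → K) → K)} {ps : List (Idx × Idx)}
  {W : Set (Finset Idx)} {v : Finset Idx → ℕ} {wt : Idx × Idx → ℕ} {D : Finset Idx}

theorem pathPoly_mem_coeffsIn (h : IsGraded ps W v wt) (hD : D ∈ W)
    (hA : ∀ D' ∈ W, v D' < v D + (ps.map wt).sum → (fun z => z D') ∈ A)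
    (htarget : ∀ D', IsPath ps D D' → (fun z => z D') ∈ A) : pathPoly ε ps D ∈ coeffsIn A := by
  induction ps generalizing D with
  | nil => exact C_mem_coeffsIn (htarget D rfl)
  | cons m ps ih =>
    have hpos := h.weight_pos m List.mem_cons_self
    simp only [List.map_cons, List.sum_cons] at hA
    have hskip : pathPoly ε ps D ∈ coeffsIn A :=
      ih h.tail hD (fun D' hD' hv => hA D' hD' (by omega)) fun D' hD' => by
        obtain ⟨hW, hv⟩ := h.tail.target hD hD'
        exact hA D' hW (by omega)
    refine add_mem hskip ?_
    split_ifs with hm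
    · refine mul_mem (mul_mem X_mem_coeffsIn (C_mem_coeffsIn (A.algebraMap_mem _))) ?_
      refine ih h.tail (h.move_mem m List.mem_cons_self D hD hm) (fun D' hD' hv => hA D' hD' ?_)
        fun D' hD' => htarget D' ⟨hm, hD'⟩
      rw [h.degree_move m List.mem_cons_self D hD hm] at hv
      omega
    · exact zero_mem _

theorem exists_pathPoly_eq_add [IsDomain K] (hε : ∀ m D, ε m D ≠ 0) (h : IsGraded ps W v wt)
    {D' : Finset Idx} (hD : D ∈ W)
    (hA : ∀ D'' ∈ W, v D'' < v D + (ps.map wt).sum → (fun z => z D'') ∈ A)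
    (hp : IsPath ps D D') :
    ∃ B ∈ coeffsIn A, ∃ c : K, c ≠ 0 ∧
      pathPoly ε ps D = B + Polynomial.C (fun z => c * z D') * Polynomial.X ^ ps.length := by
  induction ps generalizing D with
  | nil =>
    obtain rfl : D = D' := hp
    exact ⟨0, zero_mem _, 1, one_ne_zero, by simp [pathPoly]⟩
  | cons m ps ih =>
    have hpos := h.weight_pos m List.mem_cons_self
    have hmove := h.degree_move m List.mem_cons_self D hD hp.1
    simp only [List.map_cons, List.sum_cons] at hA
    obtain ⟨B, hB, c, hc, hBc⟩ := ih h.tail (h.move_mem m List.mem_cons_self D hD hp.1)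
      (fun D' hD' hv => hA D' hD' (by omega)) hp.2
    have hskip : pathPoly ε ps D ∈ coeffsIn A :=
      pathPoly_mem_coeffsIn h.tail hD (fun D' hD' hv => hA D' hD' (by omega)) fun D' hD' => by
        obtain ⟨hW, hv⟩ := h.tail.target hD hD'
        exact hA D' hW (by omega)
    refine ⟨pathPoly ε ps D + Polynomial.X * Polynomial.C (algebraMap K _ (ε m D)) * B,
      add_mem hskip
        (mul_mem (mul_mem X_mem_coeffsIn (C_mem_coeffsIn (A.algebraMap_mem _))) hB),
      ε m D * c, mul_ne_zero (hε _ _) hc, ?_⟩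
    have hC : Polynomial.C (fun z : Finset Idx → K => ε m D * c * z D') =
        Polynomial.C (algebraMap K _ (ε m D)) * Polynomial.C fun z => c * z D' := by
      rw [← Polynomial.C_mul]
      congr 1
      ext z
      exact mul_assoc _ _ _
    rw [pathPoly, if_pos hp.1, hBc, List.length_cons, hC]
    ring

end

theorem exists_hasseDeriv_mul_pow_eq [Field K] [Infinite K] {ε : Idx × Idx → Finset Idx → K}
    {A : Subalgebra K ((Finset Idx → K) → K)} {Z : Set (Finset Idx → K)}
    {f : MvPolynomial (Finset Idx) K} {s D' : Finset Idx} {q : ℕ} (hq : q ≠ 0)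
    {ps : List (Idx × Idx)} (hps : ps ≠ [])
    (hs : ∃ B ∈ coeffsIn A, ∃ c : K, c ≠ 0 ∧
      pathPoly ε ps s = B + Polynomial.C (fun z => c * z D') * Polynomial.X ^ ps.length)
    (hr : ∀ r ∈ f.vars, r ≠ s → pathPoly ε ps r ∈ coeffsIn A)
    (hvanish : ∀ z ∈ Z, ∀ t, eval (pathPerm ε t ps z) f = 0)
    (hlow : ∀ d ≠ 0, d < q → ∀ z ∈ Z, ∀ t, ∀ w : Finset Idx → K,
      Set.EqOn (pathPerm ε t ps z) w {s}ᶜ → eval w (hasseDeriv s d f) = 0) :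
    ∃ p ∈ A, ∀ z ∈ Z, eval z (hasseDeriv s q f) * z D' ^ q = p z := by
  obtain ⟨B, hB, c, hc, hBc⟩ := hs
  have hlen : ps.length ≠ 0 := by simpa using hps
  have hB0 : B.coeff 0 = fun z => z s := by
    simpa [hBc, hlen.symm] using coeff_zero_pathPoly (ε := ε) ps s
  let b : Finset Idx → Polynomial ((Finset Idx → K) → K) :=
    Function.update (pathPoly ε ps) s B
  have hvanish' : ∀ z ∈ Z, ∀ t, eval ((fun r => evalAtPoint z t (b r)) +
      Pi.single s (c * z D' * t ^ ps.length)) f = 0 := by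
    intro z hz t
    rw [← hvanish z hz t]
    congr 2
    ext r
    rw [← evalAtPoint_pathPoly]
    rcases eq_or_ne r s with rfl | hrs
    · simp [b, hBc, evalAtPoint_C, evalAtPoint_X]
    · simp [b, hrs]
  obtain ⟨p, hp, hpz⟩ := exists_elimination (A := A) (mem_supported.2 subset_rfl) hq hlen b
    (fun z => c * z D')
    (fun r hrf => by
      rcases eq_or_ne r s with rfl | hrs
      · simpa [b] using hB
      · simpa [b, hrs] using hr r hrf hrs)
    (fun r _ => by
      rcases eq_or_ne r s with rfl | hrs
      · simpa [b] using hB0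
      · simpa [b, hrs] using coeff_zero_pathPoly ps r)
    hvanish' fun d hd hdq z hz t => hlow d hd hdq z hz t _ fun r hrs => by
      have hrs : r ≠ s := hrs
      simp [b, hrs, evalAtPoint_pathPoly]
  refine ⟨(c ^ q)⁻¹ • p, A.smul_mem hp _, fun z hz => ?_⟩
  rw [Pi.smul_apply, ← hpz z hz, smul_eq_mul, mul_pow]
  field_simp

end Transvections

section TransvectionGroup

open MvPolynomial

variable {K : Type*} [CommRing K] {ε : Idx × Idx → Finset Idx → K} {M : Set (Idx × Idx)}

variable (ε) in
/-- The group generated by the transvections with indices in `M`. -/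
def transvectionGroup (M : Set (Idx × Idx)) : Subgroup (Equiv.Perm (Finset Idx → K)) :=
  Subgroup.closure {g | ∃ m ∈ M, ∃ t, g = transvection ε m t}

/-- The pairs of indices of the same sign outside `[-n, n]`. -/
def outerMoves (n : ℕ) : Set (Idx × Idx) :=
  {m | (m.1.1 < 0 ↔ m.2.1 < 0) ∧ n < m.1.1.natAbs ∧ n < m.2.1.natAbs}

theorem outerMoves_anti {n n' : ℕ} (h : n ≤ n') : outerMoves n' ⊆ outerMoves n :=
  fun _ hm => ⟨hm.1, h.trans_lt hm.2.1, h.trans_lt hm.2.2⟩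

theorem transvectionGroup_mono {M' : Set (Idx × Idx)} (h : M ⊆ M') :
    transvectionGroup ε M ≤ transvectionGroup ε M' :=
  Subgroup.closure_mono fun _ ⟨m, hm, t, ht⟩ => ⟨m, h hm, t, ht⟩

theorem transvection_mem {m : Idx × Idx} (hm : m ∈ M) (t : K) :
    transvection ε m t ∈ transvectionGroup ε M :=
  Subgroup.subset_closure ⟨m, hm, t, rfl⟩

theorem pathPerm_mem {ps : List (Idx × Idx)} (t : K) (h : ∀ m ∈ ps, m ∈ M) :
    pathPerm ε t ps ∈ transvectionGroup ε M := by
  refine Subgroup.list_prod_mem _ fun g hg => ?_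
  obtain ⟨m, hm, rfl⟩ := List.mem_map.1 hg
  exact transvection_mem (h m hm) t

theorem polyFun_comp_transvection {S : Set (Finset Idx)} {m : Idx × Idx}
    (hS : ∀ D ∈ S, CanMove m D → move m D ∈ S) (t : K) :
    ∀ F ∈ polyFun K S, (fun z => F (transvection ε m t z)) ∈ polyFun K S := by
  let φ : ((Finset Idx → K) → K) →ₐ[K] ((Finset Idx → K) → K) :=
    AlgHom.pi fun z => Pi.evalAlgHom K _ (transvection ε m t z)
  have h : polyFun K S ≤ (polyFun K S).comap φ := by
    refine polyFun_le_iff.2 fun D hD => ?_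
    have hφ : φ (fun z => z D) = (fun z => z D) + if CanMove m D then
        (t * ε m D) • (fun z : Finset Idx → K => z (move m D)) else 0 := by
      ext z
      simp only [φ, AlgHom.pi_apply, Pi.evalAlgHom_apply, transvection_apply, Pi.add_apply]
      split_ifs <;> simp
    rw [Subalgebra.mem_comap, hφ]
    refine add_mem (coord_mem_polyFun hD) ?_
    split_ifs with hm
    · exact Subalgebra.smul_mem _ (coord_mem_polyFun (hS D hD hm)) _
    · exact zero_mem _
  exact fun F hF => h hF

theorem polyFun_comp_transvectionGroup {S : Set (Finset Idx)}
    (hS : ∀ m ∈ M, ∀ D ∈ S, CanMove m D → move m D ∈ S) {g : Equiv.Perm (Finset Idx → K)}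
    (hg : g ∈ transvectionGroup ε M) :
    ∀ F ∈ polyFun K S, (fun z => F (g z)) ∈ polyFun K S := by
  induction hg using Subgroup.closure_induction'' with
  | mem x hx =>
    obtain ⟨m, hm, t, rfl⟩ := hx
    exact polyFun_comp_transvection (hS m hm) t
  | inv_mem x hx =>
    obtain ⟨m, hm, t, rfl⟩ := hx
    rw [inv_transvection]
    exact polyFun_comp_transvection (hS m hm) (-t)
  | one => exact fun F hF => hF
  | mul x _ _ _ hx hy => exact fun F hF => hy _ (hx F hF)

theorem apply_of_mem_transvectionGroup_outerMoves {n : ℕ} {D : Finset Idx}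
    (hD : ∀ k ∈ D, k.1.natAbs ≤ n) {g : Equiv.Perm (Finset Idx → K)}
    (hg : g ∈ transvectionGroup ε (outerMoves n)) (z : Finset Idx → K) : g z D = z D := by
  induction hg using Subgroup.closure_induction generalizing z with
  | mem x hx =>
    obtain ⟨m, ⟨hsign, hfst, hsnd⟩, t, rfl⟩ := hx
    rw [transvection_apply, if_neg, add_zero]
    rintro ⟨h1, h2⟩
    have notMem_fst : m.1 ∉ D := fun h => (hD _ h).not_gt hfst
    have notMem_snd : m.2 ∉ D := fun h => (hD _ h).not_gt hsnd
    simp only [Occupied, notMem_fst, notMem_snd, false_iff] at h1 h2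
    exact h2 fun h => h1 (hsign.2 h)
  | one => rfl
  | mul x y _ _ hx hy => rw [Equiv.Perm.mul_apply, hx, hy]
  | inv x _ hx =>
    rw [← hx (x⁻¹ z), ← Equiv.Perm.mul_apply, mul_inv_cancel, Equiv.Perm.one_apply]

theorem eval_apply_of_mem_transvectionGroup_outerMoves {n : ℕ} {f : MvPolynomial (Finset Idx) K}
    (hf : ∀ D ∈ f.vars, ∀ k ∈ D, k.1.natAbs ≤ n) {g : Equiv.Perm (Finset Idx → K)}
    (hg : g ∈ transvectionGroup ε (outerMoves n)) (z : Finset Idx → K) :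
    eval (g z) f = eval z f :=
  eval_congr_of_mem_supported (mem_supported.2 subset_rfl) fun D hD =>
    apply_of_mem_transvectionGroup_outerMoves (hf D hD) hg z

end TransvectionGroup

section OrbitTypes

/-- The elements of `D` outside `[-n, n]`. -/
def outer (n : ℕ) (D : Finset Idx) : Finset Idx := D.filter fun k => n < k.1.natAbs

/-- The elements of `D` in `[-n, n]`. -/
def inner (n : ℕ) (D : Finset Idx) : Finset Idx := D.filter fun k => k.1.natAbs ≤ n

/-- The sign of an index; negative indices have sign `true`. -/
def sgn (k : Idx) : Bool := decide (k.1 < 0)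

/-- The invariant of `D` under the moves in `outerMoves n`: its elements in `[-n, n]` and the signs
of the others. -/
def orbitType (n : ℕ) (D : Finset Idx) : Finset Idx × Multiset Bool :=
  (inner n D, (outer n D).val.map sgn)

variable {n n' : ℕ} {D D' : Finset Idx} {k l : Idx}

theorem mem_outer : k ∈ outer n D ↔ k ∈ D ∧ n < k.1.natAbs :=
  Finset.mem_filter

theorem mem_inner : k ∈ inner n D ↔ k ∈ D ∧ k.1.natAbs ≤ n :=
  Finset.mem_filter

theorem inner_union_outer (n : ℕ) (D : Finset Idx) : inner n D ∪ outer n D = D := by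
  ext k
  grind [mem_inner, mem_outer]

theorem outer_subset (h : n ≤ n') (D : Finset Idx) : outer n' D ⊆ outer n D :=
  Finset.monotone_filter_right _ fun _ _ hk => h.trans_lt hk

theorem sgn_eq_iff : sgn k = sgn l ↔ (k.1 < 0 ↔ l.1 < 0) := by
  simp [sgn]

theorem card_orbitType_snd (n : ℕ) (D : Finset Idx) :
    (orbitType n D).2.card = (outer n D).card := by
  simp [orbitType]

/-- The move which replaces the element `k` of `D` by the element `l`, if both have the same sign. A
negative index is occupied if it lies in `D`, and a positive one if it does not. -/
def swapMove (k l : Idx) : Idx × Idx := if k.1 < 0 then (k, l) else (l, k)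

theorem swapMove_eq_or (k l : Idx) : swapMove k l = (k, l) ∨ swapMove k l = (l, k) := by
  unfold swapMove
  split_ifs <;> simp

theorem swapMove_mem_outerMoves (h : sgn k = sgn l) (hk : n < k.1.natAbs) (hl : n < l.1.natAbs) :
    swapMove k l ∈ outerMoves n := by
  rw [sgn_eq_iff] at h
  rcases swapMove_eq_or k l with hs | hs <;> rw [hs]
  exacts [⟨h, hk, hl⟩, ⟨h.symm, hl, hk⟩]

theorem exists_eq_swapMove {m : Idx × Idx} (hm : m ∈ outerMoves n) :
    ∃ k l, sgn k = sgn l ∧ n < k.1.natAbs ∧ n < l.1.natAbs ∧ m = swapMove k l := by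
  obtain ⟨hsign, hfst, hsnd⟩ := hm
  by_cases hneg : m.1.1 < 0
  · exact ⟨m.1, m.2, sgn_eq_iff.2 hsign, hfst, hsnd, by simp [swapMove, hneg]⟩
  · exact ⟨m.2, m.1, sgn_eq_iff.2 hsign.symm, hsnd, hfst, by simp [swapMove, hsign.not.1 hneg]⟩

theorem canMove_swapMove (h : sgn k = sgn l) : CanMove (swapMove k l) D ↔ k ∈ D ∧ l ∉ D := by
  rw [sgn_eq_iff] at h
  by_cases hk : k.1 < 0
  · simp [swapMove, CanMove, Occupied, hk, h.1 hk]
  · simp [swapMove, CanMove, Occupied, hk, h.not.1 hk, and_comm]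

theorem move_swapMove (hk : k ∈ D) (hl : l ∉ D) :
    move (swapMove k l) D = insert l (D.erase k) := by
  have hpair : move (swapMove k l) D = symmDiff D {k, l} := by
    rcases swapMove_eq_or k l with h | h
    · rw [h, move]
    · rw [h, move, Finset.pair_comm]
  rw [hpair]
  ext x
  grind [Finset.mem_symmDiff]

theorem map_sgn_insert_erase (hk : k ∈ D) (hl : l ∉ D) (h : sgn k = sgn l) :
    (insert l (D.erase k)).val.map sgn = D.val.map sgn := by
  rw [Finset.insert_val_of_notMem (fun h => hl (Finset.mem_of_mem_erase h)), Multiset.map_cons,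
    ← h, ← Multiset.map_cons, ← Finset.insert_val_of_notMem (Finset.notMem_erase k D),
    Finset.insert_erase hk]

theorem orbitType_move {m : Idx × Idx} (hm : m ∈ outerMoves n) (h : CanMove m D) :
    orbitType n (move m D) = orbitType n D := by
  obtain ⟨k, l, hsgn, hkn, hln, rfl⟩ := exists_eq_swapMove hm
  obtain ⟨hk, hl⟩ := (canMove_swapMove hsgn).1 h
  have houter : outer n (insert l (D.erase k)) = insert l ((outer n D).erase k) := by
    rw [outer, Finset.filter_insert, if_pos hln, Finset.filter_erase, outer]
  have hinner : inner n (insert l (D.erase k)) = inner n D := by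
    rw [inner, Finset.filter_insert, if_neg hln.not_ge, Finset.filter_erase]
    exact Finset.erase_eq_of_notMem fun h => hkn.not_ge (Finset.mem_filter.1 h).2
  rw [move_swapMove hk hl, orbitType, orbitType, hinner, houter,
    map_sgn_insert_erase (mem_outer.2 ⟨hk, hkn⟩) (fun h => hl (mem_outer.1 h).1) hsgn]

theorem orbitType_eq_of_le (h : n ≤ n') (hD : orbitType n' D = orbitType n' D') :
    orbitType n D = orbitType n D' := by
  have hinner : ∀ D, inner n D = inner n (inner n' D) := fun D => by
    ext x
    grind [mem_inner]
  have houter : ∀ D, (outer n D).val.map sgn =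
      (outer n (inner n' D)).val.map sgn + (outer n' D).val.map sgn := fun D => by
    have hdisj : Disjoint (outer n (inner n' D)) (outer n' D) :=
      Finset.disjoint_left.2 fun x => by grind [mem_inner, mem_outer]
    rw [← Multiset.map_add, ← Finset.disjUnion_val _ _ hdisj]
    congr 2
    ext x
    grind [mem_inner, mem_outer]
  have hinner_eq : inner n' D = inner n' D' := congr(($hD).1)
  have houter_eq : (outer n' D).val.map sgn = (outer n' D').val.map sgn := congr(($hD).2)
  rw [orbitType, orbitType, houter D, houter D', hinner D, hinner D', hinner_eq,
    houter_eq]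

theorem orbitType_eq_of_card_le (h : n ≤ n') (hcard : (outer n D).card ≤ (outer n' D).card) :
    orbitType n' D = orbitType n D := by
  have houter := Finset.eq_of_subset_of_card_le (outer_subset h D) hcard
  have hinner : ∀ n, inner n D = D \ outer n D := fun n => by
    ext x
    grind [mem_inner, mem_outer]
  rw [orbitType, orbitType, hinner, hinner, houter]

theorem finite_natAbs_le (n : ℕ) : {k : Idx | k.1.natAbs ≤ n}.Finite := by
  refine Set.Finite.of_finite_image ((Set.finite_Icc (-(n : ℤ)) n).subset ?_)
    Subtype.val_injective.injOn
  rintro _ ⟨k, hk : k.1.natAbs ≤ n, rfl⟩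
  rw [Set.mem_Icc]
  omega

theorem finite_orbitType (n a : ℕ) :
    {τ | ∃ D, (outer n D).card ≤ a ∧ orbitType n D = τ}.Finite := by
  have finite_inner : {J : Finset Idx | (J : Set Idx) ⊆ {k | k.1.natAbs ≤ n}}.Finite :=
    Set.Finite.of_finite_image ((finite_natAbs_le n).finite_subsets.subset (by
      rintro _ ⟨J, hJ, rfl⟩
      exact hJ)) Finset.coe_injective.injOn
  have finite_sgn : {s : Multiset Bool | s.card ≤ a}.Finite := by
    refine (Set.finite_Iic (a • (Finset.univ : Finset Bool).val)).subset fun s hs => ?_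
    rw [Set.mem_Iic, Multiset.le_iff_count]
    intro b
    rw [Multiset.count_nsmul, Multiset.count_eq_one_of_mem Finset.univ.nodup
      (Finset.mem_univ b), mul_one]
    exact (Multiset.count_le_card b s).trans hs
  refine (finite_inner.prod finite_sgn).subset ?_
  rintro _ ⟨D, hD, rfl⟩
  exact ⟨fun k hk => (mem_inner.1 hk).2, (card_orbitType_snd n D).trans_le hD⟩

theorem exists_path (A B J : Finset Idx) (hAB : A.val.map sgn = B.val.map sgn)
    (hJA : Disjoint J A) (hJB : Disjoint J B) (hd : Disjoint A B) :
    ∃ ps : List (Idx × Idx), IsPath ps (J ∪ A) (J ∪ B) ∧ ps.length = A.card ∧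
      ∀ m ∈ ps, ∃ k ∈ A, ∃ l ∈ B, sgn k = sgn l ∧ m = swapMove k l := by
  induction A using Finset.induction_on generalizing B J with
  | empty =>
    have hB : B = ∅ := by simpa [eq_comm] using hAB
    subst hB
    exact ⟨[], rfl, rfl, by simp⟩
  | insert k A hk ih =>
    rw [Finset.insert_val_of_notMem hk, Multiset.map_cons] at hAB
    obtain ⟨l, hl, hlk⟩ := Multiset.mem_map.1
      (hAB ▸ Multiset.mem_cons_self _ _ : sgn k ∈ B.val.map sgn)
    rw [Finset.mem_val] at hl
    rw [← Finset.insert_erase hl, Finset.insert_val_of_notMem (Finset.notMem_erase _ _),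
      Multiset.map_cons, hlk, Multiset.cons_inj_right] at hAB
    rw [Finset.disjoint_left] at hJA hJB hd
    obtain ⟨ps, hps, hlen, hmem⟩ := ih (B.erase l) (insert l J) hAB
      (Finset.disjoint_left.2 (by grind)) (Finset.disjoint_left.2 (by grind))
      (Finset.disjoint_left.2 (by grind))
    have hlJA : l ∉ J ∪ insert k A := by grind
    have hsource : insert l ((J ∪ insert k A).erase k) = insert l J ∪ A := by
      ext x
      grind
    have htarget : insert l J ∪ B.erase l = J ∪ B := by
      ext x
      grind
    refine ⟨swapMove k l :: ps, ⟨(canMove_swapMove hlk.symm).2 ⟨by simp, hlJA⟩, ?_⟩, ?_, ?_⟩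
    · rwa [move_swapMove (by simp) hlJA, hsource, ← htarget]
    · rw [List.length_cons, hlen, Finset.card_insert_of_notMem hk]
    · intro m hm
      rcases List.mem_cons.1 hm with rfl | hm
      · exact ⟨k, Finset.mem_insert_self _ _, l, hl, hlk.symm, rfl⟩
      · obtain ⟨k', hk', l', hl', h⟩ := hmem m hm
        exact ⟨k', Finset.mem_insert_of_mem hk', l', Finset.mem_of_mem_erase hl', h⟩

end OrbitTypes

section HasseOrder

open MvPolynomial Set

variable {R σ : Type*} [CommRing R] [DecidableEq σ] {Y : Set (σ → R)} {s : σ}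
  {f : MvPolynomial σ R} {q : ℕ}

/-- `q` is the least positive order of a Hasse derivative of `f` with respect to `s` which does not
vanish identically on `Y`. -/
structure IsHasseOrder (Y : Set (σ → R)) (s : σ) (f : MvPolynomial σ R) (q : ℕ) : Prop where
  ne_zero : q ≠ 0
  lower : ∀ d ≠ 0, d < q → ∀ z ∈ Y, eval z (hasseDeriv s d f) = 0
  exists_ne_zero : ∃ z ∈ Y, eval z (hasseDeriv s q f) ≠ 0

theorem exists_isHasseOrder (h : ∃ d ≠ 0, ∃ z ∈ Y, eval z (hasseDeriv s d f) ≠ 0) :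
    ∃ q, IsHasseOrder Y s f q := by
  classical
  obtain ⟨hq, hne⟩ := Nat.find_spec h
  refine ⟨Nat.find h, hq, fun d hd hdq z hz => ?_, hne⟩
  by_contra hcon
  exact Nat.find_min h hdq ⟨hd, z, hz, hcon⟩

namespace IsHasseOrder

theorem hasseDeriv_ne_zero (h : IsHasseOrder Y s f q) : hasseDeriv s q f ≠ 0 := by
  obtain ⟨z, _, hz⟩ := h.exists_ne_zero
  rintro h0
  exact hz (by rw [h0, map_zero])

theorem mem_vars (h : IsHasseOrder Y s f q) : s ∈ f.vars := by
  by_contra hs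
  exact h.hasseDeriv_ne_zero (hasseDeriv_eq_zero_of_notMem_vars hs h.ne_zero)

theorem totalDegree_lt (h : IsHasseOrder Y s f q) :
    (hasseDeriv s q f).totalDegree < f.totalDegree :=
  totalDegree_hasseDeriv_lt h.ne_zero h.hasseDeriv_ne_zero

theorem add_pow [IsDomain R] [Infinite R] (h : IsHasseOrder Y s f q)
    (hY : ∀ z ∈ Y, ∀ y, z + Pi.single s y ∈ Y) (a b : R) : (a + b) ^ q = a ^ q + b ^ q := by
  obtain ⟨z, hz, hzq⟩ := h.exists_ne_zero
  exact add_pow_of_hasseDeriv_vanish hY h.ne_zero h.lower hz hzq a b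

end IsHasseOrder

/-- Induction on the degree of `f`: off the zeros of a Hasse derivative of `f` one uses `hopen`, on
its zeros the induction hypothesis. -/
theorem NoetherianUpTo.inter_stableZeros_eval {G : Subgroup (Equiv.Perm (σ → R))}
    {F : Set ((σ → R) → R)} {S T : Set σ} (hF : ∀ g ∈ G, ∀ f ∈ F, (fun z => f (g z)) ∈ F)
    (hY : ∀ g ∈ G, MapsTo g Y Y)
    (hconst : ∀ f ∈ supported R S, (∃ z ∈ Y, eval z f ≠ 0) →
      (∀ s ∈ T, ∀ d ≠ 0, ∀ z ∈ Y, eval z (hasseDeriv s d f) = 0) →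
      NoetherianUpTo G F (Y ∩ stableZeros G fun z => eval z f))
    (hopen : ∀ f ∈ supported R S, ∀ s ∈ T, ∀ q, IsHasseOrder Y s f q →
      NoetherianUpTo G F
        {z ∈ Y ∩ stableZeros G fun z => eval z f | eval z (hasseDeriv s q f) ≠ 0})
    (hf : f ∈ supported R S) (hfY : ∃ z ∈ Y, eval z f ≠ 0) :
    NoetherianUpTo G F (Y ∩ stableZeros G fun z => eval z f) := by
  induction hd : f.totalDegree using Nat.strong_induction_on generalizing f with
  | _ n ih =>
    by_cases hT : ∀ s ∈ T, ∀ d ≠ 0, ∀ z ∈ Y, eval z (hasseDeriv s d f) = 0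
    · exact hconst f hf hfY hT
    push Not at hT
    obtain ⟨s, hs, hex⟩ := hT
    obtain ⟨q, hq⟩ := exists_isHasseOrder hex
    have hderiv : NoetherianUpTo G F (Y ∩ stableZeros G fun z => eval z (hasseDeriv s q f)) :=
      ih _ (hd ▸ hq.totalDegree_lt) (hasseDeriv_mem_supported hf s q) hq.exists_ne_zero rfl
    refine .of_stableZeros_of_ne_zero hF
      (fun g hg z hz => ⟨hY g hg hz.1, apply_mem_stableZeros hg hz.2⟩)
      (hderiv.mono subset_rfl fun z hz => ⟨hz.1.1, hz.2⟩) (hopen f hf s hs q hq)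

end HasseOrder

section OpenLocus

open MvPolynomial Set

variable {K : Type*} [Field K] {ε : Idx × Idx → Finset Idx → K}

theorem NoetherianUpTo.of_le_rootClosure {n : ℕ} {M : Set (Idx × Idx)} (hM : outerMoves n ⊆ M)
    {W : Set (Finset Idx → K)} (hW : ∀ g ∈ transvectionGroup ε M, MapsTo g W W)
    {p : MvPolynomial (Finset Idx) K} (hp : ∀ D ∈ p.vars, ∀ k ∈ D, k.1.natAbs ≤ n)
    {A : Subalgebra K ((Finset Idx → K) → K)} (hpA : (fun z => eval z p) ∈ A) {q : ℕ}
    (hq : q ≠ 0) {hadd : ∀ a b : K, (a + b) ^ q = a ^ q + b ^ q}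
    (hA : NoetherianUpTo (transvectionGroup ε (outerMoves n)) (A : Set ((Finset Idx → K) → K)) univ)
    {B : Subalgebra K ((Finset Idx → K) → K)}
    (hle : B ≤ rootClosure A {z ∈ W | eval z p ≠ 0} _ hpA q hadd) :
    NoetherianUpTo (transvectionGroup ε M) (B : Set ((Finset Idx → K) → K))
      {z ∈ W | eval z p ≠ 0} := by
  refine hA.comap id (fun _ _ => mem_univ _) (fun g hg => ?_) fun F hF =>
    exists_zero_iff_of_mem_rootClosure (fun z hz => hz.2) hq (hle hF)
  have hgM := transvectionGroup_mono hM hg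
  refine ⟨g, hgM, fun z hz => ⟨⟨hW g hgM hz.1, ?_⟩, rfl⟩⟩
  rw [eval_apply_of_mem_transvectionGroup_outerMoves hp hg]
  exact hz.2

end OpenLocus

section OutwardMoves

variable {n n' : ℕ} {s r D : Finset Idx} {S : Set (Finset Idx)}
  {τ : Finset Idx × Multiset Bool} {ps : List (Idx × Idx)}

/-- Membership in `S` only depends on the orbit type at level `n`. -/
def Saturated (n : ℕ) (S : Set (Finset Idx)) : Prop :=
  ∀ D D', orbitType n D = orbitType n D' → D ∈ S → D' ∈ S

theorem Saturated.move_mem (hS : Saturated n S) (m : Idx × Idx) (hm : m ∈ outerMoves n)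
    (D : Finset Idx) (hD : D ∈ S) (h : CanMove m D) : move m D ∈ S :=
  hS D _ (orbitType_move hm h).symm hD

theorem Saturated.mono (h : n ≤ n') (hS : Saturated n S) : Saturated n' S :=
  fun D D' hD => hS D D' (orbitType_eq_of_le h hD)

theorem Saturated.sdiff (hS : Saturated n S) (τ : Finset Idx × Multiset Bool) :
    Saturated n (S \ {D | orbitType n D = τ}) :=
  fun D D' h hD => ⟨hS D D' h hD.1, fun h' => hD.2 (h.trans h')⟩

/-- The moves which exchange an index in `[-n', n']`, but outside `[-n, n]`, for one outside
`[-n', n']`. -/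
def outwardMoves (n n' : ℕ) : Set (Idx × Idx) :=
  {m | ∃ k l, sgn k = sgn l ∧ n < k.1.natAbs ∧ k.1.natAbs ≤ n' ∧ n' < l.1.natAbs ∧
    m = swapMove k l}

theorem outwardMoves_subset_outerMoves : outwardMoves n n' ⊆ outerMoves n := by
  rintro _ ⟨k, l, hsgn, hnk, hkn', hl, rfl⟩
  exact swapMove_mem_outerMoves hsgn hnk (hnk.trans_le (hkn'.trans hl.le))

theorem card_outer_move {m : Idx × Idx} (hm : m ∈ outwardMoves n n') (h : CanMove m D) :
    (outer n' (move m D)).card = (outer n' D).card + 1 := by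
  obtain ⟨k, l, hsgn, _, hkn', hl, rfl⟩ := hm
  obtain ⟨hkD, hlD⟩ := (canMove_swapMove hsgn).1 h
  have houter : outer n' (move (swapMove k l) D) = insert l (outer n' D) := by
    rw [move_swapMove hkD hlD, outer, Finset.filter_insert, if_pos hl, Finset.filter_erase]
    exact congrArg _ (Finset.erase_eq_of_notMem fun h => hkn'.not_gt (Finset.mem_filter.1 h).2)
  rw [houter, Finset.card_insert_of_notMem fun h => hlD (mem_outer.1 h).1]

theorem Saturated.isGraded (hS : Saturated n S) (hps : ∀ m ∈ ps, m ∈ outwardMoves n n') :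
    IsGraded ps S (fun D => (outer n' D).card) fun _ => 1 where
  move_mem m hm := hS.move_mem m (outwardMoves_subset_outerMoves (hps m hm))
  degree_move m hm _ _ hcan := card_outer_move (hps m hm) hcan
  weight_pos _ _ := zero_lt_one

theorem exists_outward_path (hs : ∀ k ∈ s, k.1.natAbs ≤ n') (h : orbitType n s = orbitType n' D) :
    ∃ ps, IsPath ps s D ∧ ps.length = (outer n s).card ∧ ∀ m ∈ ps, m ∈ outwardMoves n n' := by
  have hinner : inner n s = inner n' D := congr(($h).1)
  have hsgn : (outer n s).val.map sgn = (outer n' D).val.map sgn := congr(($h).2)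
  obtain ⟨ps, hpath, hlen, hmoves⟩ := exists_path (outer n s) (outer n' D) (inner n s) hsgn
    (Finset.disjoint_left.2 fun k => by grind [mem_inner, mem_outer])
    (Finset.disjoint_left.2 fun k => by grind [mem_inner, mem_outer])
    (Finset.disjoint_left.2 fun k => by grind [mem_outer])
  rw [inner_union_outer, hinner, inner_union_outer] at hpath
  refine ⟨ps, hpath, hlen, fun m hm => ?_⟩
  obtain ⟨k, hk, l, hl, hkl, rfl⟩ := hmoves m hm
  rw [mem_outer] at hk hl
  exact ⟨k, l, hkl, hk.2, hs k hk.1, hl.2, rfl⟩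

theorem IsPath.eq_of_inner_eq {D' : Finset Idx} (hs : ∀ k ∈ s, k.1.natAbs ≤ n)
    (hr : ∀ k ∈ r, k.1.natAbs ≤ n) (hsD : IsPath ps s D) (hrD : IsPath ps r D')
    (h : inner n D' = inner n D) : r = s := by
  obtain ⟨X, hX⟩ := IsPath.exists_symmDiff ps
  rw [hX _ _ hrD, hX _ _ hsD] at h
  ext k
  have hk : k ∈ inner n (symmDiff r X) ↔ k ∈ inner n (symmDiff s X) := by rw [h]
  simp only [mem_inner, Finset.mem_symmDiff] at hk
  grind

theorem orbitType_ne_of_card_pos (hτ : 0 < τ.2.card) (hs : ∀ k ∈ s, k.1.natAbs ≤ n) :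
    orbitType n s ≠ τ := by
  rintro rfl
  rw [card_orbitType_snd, Finset.card_pos] at hτ
  obtain ⟨k, hk⟩ := hτ
  exact (hs k (mem_outer.1 hk).1).not_gt (mem_outer.1 hk).2

end OutwardMoves

section TopTypes

variable {n n' a : ℕ} {S : Set (Finset Idx)} {τ : Finset Idx × Multiset Bool}

/-- The orbit types at level `n` of the elements of `S` with exactly `a` elements outside
`[-n, n]`. -/
def topTypes (n a : ℕ) (S : Set (Finset Idx)) : Set (Finset Idx × Multiset Bool) :=
  {τ | τ.2.card = a ∧ ∃ D ∈ S, orbitType n D = τ}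

theorem finite_topTypes : (topTypes n a S).Finite := by
  refine (finite_orbitType n a).subset ?_
  rintro _ ⟨ha, D, _, rfl⟩
  exact ⟨D, (card_orbitType_snd n D ▸ ha).le, rfl⟩

theorem ncard_topTypes_sdiff_lt (h : n ≤ n') (ha : ∀ D ∈ S, (outer n D).card ≤ a)
    (hτ : τ ∈ topTypes n a S) :
    (topTypes n' a (S \ {D | orbitType n' D = τ})).ncard < (topTypes n a S).ncard := by
  have hne : ∀ μ ∈ topTypes n' a (S \ {D | orbitType n' D = τ}), μ ∈ topTypes n a S ∧ μ ≠ τ := by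
    rintro _ ⟨hcard, D, hD, rfl⟩
    refine ⟨⟨hcard, D, hD.1, (orbitType_eq_of_card_le h ?_).symm⟩, hD.2⟩
    exact (ha D hD.1).trans (card_orbitType_snd n' D ▸ hcard.ge)
  exact Set.ncard_lt_ncard ⟨fun μ hμ => (hne μ hμ).1, fun hle => (hne τ (hle hτ)).2 rfl⟩
    finite_topTypes

end TopTypes

section BoundedArity

open MvPolynomial Set

variable {K : Type*} [Field K] {ε : Idx × Idx → Finset Idx → K} {n n' : ℕ}
  {S : Set (Finset Idx)} {τ : Finset Idx × Multiset Bool} {Y : Set (Finset Idx → K)}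
  {f : MvPolynomial (Finset Idx) K} {s D : Finset Idx} {q : ℕ}

theorem exists_natAbs_le_of_mem_vars (n : ℕ) (f : MvPolynomial (Finset Idx) K) :
    ∃ n' ≥ n, ∀ D ∈ f.vars, ∀ k ∈ D, k.1.natAbs ≤ n' := by
  refine ⟨max n (f.vars.sup fun D => D.sup fun k => k.1.natAbs), le_max_left _ _,
    fun D hD k hk => le_max_of_le_right ?_⟩
  exact (Finset.le_sup (f := fun k : Idx => k.1.natAbs) hk).trans
    (Finset.le_sup (f := fun D : Finset Idx => D.sup fun k => k.1.natAbs) hD)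

theorem exists_hasseDeriv_mul_coord_pow_eq [Infinite K] (hε : ∀ m D, ε m D ≠ 0)
    (hS : Saturated n S) (hτ : 0 < τ.2.card)
    (hYG : ∀ g ∈ transvectionGroup ε (outerMoves n), MapsTo g Y Y)
    (hYτ : ∀ z ∈ Y, ∀ w, EqOn z w {s | orbitType n s = τ}ᶜ → w ∈ Y) (hf : f ∈ supported K S)
    (hvars : ∀ D ∈ f.vars, ∀ k ∈ D, k.1.natAbs ≤ n') (hs : orbitType n s = τ)
    (hq : IsHasseOrder Y s f q) (hD : orbitType n' D = τ) :
    ∃ p ∈ polyFun K (S \ {D | orbitType n' D = τ}),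
      ∀ z ∈ Y ∩ stableZeros (transvectionGroup ε (outerMoves n)) (fun z => eval z f),
        eval z (hasseDeriv s q f) * z D ^ q = p z := by
  have hfS : ∀ r ∈ f.vars, r ∈ S := mem_supported.1 hf
  have hsv := hq.mem_vars
  obtain ⟨ps, hpath, hlen, hps⟩ := exists_outward_path (hvars s hsv) (hs.trans hD.symm)
  have hps' : ∀ m ∈ ps, m ∈ outerMoves n := fun m hm => outwardMoves_subset_outerMoves (hps m hm)
  have hcard : ps.length = τ.2.card := by rw [hlen, ← hs, card_orbitType_snd]
  have hgraded := hS.isGraded hps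
  have hlowA : ∀ r ∈ f.vars, ∀ D' ∈ S,
      (outer n' D').card < (outer n' r).card + (ps.map fun _ => 1).sum →
      (fun z : Finset Idx → K => z D') ∈ polyFun K (S \ {D | orbitType n' D = τ}) := by
    intro r hr D' hD' hlt
    have houter : outer n' r = ∅ :=
      Finset.filter_eq_empty_iff.2 fun k hk => (hvars r hr k hk).not_gt
    rw [houter, Finset.card_empty, zero_add, List.map_const', List.sum_replicate,
      smul_eq_mul, mul_one, hcard] at hlt
    refine coord_mem_polyFun ⟨hD', fun h : orbitType n' D' = τ => hlt.ne ?_⟩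
    rw [← h, card_orbitType_snd]
  refine exists_hasseDeriv_mul_pow_eq hq.ne_zero (List.length_pos_iff.1 (hcard ▸ hτ))
    (exists_pathPoly_eq_add hε hgraded (hfS s hsv) (hlowA s hsv) hpath) ?_
    (fun z hz t => hz.2 _ (pathPerm_mem t hps')) ?_
  · refine fun r hr hrs => pathPoly_mem_coeffsIn hgraded (hfS r hr) (hlowA r hr) fun D' hD' =>
      coord_mem_polyFun ⟨(hgraded.target (hfS r hr) hD').1, fun h => hrs ?_⟩
    exact hpath.eq_of_inner_eq (hvars s hsv) (hvars r hr) hD' congr(($(h.trans hD.symm)).1)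
  · refine fun d hd hdq z hz t w hw => hq.lower d hd hdq w (hYτ _ (hYG _ (pathPerm_mem t hps') hz.1)
      w (hw.mono (compl_subset_compl.2 ?_)))
    exact singleton_subset_iff.2 hs

theorem noetherianUpTo_hasseDeriv_ne_zero_of_orbitType [Infinite K] (hε : ∀ m D, ε m D ≠ 0)
    (hS : Saturated n S) (hτ : 0 < τ.2.card)
    (hIH : ∀ n' ≥ n, NoetherianUpTo (transvectionGroup ε (outerMoves n'))
      (polyFun K (S \ {D | orbitType n' D = τ}) : Set ((Finset Idx → K) → K)) univ)
    (hYG : ∀ g ∈ transvectionGroup ε (outerMoves n), MapsTo g Y Y)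
    (hYτ : ∀ z ∈ Y, ∀ w, EqOn z w {s | orbitType n s = τ}ᶜ → w ∈ Y) (hf : f ∈ supported K S)
    (hs : orbitType n s = τ) (hq : IsHasseOrder Y s f q) :
    NoetherianUpTo (transvectionGroup ε (outerMoves n))
      (polyFun K S : Set ((Finset Idx → K) → K))
      {z ∈ Y ∩ stableZeros (transvectionGroup ε (outerMoves n)) fun z => eval z f |
        eval z (hasseDeriv s q f) ≠ 0} := by
  obtain ⟨n', hn', hvars⟩ := exists_natAbs_le_of_mem_vars n f
  have hvars' : (hasseDeriv s q f).vars ⊆ f.vars :=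
    mem_supported.1 (hasseDeriv_mem_supported (mem_supported_vars f) s q)
  have hadd := hq.add_pow fun z hz y => hYτ z hz _ fun D hD => by
    have hDs : D ≠ s := by
      rintro rfl
      exact hD hs
    simp [hDs]
  have hderiv : (fun z => eval z (hasseDeriv s q f)) ∈
      polyFun K (S \ {D | orbitType n' D = τ}) :=
    mem_polyFun.2 ⟨_, mem_supported.2 fun D hD => ⟨mem_supported.1 hf (hvars' hD),
      orbitType_ne_of_card_pos hτ (hvars D (hvars' hD))⟩, fun _ => rfl⟩
  refine NoetherianUpTo.of_le_rootClosure (W := Y ∩ stableZeros _ _) (outerMoves_anti hn')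
    (fun g hg z hz => ⟨hYG g hg hz.1, apply_mem_stableZeros hg hz.2⟩)
    (fun D hD => hvars D (hvars' hD)) hderiv hq.ne_zero (hadd := hadd) (hIH n' hn')
    (polyFun_le_iff.2 fun D hD => ?_)
  by_cases hDτ : orbitType n' D = τ
  · obtain ⟨p, hp, hpz⟩ :=
      exists_hasseDeriv_mul_coord_pow_eq hε hS hτ hYG hYτ hf hvars hs hq hDτ
    exact mem_rootClosure_of_mul_pow (le_rootClosure hp) fun z hz => hpz z hz.1
  · exact le_rootClosure (coord_mem_polyFun ⟨hD, hDτ⟩)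

theorem exists_mem_supported_sdiff_eval_eq {R σ : Type*} [CommRing R] {S : Set σ}
    {f : MvPolynomial σ R} (hf : f ∈ supported R S) (T : Set σ) :
    ∃ f' ∈ supported R (S \ T), ∀ z, eval z f' = eval (Tᶜ.indicator z) f := by
  refine ⟨aeval (Tᶜ.indicator X) f, aeval_mem_of_mem_supported hf fun s hs => ?_, fun z => ?_⟩
  · by_cases hT : s ∈ T
    · simp [hT]
    · rw [indicator_of_mem hT]
      exact Algebra.subset_adjoin (mem_image_of_mem _ ⟨hs, hT⟩)
  · have h : (aeval z).comp (aeval (Tᶜ.indicator X)) = aeval (R := R) (Tᶜ.indicator z) := by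
      ext s
      by_cases hT : s ∈ T <;> simp [hT]
    exact congr($h f)

theorem exists_polyFun_eqOn_of_hasseDeriv_vanish {R σ : Type*} [CommRing R] [DecidableEq σ]
    {S T : Set σ} {Y : Set (σ → R)} {f : MvPolynomial σ R} (hf : f ∈ supported R S)
    (hY : ∀ z ∈ Y, ∀ w, EqOn z w Tᶜ → w ∈ Y)
    (h : ∀ s ∈ T, ∀ d ≠ 0, ∀ z ∈ Y, eval z (hasseDeriv s d f) = 0) :
    ∃ F ∈ polyFun R (S \ T), EqOn (fun z => eval z f) F Y := by
  obtain ⟨f', hf', hff'⟩ := exists_mem_supported_sdiff_eval_eq hf T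
  refine ⟨fun z => eval z f', mem_polyFun.2 ⟨f', hf', fun _ => rfl⟩, fun z hz => ?_⟩
  change eval z f = eval z f'
  rw [hff', eval_eq_of_hasseDeriv_vanish hY h hz fun s hs => (indicator_of_mem hs z).symm]

theorem noetherianUpTo_of_remove_orbitType [Infinite K] (hε : ∀ m D, ε m D ≠ 0)
    (hS : Saturated n S) (hτ : 0 < τ.2.card)
    (hIH : ∀ n' ≥ n, NoetherianUpTo (transvectionGroup ε (outerMoves n'))
      (polyFun K (S \ {D | orbitType n' D = τ}) : Set ((Finset Idx → K) → K)) univ) :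
    NoetherianUpTo (transvectionGroup ε (outerMoves n))
      (polyFun K S : Set ((Finset Idx → K) → K)) univ := by
  set G := transvectionGroup ε (outerMoves n)
  set T := {D | orbitType n D = τ}
  refine (hIH n le_rfl).induction (fun Y => (∀ g ∈ G, MapsTo g Y Y) →
    (∀ z ∈ Y, ∀ w, EqOn z w Tᶜ → w ∈ Y) →
      NoetherianUpTo G (polyFun K S : Set ((Finset Idx → K) → K)) Y)
    (fun Y hY hYG hYT => ?_) (fun _ _ _ _ => mem_univ _) (fun _ _ _ _ => mem_univ _)
  refine .of_inter_stableZeros fun F hF => ?_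
  obtain ⟨f, hf, hFf⟩ := mem_polyFun.1 hF
  obtain rfl : F = fun z => eval z f := funext hFf
  refine .inter_stableZeros_eval (S := S) (T := T)
    (fun g hg => polyFun_comp_transvectionGroup hS.move_mem hg) hYG
    (fun f hf hfY hvanish => ?_)
    (fun f hf s hs q hq =>
      noetherianUpTo_hasseDeriv_ne_zero_of_orbitType hε hS hτ hIH hYG hYT hf hs hq) hf
  obtain ⟨F, hF, hFf⟩ := exists_polyFun_eqOn_of_hasseDeriv_vanish hf hYT hvanish
  rw [inter_stableZeros_congr hYG hFf]
  obtain ⟨z, hz, hfz⟩ := hfY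
  refine hY F hF ⟨z, hz, hFf hz ▸ hfz⟩
    (fun g hg z hz => ⟨hYG g hg hz.1, apply_mem_stableZeros hg hz.2⟩)
    fun z hz w hzw => ⟨hYT z hz.1 w hzw, fun g hg => ?_⟩
  have hFg := polyFun_comp_transvectionGroup (hS.sdiff τ).move_mem hg F hF
  rw [← hz.2 g hg]
  exact (polyFun_congr hFg (hzw.mono fun D hD => hD.2)).symm

theorem noetherianUpTo_of_card_outer_le [Infinite K] (hε : ∀ m D, ε m D ≠ 0) (a : ℕ) :
    ∀ (n : ℕ) (S : Set (Finset Idx)), Saturated n S → (∀ D ∈ S, (outer n D).card ≤ a) →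
      NoetherianUpTo (transvectionGroup ε (outerMoves n))
        (polyFun K S : Set ((Finset Idx → K) → K)) univ := by
  induction a with
  | zero =>
    intro n S _ ha
    refine .of_finite _ ((finite_natAbs_le n).toFinset.powerset.finite_toSet.subset fun D hD => ?_)
    have houter := Finset.card_eq_zero.1 (Nat.le_zero.1 (ha D hD))
    simp only [Finset.coe_powerset, Set.mem_preimage, Set.mem_powerset_iff]
    intro k hk
    simpa [mem_outer] using (Finset.filter_eq_empty_iff.1 houter) hk
  | succ a iha =>
    intro n S
    induction hc : (topTypes n (a + 1) S).ncard using Nat.strong_induction_on generalizing n S with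
    | _ c ihc =>
    intro hS ha
    rcases (topTypes n (a + 1) S).eq_empty_or_nonempty with hempty | ⟨τ, hτ⟩
    · refine iha n S hS fun D hD => Nat.le_of_lt_succ ((ha D hD).lt_of_ne fun hcard => ?_)
      exact eq_empty_iff_forall_notMem.1 hempty _ ⟨card_orbitType_snd n D ▸ hcard, D, hD, rfl⟩
    · refine noetherianUpTo_of_remove_orbitType hε hS (hτ.1 ▸ a.succ_pos) fun n' hn' =>
        ihc _ ?_ n' _ rfl ((hS.mono hn').sdiff τ) fun D hD =>
          (Finset.card_le_card (outer_subset hn' D)).trans (ha D hD.1)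
      rw [← hc]
      exact ncard_topTypes_sdiff_lt hn' ha hτ

end BoundedArity

section Charge

variable {m : Idx × Idx} {D D' : Finset Idx} {n : ℕ} {k : Idx}

/-- The charge of the semi-infinite monomial recorded by `D`. -/
def charge (D : Finset Idx) : ℤ := ∑ k ∈ D, if k.1 < 0 then -1 else 1

theorem charge_eq_card_sub_card (D : Finset Idx) :
    charge D = ((D.filter fun k => ¬ k.1 < 0).card : ℤ) - (D.filter fun k => k.1 < 0).card := by
  rw [charge, Finset.sum_ite, Finset.sum_const, Finset.sum_const]
  simp only [nsmul_eq_mul]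
  ring

theorem charge_symmDiff_singleton (D : Finset Idx) (k : Idx) :
    charge (symmDiff D {k}) = charge D + if Occupied k D then 1 else -1 := by
  by_cases hk : k ∈ D
  · have h : symmDiff D {k} = D.erase k := by
      ext
      grind [Finset.mem_symmDiff]
    rw [h, charge, charge, ← Finset.add_sum_erase D _ hk]
    simp only [Occupied, hk, true_iff]
    split_ifs <;> ring
  · have h : symmDiff D {k} = insert k D := by
      ext
      grind [Finset.mem_symmDiff]
    rw [h, charge, charge, Finset.sum_insert hk]
    simp only [Occupied, hk, false_iff]
    split_ifs <;> ring

theorem charge_move (h : CanMove m D) : charge (move m D) = charge D := by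
  have hne : m.1 ≠ m.2 := fun he => h.2 (he ▸ h.1)
  have hm : move m D = symmDiff (symmDiff D {m.1}) {m.2} := by
    ext
    grind [mem_move, Finset.mem_symmDiff]
  have hsnd : ¬ Occupied m.2 (symmDiff D {m.1}) := fun h' => h.2 (by
    grind [Occupied, Finset.mem_symmDiff])
  rw [hm, charge_symmDiff_singleton, charge_symmDiff_singleton, if_pos h.1, if_neg hsnd]
  ring

/-- The monomials of charge zero; they index the basis of the infinite wedge. -/
def balanced : Set (Finset Idx) := {D | charge D = 0}

/-- The monomials of charge zero in which at most one index below `-n` is occupied. -/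
def thinSet (n : ℕ) : Set (Finset Idx) :=
  {D | charge D = 0 ∧ (D.filter fun k => k.1 < -(n : ℤ)).card ≤ 1}

theorem charge_eq_inner_add_outer (n : ℕ) (D : Finset Idx) : charge D = charge (inner n D) +
    (((outer n D).val.map sgn).map fun b => if b then (-1 : ℤ) else 1).sum := by
  have hdisj : Disjoint (inner n D) (outer n D) :=
    Finset.disjoint_left.2 fun k => by grind [mem_inner, mem_outer]
  conv_lhs => rw [← inner_union_outer n D, charge, Finset.sum_union hdisj]
  rw [Multiset.map_map, charge, Finset.sum, Finset.sum]
  simp [sgn]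

theorem card_filter_lt_neg (n : ℕ) (D : Finset Idx) :
    (D.filter fun k => k.1 < -(n : ℤ)).card = ((outer n D).val.map sgn).count true := by
  have h : D.filter (fun k => k.1 < -(n : ℤ)) = (outer n D).filter fun k => true = sgn k := by
    ext k
    simp only [Finset.mem_filter, mem_outer, sgn, true_eq_decide_iff, and_assoc]
    exact and_congr_right fun _ => by omega
  rw [h, Multiset.count_map, ← Finset.filter_val, Finset.card_val]

theorem saturated_thinSet (n : ℕ) : Saturated n (thinSet n) := by
  intro D D' h hD
  have hinner : inner n D = inner n D' := congr(($h).1)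
  have hsgn : (outer n D).val.map sgn = (outer n D').val.map sgn := congr(($h).2)
  rwa [thinSet, Set.mem_ofPred_eq, charge_eq_inner_add_outer n, card_filter_lt_neg, hinner, hsgn,
    ← charge_eq_inner_add_outer, ← card_filter_lt_neg] at hD

theorem card_le_of_mem_thinSet (hD : D ∈ thinSet n) :
    D.card ≤ 2 * ((finite_natAbs_le n).toFinset.card + 1) := by
  have hsub : (D.filter fun k => k.1 < 0) ⊆
      (finite_natAbs_le n).toFinset ∪ D.filter fun k => k.1 < -(n : ℤ) := by
    intro k hk
    rw [Finset.mem_filter] at hk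
    rw [Finset.mem_union, Finset.mem_filter, (finite_natAbs_le n).mem_toFinset]
    by_cases h : k.1 < -(n : ℤ)
    · exact Or.inr ⟨hk.1, h⟩
    · exact Or.inl (show k.1.natAbs ≤ n by omega)
  have hneg := (Finset.card_le_card hsub).trans (Finset.card_union_le _ _)
  have hcharge := hD.1
  rw [charge_eq_card_sub_card] at hcharge
  have hcard := D.card_filter_add_card_filter_not fun k => k.1 < 0
  have hthin := hD.2
  omega

end Charge

section LowOccupied

variable {D D' s : Finset Idx} {k l a b c g : Idx} {n p : ℕ}

/-- The occupied indices which are at most `p`. -/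
def lowOccupied (p : ℕ) (D : Finset Idx) : Finset Idx :=
  (D.filter fun k => k.1 < 0) ∪ ((Finset.range p).image posIdx \ D)

theorem eq_posIdx_iff {i : ℕ} : k = posIdx i ↔ k.1 = i + 1 :=
  Subtype.ext_iff

theorem posIdx_injective : Function.Injective posIdx := fun i j h => by
  have := eq_posIdx_iff.1 h
  simp only [posIdx] at this
  omega

theorem mem_image_posIdx {t : Finset ℕ} : k ∈ t.image posIdx ↔ 0 < k.1 ∧ k.1.toNat - 1 ∈ t := by
  simp only [Finset.mem_image, eq_comm (b := k), eq_posIdx_iff]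
  constructor
  · rintro ⟨i, hi, hk⟩
    exact ⟨by omega, by rwa [hk, show ((i : ℤ) + 1).toNat - 1 = i by omega]⟩
  · rintro ⟨hk, ht⟩
    exact ⟨_, ht, by omega⟩

theorem mem_lowOccupied : k ∈ lowOccupied p D ↔ k.1 ≤ p ∧ Occupied k D := by
  have := k.2
  simp only [lowOccupied, Finset.mem_union, Finset.mem_filter, Finset.mem_sdiff, mem_image_posIdx,
    Finset.mem_range, Occupied]
  grind

theorem mem_of_mem_lowOccupied (h : k ∈ lowOccupied p D) (hk : k.1 < 0) : k ∈ D :=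
  (mem_lowOccupied.1 h).2.2 hk

theorem card_lowOccupied_add_charge (p : ℕ) (D : Finset Idx) :
    ((lowOccupied p D).card : ℤ) + charge D = p + (D.filter fun k => (p : ℤ) < k.1).card := by
  have hdisj : Disjoint (D.filter fun k => k.1 < 0) ((Finset.range p).image posIdx \ D) :=
    Finset.disjoint_left.2 fun k => by grind
  have hdisj' : Disjoint (D.filter fun k => (p : ℤ) < k.1) ((Finset.range p).image posIdx ∩ D) :=
    Finset.disjoint_left.2 fun k => by grind [mem_image_posIdx]
  have hpos : (D.filter fun k => ¬ k.1 < 0) =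
      (D.filter fun k => (p : ℤ) < k.1) ∪ ((Finset.range p).image posIdx ∩ D) := by
    ext k
    have := k.2
    simp only [Finset.mem_union, Finset.mem_filter, Finset.mem_inter, mem_image_posIdx,
      Finset.mem_range]
    grind
  have hsdiff := Finset.card_sdiff_add_card_inter ((Finset.range p).image posIdx) D
  rw [Finset.card_image_of_injective _ posIdx_injective, Finset.card_range] at hsdiff
  rw [charge_eq_card_sub_card, hpos, Finset.card_union_of_disjoint hdisj', lowOccupied,
    Finset.card_union_of_disjoint hdisj]
  omega

theorem eq_of_lowOccupied_eq (h : lowOccupied 2 D = lowOccupied 2 D')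
    (hhigh : ∀ k : Idx, 2 < k.1 → (k ∈ D ↔ k ∈ D')) : D = D' := by
  refine ext_occupied fun k => ?_
  have hk : k ∈ lowOccupied 2 D ↔ k ∈ lowOccupied 2 D' := by rw [h]
  grind [mem_lowOccupied, Occupied]

theorem lowOccupied_move (hc : 2 < c.1) (hg : g ∈ lowOccupied 2 D) :
    lowOccupied 2 (move (c, g) D) = (lowOccupied 2 D).erase g := by
  ext k
  have := mem_lowOccupied.1 hg
  grind [mem_lowOccupied, Occupied, mem_move]

theorem exists_path_of_mem_lowOccupied (hab : a ≠ b) (hD : charge D = 0) (ha : a ∈ lowOccupied 2 D)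
    (hb : b ∈ lowOccupied 2 D) :
    ∃ D' ps, lowOccupied 2 D' = {a, b} ∧ (∀ c ∈ D', c.1 ≤ 2) ∧ IsPath ps D' D ∧
      ∀ m ∈ ps, 2 < m.1.1 ∧ m.2.1 ≤ 2 := by
  induction hu : (lowOccupied 2 D).card generalizing D with
  | zero => exact absurd ha (Finset.card_eq_zero.1 hu ▸ Finset.notMem_empty a)
  | succ u ih =>
    have hcard : (lowOccupied 2 D).card = 2 + (D.filter fun k => 2 < k.1).card := by
      have := card_lowOccupied_add_charge 2 D
      grind
    have hsub : {a, b} ⊆ lowOccupied 2 D := by grind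
    rcases hsub.eq_or_ssubset with heq | hssub
    · rw [← heq, Finset.card_pair hab, left_eq_add, Finset.card_eq_zero,
        Finset.filter_eq_empty_iff] at hcard
      exact ⟨D, [], heq.symm, fun c hc => not_lt.1 (hcard hc), rfl, by simp⟩
    · obtain ⟨g, hg, hgab⟩ := Finset.exists_of_ssubset hssub
      have hlt := Finset.card_lt_card hssub
      rw [Finset.card_pair hab] at hlt
      obtain ⟨c, hc⟩ := Finset.card_pos.1 (show 0 < (D.filter fun k => 2 < k.1).card by omega)
      rw [Finset.mem_filter] at hc
      have hlow := lowOccupied_move hc.2 hg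
      have hcan : CanMove (g, c) D := ⟨(mem_lowOccupied.1 hg).2, by grind [Occupied]⟩
      have hswap : move (c, g) D = move (g, c) D := by rw [move, move, Finset.pair_comm]
      obtain ⟨D', ps, hD', hhigh, hps, hmoves⟩ := ih (D := move (c, g) D)
        (by rw [hswap, charge_move hcan, hD]) (by grind) (by grind)
        (by rw [hlow, Finset.card_erase_of_mem hg, hu, Nat.add_sub_cancel])
      refine ⟨D', ps ++ [(c, g)], hD', hhigh, ?_, ?_⟩
      · rw [← move_move (c, g) D]
        exact hps.append_singleton
          ⟨(occupied_move_fst (m := (c, g))).2 hcan.2, fun h => occupied_move_snd.1 h hcan.1⟩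
      · grind [mem_lowOccupied]

theorem isPath_of_lowOccupied_eq_pair (hkl : k ≠ l) (hs : lowOccupied 2 s = {k, l})
    (hs2 : ∀ c ∈ s, c.1 ≤ 2) (hab : a ≠ b) (hD : lowOccupied 2 D = {a, b}) (hD2 : ∀ c ∈ D, c.1 ≤ 2)
    (ha : ¬ Occupied a s) (hb : ¬ Occupied b s) : IsPath [(k, a), (l, b)] s D := by
  have hmem : ∀ x, x = k ∨ x = l ↔ x.1 ≤ 2 ∧ Occupied x s := fun x => by
    simpa [hs] using mem_lowOccupied (p := 2) (D := s) (k := x)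
  have hmem' : ∀ x, x = a ∨ x = b ↔ x.1 ≤ 2 ∧ Occupied x D := fun x => by
    simpa [hD] using mem_lowOccupied (p := 2) (D := D) (k := x)
  have hk := hmem k
  have hl := hmem l
  refine ⟨⟨by grind, ha⟩, ⟨?_, ?_⟩, ext_occupied fun x => ?_⟩
  · grind [Occupied, mem_move]
  · grind [Occupied, mem_move]
  · have hx := hmem x
    have hx' := hmem' x
    have ha' := hmem' a
    have hb' := hmem' b
    grind [Occupied, mem_move]

end LowOccupied

section LevelSet

variable {s r D : Finset Idx} {k l a b : Idx} {n : ℕ} {ps : List (Idx × Idx)}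

/-- The monomials of charge zero which differ from the vacuum only in `[-n, p]`; they index the
basis of `⋀^p V_{n,p}`. -/
def levelSet (n p : ℕ) : Set (Finset Idx) :=
  {D | charge D = 0 ∧ ∀ k ∈ D, -(n : ℤ) ≤ k.1 ∧ k.1 ≤ p}

theorem card_lowOccupied_of_mem_levelSet {p : ℕ} (hD : D ∈ levelSet n p) :
    (lowOccupied p D).card = p := by
  have hcard := card_lowOccupied_add_charge p D
  rw [hD.1, Finset.filter_eq_empty_iff.2 fun k hk => (hD.2 k hk).2.not_gt] at hcard
  simpa using hcard

theorem levelSet_two_subset_thinSet (n : ℕ) : levelSet n 2 ⊆ thinSet n := fun D hD => by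
  refine ⟨hD.1, ?_⟩
  rw [Finset.filter_eq_empty_iff.2 (fun k hk => not_lt.2 (hD.2 k hk).1), Finset.card_empty]
  exact Nat.zero_le _

theorem exists_path_of_mem_levelSet (hs : s ∈ levelSet n 2) (hkl : k ≠ l)
    (hlow : lowOccupied 2 s = {k, l}) (hab : a ≠ b) (ha : a.1 < -(n : ℤ)) (hb : b.1 < -(n : ℤ))
    (hD : charge D = 0) (haD : a ∈ D) (hbD : b ∈ D) :
    ∃ ps, IsPath ((k, a) :: (l, b) :: ps) s D ∧ ∀ m ∈ ps, 2 < m.1.1 ∧ m.2.1 ≤ 2 := by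
  have hmem : ∀ c ∈ D, c.1 < -(n : ℤ) → c ∈ lowOccupied 2 D := fun c hc hcn =>
    mem_lowOccupied.2 ⟨by omega, iff_of_true hc (by omega)⟩
  have hvacant : ∀ c : Idx, c.1 < -(n : ℤ) → ¬ Occupied c s := fun c hc h =>
    (hs.2 c (h.2 (by omega))).1.not_gt hc
  obtain ⟨D', ps, hD', hhigh, hps, hmoves⟩ :=
    exists_path_of_mem_lowOccupied hab hD (hmem a haD ha) (hmem b hbD hb)
  obtain ⟨hfst, hsnd, rfl⟩ := isPath_of_lowOccupied_eq_pair hkl hlow (fun c hc => (hs.2 c hc).2) hab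
    hD' hhigh (hvacant a ha) (hvacant b hb)
  exact ⟨ps, ⟨hfst, hsnd, hps⟩, hmoves⟩

/-- The index lies outside `[-n, 2]`. -/
def Far (n : ℕ) (k : Idx) : Prop := k.1 < -(n : ℤ) ∨ 2 < k.1

instance (n : ℕ) : DecidablePred (Far n) := fun _ => inferInstanceAs (Decidable (_ ∨ _))

theorem isGraded_far (h : ∀ m ∈ ps, -(n : ℤ) ≤ m.1.1 ∧ m.2.1 ≤ 2 ∧ (Far n m.1 ∨ Far n m.2)) :
    IsGraded ps balanced (fun D => (D.filter (Far n)).card)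
      fun m => (({m.1, m.2} : Finset Idx).filter (Far n)).card where
  move_mem _ _ _ hD hcan := (charge_move hcan).trans hD
  degree_move m hm D _ hcan := by
    obtain ⟨hfst, hsnd, _⟩ := h m hm
    have hdisj : Disjoint (D.filter (Far n)) (({m.1, m.2} : Finset Idx).filter (Far n)) :=
      Finset.disjoint_left.2 fun x => by grind [Far, Occupied, CanMove]
    have hfar : (move m D).filter (Far n) =
        D.filter (Far n) ∪ ({m.1, m.2} : Finset Idx).filter (Far n) := by
      ext x
      have hx (h : x ∈ D.filter (Far n)) := Finset.disjoint_left.1 hdisj h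
      grind [mem_move]
    rw [hfar, Finset.card_union_of_disjoint hdisj]
  weight_pos m hm := by
    refine Finset.card_pos.2 ?_
    rcases (h m hm).2.2 with hfar | hfar
    exacts [⟨m.1, by simp [hfar]⟩, ⟨m.2, by simp [hfar]⟩]

end LevelSet

section BoundedRank

open MvPolynomial Set

variable {n : ℕ} {s r D : Finset Idx} {k l a b : Idx} {ps : List (Idx × Idx)}

theorem filter_far_eq_empty (hs : s ∈ levelSet n 2) : s.filter (Far n) = ∅ :=
  Finset.filter_eq_empty_iff.2 fun k hk => by
    have := hs.2 k hk
    grind [Far]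

theorem neg_le_of_mem_lowOccupied (hs : s ∈ levelSet n 2) (hk : k ∈ lowOccupied 2 s) :
    -(n : ℤ) ≤ k.1 := by
  by_contra h
  exact h (hs.2 k (mem_of_mem_lowOccupied hk (by omega))).1

theorem IsPath.eq_of_mem_levelSet (hs : s ∈ levelSet n 2) (hr : r ∈ levelSet n 2) (hkl : k ≠ l)
    (hlow : lowOccupied 2 s = {k, l}) (hla : l ≠ a) (h : IsPath ((k, a) :: (l, b) :: ps) r D) :
    r = s := by
  have hk := mem_lowOccupied.1 (show k ∈ lowOccupied 2 s by simp [hlow])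
  have hl := mem_lowOccupied.1 (show l ∈ lowOccupied 2 s by simp [hlow])
  have hsub : {k, l} ⊆ lowOccupied 2 r := Finset.insert_subset (mem_lowOccupied.2 ⟨hk.1, h.1.1⟩)
    (Finset.singleton_subset_iff.2 (mem_lowOccupied.2 ⟨hl.1,
      (occupied_move_of_ne (m := (k, a)) hkl.symm hla).1 h.2.1.1⟩))
  have heq := Finset.eq_of_subset_of_card_le hsub
    (by rw [card_lowOccupied_of_mem_levelSet hr, Finset.card_pair hkl])
  exact eq_of_lowOccupied_eq (heq.symm.trans hlow.symm) fun c hc =>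
    iff_of_false (fun h => (hr.2 c h).2.not_gt hc) fun h => (hs.2 c h).2.not_gt hc

theorem exists_isGraded_path (hs : s ∈ levelSet n 2) (hD : D ∈ balanced) (hD' : D ∉ thinSet n) :
    ∃ ps, ps ≠ [] ∧ IsPath ps s D ∧ IsGraded ps balanced (fun D => (D.filter (Far n)).card)
        (fun m => (({m.1, m.2} : Finset Idx).filter (Far n)).card) ∧
      ∀ r ∈ levelSet n 2, ∀ D', IsPath ps r D' → r = s := by
  obtain ⟨k, l, hkl, hlow⟩ := Finset.card_eq_two.1 (card_lowOccupied_of_mem_levelSet hs)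
  have hk := neg_le_of_mem_lowOccupied hs (show k ∈ lowOccupied 2 s by simp [hlow])
  have hl := neg_le_of_mem_lowOccupied hs (show l ∈ lowOccupied 2 s by simp [hlow])
  obtain ⟨a, b, ha, hb, hab⟩ := Finset.one_lt_card_iff.1 (not_le.1 fun h => hD' ⟨hD, h⟩)
  rw [Finset.mem_filter] at ha hb
  obtain ⟨ps, hps, hmoves⟩ := exists_path_of_mem_levelSet hs hkl hlow hab ha.2 hb.2 hD ha.1 hb.1
  refine ⟨_, List.cons_ne_nil _ _, hps, isGraded_far fun m hm => ?_, fun r hr D' h =>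
    h.eq_of_mem_levelSet hs hr hkl hlow (by grind)⟩
  grind [Far]

variable {K : Type*} [Field K] {ε : Idx × Idx → Finset Idx → K} {q : ℕ}
  {f : MvPolynomial (Finset Idx) K} {A : Subalgebra K ((Finset Idx → K) → K)}

theorem exists_hasseDeriv_mul_coord_pow_eq_of_notMem_thinSet [Infinite K] (hε : ∀ m D, ε m D ≠ 0)
    (hf : f ∈ supported K (levelSet n 2)) (hq : IsHasseOrder univ s f q)
    (hA : ∀ D' ∈ balanced, (D'.filter (Far n)).card < (D.filter (Far n)).card →
      (fun z => z D') ∈ A)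
    (hD : D ∈ balanced) (hD' : D ∉ thinSet n) :
    ∃ p ∈ A, ∀ z ∈ stableZeros (transvectionGroup ε univ) fun z => eval z f,
      eval z (hasseDeriv s q f) * z D ^ q = p z := by
  have hlevel : ∀ r ∈ f.vars, r ∈ levelSet n 2 := mem_supported.1 hf
  have hbalanced : ∀ r ∈ f.vars, r ∈ balanced := fun r hr => (hlevel r hr).1
  have hs := hq.mem_vars
  obtain ⟨ps, hne, hpath, hgraded, huniq⟩ := exists_isGraded_path (hlevel s hs) hD hD'
  have hcard := (hgraded.target (hbalanced s hs) hpath).2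
  have hlow : ∀ r ∈ f.vars, ∀ D' ∈ balanced, (D'.filter (Far n)).card < (r.filter (Far n)).card +
      (ps.map fun m => (({m.1, m.2} : Finset Idx).filter (Far n)).card).sum →
      (fun z => z D') ∈ A := fun r hr D' hD' hlt => hA D' hD' (by
    rwa [hcard, filter_far_eq_empty (hlevel s hs), ← filter_far_eq_empty (hlevel r hr)])
  exact exists_hasseDeriv_mul_pow_eq hq.ne_zero hne
    (exists_pathPoly_eq_add hε hgraded (hbalanced s hs) (hlow s hs) hpath)
    (fun r hr hrs => pathPoly_mem_coeffsIn hgraded (hbalanced r hr) (hlow r hr) fun D' h =>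
      absurd (huniq r (hlevel r hr) D' h) hrs)
    (fun z hz t => hz _ (pathPerm_mem t fun _ _ => mem_univ _))
    fun d hd hdq _ _ _ w _ => hq.lower d hd hdq w (mem_univ w)

theorem noetherianUpTo_hasseDeriv_ne_zero_of_levelSet [Infinite K] (hε : ∀ m D, ε m D ≠ 0)
    (hn : 2 ≤ n) (hf : f ∈ supported K (levelSet n 2)) (hq : IsHasseOrder univ s f q) :
    NoetherianUpTo (transvectionGroup ε univ) (polyFun K balanced : Set ((Finset Idx → K) → K))
      {z ∈ univ ∩ stableZeros (transvectionGroup ε univ) fun z => eval z f |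
        eval z (hasseDeriv s q f) ≠ 0} := by
  have hderiv := hasseDeriv_mem_supported hf s q
  have hthin : (fun z => eval z (hasseDeriv s q f)) ∈ polyFun K (thinSet n) :=
    polyFun_mono (levelSet_two_subset_thinSet n) (mem_polyFun.2 ⟨_, hderiv, fun _ => rfl⟩)
  refine NoetherianUpTo.of_le_rootClosure (n := n) (W := univ ∩ stableZeros _ _) (subset_univ _)
    (fun g hg z hz => ⟨mem_univ _, apply_mem_stableZeros hg hz.2⟩) (fun D hD k hk => ?_) hthin
    hq.ne_zero (hadd := hq.add_pow fun _ _ _ => mem_univ _)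
    (noetherianUpTo_of_card_outer_le hε _ n _ (saturated_thinSet n) fun D hD =>
      (Finset.card_filter_le _ _).trans (card_le_of_mem_thinSet hD))
    (polyFun_le_iff.2 fun D hD => ?_)
  · have := (mem_supported.1 hderiv hD).2 k hk
    omega
  · induction hcard : (D.filter (Far n)).card using Nat.strong_induction_on generalizing D with
    | _ c ih =>
      by_cases hD' : D ∈ thinSet n
      · exact le_rootClosure (coord_mem_polyFun hD')
      · obtain ⟨p, hp, hpz⟩ := exists_hasseDeriv_mul_coord_pow_eq_of_notMem_thinSet hε hf hq
          (fun D' hD' hlt => ih _ (hcard ▸ hlt) D' hD' rfl) hD hD'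
        exact mem_rootClosure_of_mul_pow hp fun z hz => hpz z hz.1.2

theorem noetherianUpTo_stableZeros [Infinite K] (hε : ∀ m D, ε m D ≠ 0) (hn : 2 ≤ n)
    (hf : f ∈ supported K (levelSet n 2)) (hf0 : f ≠ 0) :
    NoetherianUpTo (transvectionGroup ε univ) (polyFun K balanced : Set ((Finset Idx → K) → K))
      (stableZeros (transvectionGroup ε univ) fun z => eval z f) := by
  rw [← univ_inter (stableZeros _ _)]
  obtain ⟨z, hz⟩ : ∃ z, eval z f ≠ 0 := by
    by_contra! h
    exact hf0 (MvPolynomial.funext fun z => (h z).trans (map_zero _).symm)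
  refine .inter_stableZeros_eval (T := univ)
    (fun g hg => polyFun_comp_transvectionGroup (fun m _ D hD hm => (charge_move hm).trans hD) hg)
    (fun _ _ _ _ => mem_univ _) (fun f _ hfY hvanish => ?_)
    (fun f hf s _ q hq => noetherianUpTo_hasseDeriv_ne_zero_of_levelSet hε hn hf hq) hf
    ⟨z, mem_univ z, hz⟩
  obtain ⟨z, _, hz⟩ := hfY
  refine NoetherianUpTo.empty.mono subset_rfl fun w hw => hz ?_
  have hconst : eval z f = eval w f := eval_eq_of_hasseDeriv_vanish
    (fun _ _ _ _ => mem_univ _) hvanish (mem_univ w) fun r hr => (hr (mem_univ r)).elim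
  rw [hconst]
  exact hw.2 1 (one_mem _)

end BoundedRank

section BasisWedge

universe u

variable (K : Type u) [Field K]

/-- The product `x_{i₁} ∧ ⋯ ∧ x_{iᵣ}` in the exterior algebra of `V_∞`. -/
def basisProd (L : List Idx) : ExteriorAlgebra K (VInf K) :=
  (L.map fun i => ExteriorAlgebra.ι K (x K i)).prod

/-- The wedge product of the basis vectors indexed by `S`, in increasing order. -/
def basisWedge (S : Finset Idx) : ExteriorAlgebra K (VInf K) := basisProd K S.sort

variable {K} {L L' : List Idx} {S : Finset Idx} {D : Finset Idx} {i k : Idx} {p q : ℕ}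

theorem basisProd_cons : basisProd K (i :: L) = ExteriorAlgebra.ι K (x K i) * basisProd K L := by
  simp [basisProd]

theorem basisProd_append : basisProd K (L ++ L') = basisProd K L * basisProd K L' := by
  simp [basisProd]

theorem basisProd_map_posIdx (p q : ℕ) :
    basisProd K ((List.range' p q).map posIdx) = tail K p q := by
  rw [basisProd, tail, List.map_map]
  rfl

theorem exists_basisProd_eq_smul_of_perm (h : L.Perm L') :
    ∃ c : K, c ≠ 0 ∧ basisProd K L = c • basisProd K L' := by
  induction h with
  | nil => exact ⟨1, one_ne_zero, (one_smul _ _).symm⟩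
  | cons i _ ih =>
    obtain ⟨c, hc, h⟩ := ih
    exact ⟨c, hc, by rw [basisProd_cons, basisProd_cons, h, mul_smul_comm]⟩
  | swap i j L =>
    refine ⟨-1, neg_ne_zero.2 one_ne_zero, ?_⟩
    have h := ExteriorAlgebra.ι_add_mul_swap (R := K) (x K i) (x K j)
    rw [basisProd_cons, basisProd_cons, basisProd_cons, basisProd_cons, ← mul_assoc, ← mul_assoc,
      eq_neg_of_add_eq_zero_right h, neg_mul, neg_one_smul]
  | trans _ _ ih ih' =>
    obtain ⟨c, hc, h⟩ := ih
    obtain ⟨d, hd, h'⟩ := ih'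
    exact ⟨c * d, mul_ne_zero hc hd, by rw [h, h', mul_smul]⟩

theorem basisProd_eq_zero (h : ¬ L.Nodup) : basisProd K L = 0 := by
  obtain ⟨i, hi⟩ : ∃ i, List.Duplicate i L := by
    simpa [List.nodup_iff_forall_not_duplicate] using h
  obtain ⟨L', hL'⟩ := (List.duplicate_iff_sublist.1 hi).exists_perm_append
  obtain ⟨c, -, h⟩ := exists_basisProd_eq_smul_of_perm (K := K) hL'
  rw [h, List.cons_append, List.cons_append, basisProd_cons, basisProd_cons, ← mul_assoc,
    ExteriorAlgebra.ι_sq_zero, zero_mul, smul_zero]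

theorem exists_basisProd_eq_smul_basisWedge (h : L.Nodup) :
    ∃ c : K, c ≠ 0 ∧ basisProd K L = c • basisWedge K L.toFinset :=
  exists_basisProd_eq_smul_of_perm ((List.toFinset_toList h).symm.trans
    (Finset.sort_perm_toList _ _).symm)

theorem exists_ι_mul_basisWedge (h : i ∉ S) :
    ∃ c : K, c ≠ 0 ∧ ExteriorAlgebra.ι K (x K i) * basisWedge K S =
      c • basisWedge K (insert i S) := by
  obtain ⟨c, hc, h⟩ := exists_basisProd_eq_smul_basisWedge (K := K) (L := i :: S.sort)
    (List.nodup_cons.2 ⟨by simpa using h, S.sort_nodup _⟩)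
  exact ⟨c, hc, by rw [basisWedge, ← basisProd_cons, h, List.toFinset_cons, Finset.sort_toFinset]⟩

theorem ι_mul_basisWedge_of_mem (h : i ∈ S) :
    ExteriorAlgebra.ι K (x K i) * basisWedge K S = 0 := by
  rw [basisWedge, ← basisProd_cons]
  exact basisProd_eq_zero fun hn => (List.nodup_cons.1 hn).1 (by simpa using h)

theorem sort_lowOccupied (hD : ∀ k ∈ D, k.1 ≤ p) (hpq : p ≤ q) :
    (lowOccupied q D).sort = (lowOccupied p D).sort ++ (List.range' p (q - p)).map posIdx := by
  have hmem : ∀ k, k ∈ (List.range' p (q - p)).map posIdx ↔ (p : ℤ) < k.1 ∧ k.1 ≤ q := fun k => by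
    simp only [List.mem_map, List.mem_range'_1, eq_comm (b := k), eq_posIdx_iff]
    constructor
    · rintro ⟨j, hj, hk⟩
      omega
    · rintro ⟨h, h'⟩
      exact ⟨(k.1 - 1).toNat, by omega, by omega⟩
  have hmono : StrictMono posIdx := fun i j h => Subtype.mk_lt_mk.2 (by omega)
  refine (Finset.sortedLT_sort _).eq_of_mem_iff (List.Pairwise.sortedLT ?_) fun k => ?_
  · refine List.pairwise_append.2 ⟨(Finset.sortedLT_sort _).pairwise,
      (List.sortedLT_range' _ _ one_ne_zero).pairwise.map _ fun _ _ h => hmono h,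
      fun k hk l hl => ?_⟩
    rw [Finset.mem_sort, mem_lowOccupied] at hk
    exact Subtype.coe_lt_coe.1 (hk.1.trans_lt ((hmem l).1 hl).1)
  · have := k.2
    have := hD k
    rw [List.mem_append, hmem, Finset.mem_sort, Finset.mem_sort, mem_lowOccupied, mem_lowOccupied,
      Occupied]
    grind

theorem basisWedge_lowOccupied (hD : ∀ k ∈ D, k.1 ≤ p) (hpq : p ≤ q) :
    basisWedge K (lowOccupied q D) = basisWedge K (lowOccupied p D) * tail K p (q - p) := by
  rw [basisWedge, sort_lowOccupied hD hpq, basisProd_append, basisProd_map_posIdx, basisWedge]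

end BasisWedge

section Monomials

universe u

variable {K : Type u} [Field K] {a b : ℕ × ℕ} {n p : ℕ} {D S : Finset Idx} {k : Idx}

theorem levelSet_mono (h : a ≤ b) : levelSet a.1 a.2 ⊆ levelSet b.1 b.2 := fun D hD =>
  ⟨hD.1, fun k hk => by
    have := h.1
    have := h.2
    have := hD.2 k hk
    omega⟩

theorem mem_Icc_of_mem_lowOccupied (hD : D ∈ levelSet n p) (hk : k ∈ lowOccupied p D) :
    -(n : ℤ) ≤ k.1 ∧ k.1 ≤ p := by
  refine ⟨?_, (mem_lowOccupied.1 hk).1⟩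
  rcases lt_or_ge k.1 0 with h | h
  · exact (hD.2 k (mem_of_mem_lowOccupied hk h)).1
  · omega

theorem lowOccupied_lowOccupied (hS : ∀ k ∈ S, k.1 ≤ p) : lowOccupied p (lowOccupied p S) = S := by
  ext k
  have := hS k
  grind [mem_lowOccupied, Occupied]

theorem lowOccupied_mem_levelSet (hS : ∀ k ∈ S, -(n : ℤ) ≤ k.1 ∧ k.1 ≤ p) (hcard : S.card = p) :
    lowOccupied p S ∈ levelSet n p := by
  refine ⟨?_, fun k hk => ⟨?_, (mem_lowOccupied.1 hk).1⟩⟩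
  · have h := card_lowOccupied_add_charge p (lowOccupied p S)
    rw [lowOccupied_lowOccupied fun k hk => (hS k hk).2, Finset.filter_eq_empty_iff.2
      fun k hk => (mem_lowOccupied.1 hk).1.not_gt, Finset.card_empty, hcard] at h
    simpa using h
  · rcases lt_or_ge k.1 0 with h | h
    · exact (hS k (mem_of_mem_lowOccupied hk h)).1
    · omega

/-- The wedge product of the vectors `x_i ∈ V_{n,p}`, `i ∈ S`, in increasing order. -/
def levelWedge (K : Type u) [Field K] (S : Finset Idx)
    (hS : ∀ k ∈ S, -(n : ℤ) ≤ k.1 ∧ k.1 ≤ p) (hcard : S.card = p) : ⋀[K]^p (Vnp K n p) :=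
  exteriorPower.ιMulti K p fun j => ⟨x K (S.orderEmbOfFin hcard j),
    x_mem_Vnp (hS _ (S.orderEmbOfFin_mem hcard j)).1 (hS _ (S.orderEmbOfFin_mem hcard j)).2⟩

theorem map_subtype_levelWedge (hS : ∀ k ∈ S, -(n : ℤ) ≤ k.1 ∧ k.1 ≤ p) (hcard : S.card = p) :
    ExteriorAlgebra.map (Vnp K n p).subtype (levelWedge K S hS hcard).1 = basisWedge K S := by
  rw [levelWedge, exteriorPower.ιMulti_apply_coe, ExteriorAlgebra.map_apply_ιMulti,
    ExteriorAlgebra.ιMulti_apply, basisWedge, basisProd, ← S.listMap_orderEmbOfFin_finRange hcard,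
    List.map_map, List.ofFn_eq_map]
  rfl

open Classical in
variable (K) in
/-- The monomial recorded by `D` as an element of `⋀^p V_{n,p}`, where `a = (n, p)`; it is `0` if
the monomial is not one of that level. -/
def levelMonomial (a : ℕ × ℕ) (D : Finset Idx) : ⋀[K]^a.2 (Vnp K a.1 a.2) :=
  if hD : D ∈ levelSet a.1 a.2 then
    levelWedge K (lowOccupied a.2 D) (fun _ hk => mem_Icc_of_mem_lowOccupied hD hk)
      (card_lowOccupied_of_mem_levelSet hD)
  else 0

theorem map_subtype_levelMonomial (hD : D ∈ levelSet a.1 a.2) :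
    ExteriorAlgebra.map (Vnp K a.1 a.2).subtype (levelMonomial K a D).1 =
      basisWedge K (lowOccupied a.2 D) := by
  rw [levelMonomial, dif_pos hD, map_subtype_levelWedge]

theorem trans_levelMonomial (hab : a ≤ b) (hD : D ∈ levelSet a.1 a.2) :
    trans K a b hab (levelMonomial K a D) = levelMonomial K b D := by
  apply Subtype.ext
  apply map_subtype_injective
  rw [map_subtype_trans, map_subtype_levelMonomial hD,
    map_subtype_levelMonomial (levelSet_mono hab hD),
    basisWedge_lowOccupied (fun k hk => (hD.2 k hk).2) hab.2]

variable (K) in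
/-- The monomial recorded by `D` as an element of the infinite wedge; it is `0` if `D` has nonzero
charge. -/
def monomial (D : Finset Idx) : InfWedge K :=
  toInfWedge K (D.sup fun k => k.1.natAbs, D.sup fun k => k.1.natAbs) (levelMonomial K _ D)

theorem mem_levelSet_of_sup_natAbs_le (hD : charge D = 0) (hn : (D.sup fun k => k.1.natAbs) ≤ n)
    (hp : (D.sup fun k => k.1.natAbs) ≤ p) : D ∈ levelSet n p :=
  ⟨hD, fun k hk => by
    have : k.1.natAbs ≤ D.sup fun k => k.1.natAbs := Finset.le_sup (f := fun k => k.1.natAbs) hk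
    omega⟩

theorem monomial_eq_zero (hD : charge D ≠ 0) : monomial K D = 0 := by
  rw [monomial, levelMonomial, dif_neg fun h => hD h.1, map_zero]

theorem toInfWedge_levelMonomial (hD : D ∈ levelSet a.1 a.2) :
    toInfWedge K a (levelMonomial K a D) = monomial K D := by
  set c : ℕ × ℕ := (D.sup fun k => k.1.natAbs, D.sup fun k => k.1.natAbs)
  rw [monomial, ← toInfWedge_trans a (a ⊔ c) le_sup_left, trans_levelMonomial le_sup_left hD,
    ← toInfWedge_trans c (a ⊔ c) le_sup_right,
    trans_levelMonomial le_sup_right (mem_levelSet_of_sup_natAbs_le hD.1 le_rfl le_rfl)]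

theorem ιMulti_mem_span_levelMonomial {v : Fin p → Vnp K n p}
    (hv : ∀ j, ∃ i : Idx, (-(n : ℤ) ≤ i.1 ∧ i.1 ≤ p) ∧ x K i = v j) :
    exteriorPower.ιMulti K p v ∈
      Submodule.span K (levelMonomial K (n, p) '' levelSet n p) := by
  choose i hi hx using hv
  have hmap : ExteriorAlgebra.map (Vnp K n p).subtype (exteriorPower.ιMulti K p v).1 =
      basisProd K (List.ofFn i) := by
    rw [exteriorPower.ιMulti_apply_coe, ExteriorAlgebra.map_apply_ιMulti,
      ExteriorAlgebra.ιMulti_apply, basisProd, List.map_ofFn]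
    simp [Function.comp_def, hx]
  by_cases hnodup : (List.ofFn i).Nodup
  · have hS : ∀ k ∈ (List.ofFn i).toFinset, -(n : ℤ) ≤ k.1 ∧ k.1 ≤ p := fun k hk => by
      obtain ⟨j, rfl⟩ := (List.mem_ofFn' _ _).1 (List.mem_toFinset.1 hk)
      exact hi j
    have hD := lowOccupied_mem_levelSet hS
      ((List.toFinset_card_of_nodup hnodup).trans List.length_ofFn)
    obtain ⟨c, -, hc⟩ := exists_basisProd_eq_smul_basisWedge (K := K) hnodup
    have hω : exteriorPower.ιMulti K p v =
        c • levelMonomial K (n, p) (lowOccupied p (List.ofFn i).toFinset) := by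
      apply Subtype.ext
      apply map_subtype_injective (n, p)
      rw [Submodule.coe_smul, map_smul, map_subtype_levelMonomial hD,
        lowOccupied_lowOccupied fun k hk => (hS k hk).2, ← hc]
      exact hmap
    rw [hω]
    exact Submodule.smul_mem _ _ (Submodule.subset_span ⟨_, hD, rfl⟩)
  · have hω : exteriorPower.ιMulti K p v = 0 := by
      apply Subtype.ext
      apply map_subtype_injective (n, p)
      rw [Submodule.coe_zero, map_zero, ← basisProd_eq_zero hnodup]
      exact hmap
    rw [hω]
    exact zero_mem _

variable (K) in
theorem span_levelMonomial (a : ℕ × ℕ) :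
    Submodule.span K (levelMonomial K a '' levelSet a.1 a.2) = ⊤ := by
  have hx : Submodule.span K ((↑) ⁻¹' (x K '' {i : Idx | -(a.1 : ℤ) ≤ i ∧ (i : ℤ) ≤ a.2}) :
      Set (Vnp K a.1 a.2)) = ⊤ := Submodule.span_span_coe_preimage
  rw [eq_top_iff, ← exteriorPower.ιMulti_span_of_span K a.2 _ hx, Submodule.span_le]
  rintro _ ⟨v, hv, rfl⟩
  exact ιMulti_mem_span_levelMonomial fun j => hv ⟨j, rfl⟩

variable (K) in
theorem span_monomial : Submodule.span K (monomial K '' balanced) = ⊤ := by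
  rw [eq_top_iff]
  rintro z -
  obtain ⟨a, -, ω, rfl⟩ := exists_toInfWedge 0 z
  have hω : ω ∈ Submodule.span K (levelMonomial K a '' levelSet a.1 a.2) :=
    span_levelMonomial K a ▸ Submodule.mem_top
  refine Submodule.span_mono ?_ (Submodule.apply_mem_span_image_of_mem_span (toInfWedge K a) hω)
  rintro _ ⟨_, ⟨D, hD, rfl⟩, rfl⟩
  exact ⟨D, hD.1, (toInfWedge_levelMonomial hD).symm⟩

end Monomials

section InfWedgeTransvections

universe u

variable {K : Type u} [Field K] {a : ℕ × ℕ} {n p : ℕ} {i j k : Idx} {m : Idx × Idx}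
  {D S : Finset Idx}

variable (K) in
/-- The coordinate function dual to `x_k`. -/
def coordFun (k : Idx) : VInf K →ₗ[K] K := Finsupp.lapply k

theorem coordFun_x (k i : Idx) : coordFun K k (x K i) = if i = k then 1 else 0 :=
  Finsupp.single_apply

theorem coordFun_smul_x (h : k ≠ i) (t : K) : coordFun K k (t • x K i) = 0 := by
  rw [map_smul, coordFun_x, if_neg h.symm, smul_zero]

/-- The transvection `x_k ↦ x_k + t x_i` of `V_∞`. -/
def basisTransvection (h : k ≠ i) (t : K) : VInf K ≃ₗ[K] VInf K :=
  LinearEquiv.transvection (coordFun_smul_x h t)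

theorem basisTransvection_apply (h : k ≠ i) (t : K) (v : VInf K) :
    basisTransvection h t v = v + coordFun K k v • t • x K i := rfl

theorem basisTransvection_x_self (h : k ≠ i) (t : K) :
    basisTransvection h t (x K k) = x K k + t • x K i := by
  rw [basisTransvection_apply, coordFun_x, if_pos rfl, one_smul]

theorem basisTransvection_x_of_ne (h : k ≠ i) (hj : j ≠ k) (t : K) :
    basisTransvection h t (x K j) = x K j := by
  rw [basisTransvection_apply, coordFun_x, if_neg hj, zero_smul, add_zero]

theorem basisTransvection_mem_Gnp (h : k ≠ i) (t : K) (hk : -(a.1 : ℤ) ≤ k.1 ∧ k.1 ≤ a.2)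
    (hi : -(a.1 : ℤ) ≤ i.1 ∧ i.1 ≤ a.2) : basisTransvection h t ∈ Gnp K a := by
  refine ⟨Submodule.eq_of_le_of_finrank_eq ?_ (LinearEquiv.finrank_map_eq _ _), fun j hj =>
    basisTransvection_x_of_ne h (fun hjk : j = k => hj (hjk ▸ hk)) t⟩
  rintro _ ⟨v, hv, rfl⟩
  exact add_mem hv (Submodule.smul_mem _ _ (Submodule.smul_mem _ _ (x_mem_Vnp hi.1 hi.2)))

/-- The transvection `x_k ↦ x_k + t x_i` as an element of `G_∞`. -/
def transvInf (h : k ≠ i) (t : K) : GInf K :=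
  ⟨basisTransvection h t, (max k.1.natAbs i.1.natAbs, max k.1.natAbs i.1.natAbs),
    basisTransvection_mem_Gnp h t (by dsimp only; omega) (by dsimp only; omega)⟩

theorem map_basisTransvection_basisWedge (h : k ≠ i) (t : K) (hk : k ∉ S) :
    ExteriorAlgebra.map (basisTransvection h t).toLinearMap (basisWedge K S) = basisWedge K S := by
  rw [basisWedge, basisProd, map_list_prod, List.map_map]
  congr 1
  refine List.map_congr_left fun j hj => ?_
  have hjk : j ≠ k := by
    rintro rfl
    exact hk (by simpa using hj)
  have := basisTransvection_x_of_ne (K := K) h hjk t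
  simp [this]

theorem exists_map_basisTransvection_basisWedge (h : k ≠ i) (S : Finset Idx) :
    ∃ e : K, e ≠ 0 ∧ ∀ t,
      ExteriorAlgebra.map (basisTransvection h t).toLinearMap (basisWedge K S) = basisWedge K S +
        if k ∈ S ∧ i ∉ S then (t * e) • basisWedge K (insert i (S.erase k)) else 0 := by
  by_cases hk : k ∈ S
  swap
  · exact ⟨1, one_ne_zero, fun t => by
      rw [if_neg fun h => hk h.1, add_zero, map_basisTransvection_basisWedge h t hk]⟩
  obtain ⟨c, hc, hcS⟩ := exists_ι_mul_basisWedge (K := K) (S.notMem_erase k)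
  rw [Finset.insert_erase hk] at hcS
  have hmap : ∀ t, ExteriorAlgebra.map (basisTransvection h t).toLinearMap (basisWedge K S) =
      basisWedge K S +
        (c⁻¹ * t) • (ExteriorAlgebra.ι K (x K i) * basisWedge K (S.erase k)) := fun t => by
    rw [← inv_smul_smul₀ hc (basisWedge K S), ← hcS, map_smul, map_mul,
      map_basisTransvection_basisWedge h t (S.notMem_erase k), ExteriorAlgebra.map_apply_ι,
      LinearEquiv.coe_coe, basisTransvection_x_self, map_add, map_smul, add_mul, smul_mul_assoc,
      smul_add, mul_smul]
  by_cases hi : i ∈ S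
  · refine ⟨1, one_ne_zero, fun t => ?_⟩
    rw [hmap, ι_mul_basisWedge_of_mem (Finset.mem_erase.2 ⟨h.symm, hi⟩), smul_zero,
      if_neg fun h => h.2 hi]
  · obtain ⟨d, hd, hdS⟩ := exists_ι_mul_basisWedge (K := K)
      (show i ∉ S.erase k from fun h => hi (Finset.mem_of_mem_erase h))
    refine ⟨c⁻¹ * d, mul_ne_zero (inv_ne_zero hc) hd, fun t => ?_⟩
    rw [hmap, hdS, if_pos ⟨hk, hi⟩, smul_smul]
    congr 2
    ring

theorem lowOccupied_move_of_canMove (hm : CanMove m D) (hsnd : m.2.1 ≤ p) :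
    lowOccupied p (move m D) = insert m.2 ((lowOccupied p D).erase m.1) := by
  ext k
  grind [mem_lowOccupied, mem_move, Occupied, CanMove]

theorem move_mem_levelSet (hD : D ∈ levelSet n p) (hm : CanMove m D)
    (hfst : -(n : ℤ) ≤ m.1.1 ∧ m.1.1 ≤ p) (hsnd : -(n : ℤ) ≤ m.2.1 ∧ m.2.1 ≤ p) :
    move m D ∈ levelSet n p :=
  ⟨(charge_move hm).trans hD.1, fun k hk => by
    have := hD.2 k
    grind [mem_move]⟩

theorem exists_extAct_levelMonomial (h : m.1 ≠ m.2) (hD : D ∈ levelSet a.1 a.2)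
    (hfst : -(a.1 : ℤ) ≤ m.1.1 ∧ m.1.1 ≤ a.2) (hsnd : -(a.1 : ℤ) ≤ m.2.1 ∧ m.2.1 ≤ a.2) :
    ∃ e : K, e ≠ 0 ∧ ∀ t,
      extAct a _ (basisTransvection_mem_Gnp h t hfst hsnd) (levelMonomial K a D) =
        levelMonomial K a D +
          if CanMove m D then (t * e) • levelMonomial K a (move m D) else 0 := by
  obtain ⟨e, he, hmap⟩ := exists_map_basisTransvection_basisWedge (K := K) h (lowOccupied a.2 D)
  refine ⟨e, he, fun t => Subtype.ext (map_subtype_injective a ?_)⟩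
  have hcan : (m.1 ∈ lowOccupied a.2 D ∧ m.2 ∉ lowOccupied a.2 D) ↔ CanMove m D := by
    simp [mem_lowOccupied, hfst.2, hsnd.2, CanMove]
  rw [map_subtype_extAct, map_subtype_levelMonomial hD, hmap, Submodule.coe_add, map_add,
    map_subtype_levelMonomial hD]
  congr 1
  by_cases hm : CanMove m D
  · rw [if_pos (hcan.2 hm), if_pos hm, Submodule.coe_smul, map_smul,
      map_subtype_levelMonomial (move_mem_levelSet hD hm hfst hsnd),
      lowOccupied_move_of_canMove hm hsnd.2]
  · rw [if_neg (hcan.not.2 hm), if_neg hm, Submodule.coe_zero, map_zero]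

theorem exists_act_transvInf_monomial (h : m.1 ≠ m.2) (D : Finset Idx) :
    ∃ e : K, e ≠ 0 ∧ ∀ t, act (transvInf h t) (monomial K D) =
      monomial K D + if CanMove m D then (t * e) • monomial K (move m D) else 0 := by
  by_cases hcharge : charge D = 0
  · let M := (insert m.1 (insert m.2 D)).sup fun k => k.1.natAbs
    let a : ℕ × ℕ := (M, M)
    have hle : ∀ k ∈ insert m.1 (insert m.2 D), -(a.1 : ℤ) ≤ k.1 ∧ k.1 ≤ a.2 := fun k hk => by
      have : k.1.natAbs ≤ M := Finset.le_sup (f := fun k : Idx => k.1.natAbs) hk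
      dsimp only [a]
      omega
    have hD : D ∈ levelSet a.1 a.2 := ⟨hcharge, fun k hk => hle k (by simp [hk])⟩
    have hfst := hle m.1 (by simp)
    have hsnd := hle m.2 (by simp)
    obtain ⟨e, he, hact⟩ := exists_extAct_levelMonomial (K := K) h hD hfst hsnd
    refine ⟨e, he, fun t => ?_⟩
    rw [← toInfWedge_levelMonomial hD, act_toInfWedge (transvInf h t) a
      (basisTransvection_mem_Gnp h t hfst hsnd)]
    refine (congrArg (toInfWedge K a) (hact t)).trans ?_
    rw [map_add]
    congr 1
    split_ifs with hm
    · rw [map_smul, toInfWedge_levelMonomial (move_mem_levelSet hD hm hfst hsnd)]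
    · rw [map_zero]
  · refine ⟨1, one_ne_zero, fun t => ?_⟩
    rw [monomial_eq_zero hcharge, map_zero, zero_add]
    split_ifs with hm
    · rw [monomial_eq_zero (by rwa [charge_move hm]), smul_zero]
    · rfl

end InfWedgeTransvections

section DualWedge

universe u

variable {K : Type u} [Field K]

variable (K) in
/-- The action of `G_∞` on the dual infinite wedge, contragredient to its action on the infinite
wedge. -/
def dualPerm : GInf K →* Equiv.Perm (Module.Dual K (InfWedge K)) :=
  (MulAction.toPermHom (Module.Dual K (InfWedge K) →ₗ[K] Module.Dual K (InfWedge K))ˣ _).comp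
    (infWedgeRep K).dual.asGroupHom

theorem dualPerm_apply (g : GInf K) (ω : Module.Dual K (InfWedge K)) :
    dualPerm K g ω = ω ∘ₗ infWedgeRep K g⁻¹ :=
  rfl

theorem evalAt_smul (ω : Module.Dual K (InfWedge K)) (g : GInf K) (F : CoordRing K) :
    evalAt ω (g • F) = evalAt (dualPerm K g⁻¹ ω) F := by
  have h : (evalAt ω).comp (polyAct g) = evalAt (dualPerm K g⁻¹ ω) := by
    apply SymmetricAlgebra.algHom_ext
    ext1 z
    rw [dualPerm_apply, inv_inv]
    simp [polyAct, evalAt]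
  exact congr($h F)

theorem mem_zeroSet_orbit {S : Set (CoordRing K)} {ω : Module.Dual K (InfWedge K)} :
    ω ∈ zeroSet (⋃ F ∈ S, MulAction.orbit (GInf K) F) ↔
      ∀ F ∈ S, ω ∈ stableZeros (dualPerm K).range fun ω => evalAt ω F := by
  constructor
  · rintro h F hF _ ⟨g, rfl⟩
    have hg := h (g⁻¹ • F) (Set.mem_biUnion hF (MulAction.mem_orbit F g⁻¹))
    rwa [evalAt_smul, inv_inv] at hg
  · intro h F' hF'
    obtain ⟨F, hF, g, rfl⟩ := Set.mem_iUnion₂.1 hF'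
    exact (evalAt_smul ω g F).trans (h F hF _ ⟨g⁻¹, rfl⟩)

/-- The coordinates of a point of the dual infinite wedge, indexed by finite sets `D`; they vanish
unless `D` is balanced. -/
def coords (ω : Module.Dual K (InfWedge K)) (D : Finset Idx) : K := ω (monomial K D)

theorem coords_transvInf {m : Idx × Idx} (hm : m.1 ≠ m.2) {ε : Idx × Idx → Finset Idx → K}
    (hε : ∀ D t, act (transvInf hm t) (monomial K D) = monomial K D +
      if CanMove m D then (t * ε m D) • monomial K (move m D) else 0)
    (t : K) (ω : Module.Dual K (InfWedge K)) :
    coords (dualPerm K (transvInf hm t)⁻¹ ω) = transvection ε m t (coords ω) := by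
  funext D
  have h : coords (dualPerm K (transvInf hm t)⁻¹ ω) D =
      ω (act (transvInf hm t) (monomial K D)) := by
    rw [coords, dualPerm_apply, inv_inv]
    rfl
  rw [h, hε, map_add, apply_ite ω, map_smul, map_zero, transvection_apply]
  rfl

variable (K) in
theorem exists_transvectionGroup_lift :
    ∃ ε : Idx × Idx → Finset Idx → K, (∀ m D, ε m D ≠ 0) ∧
      ∀ e ∈ transvectionGroup ε Set.univ, ∃ g : GInf K,
        ∀ ω, coords (dualPerm K g ω) = e (coords ω) := by
  choose ε hε0 hε using fun (m : {m : Idx × Idx // m.1 ≠ m.2}) =>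
    exists_act_transvInf_monomial (K := K) m.2
  classical
  refine ⟨fun m D => if hm : m.1 ≠ m.2 then ε ⟨m, hm⟩ D else 1, fun m D => ?_, fun e he => ?_⟩
  · dsimp only
    split_ifs with hm
    exacts [hε0 ⟨m, hm⟩ D, one_ne_zero]
  induction he using Subgroup.closure_induction with
  | mem e he =>
    obtain ⟨m, -, t, rfl⟩ := he
    by_cases hm : m.1 = m.2
    · have hmove (D) : ¬ CanMove m D := fun h => h.2 (hm ▸ h.1)
      exact ⟨1, fun ω => funext fun D => by simp [transvection_apply, hmove]⟩
    · refine ⟨(transvInf hm t)⁻¹, coords_transvInf hm (fun D t => ?_) t⟩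
      rw [dif_pos hm, hε ⟨m, hm⟩ D t]
  | one => exact ⟨1, fun ω => by simp⟩
  | mul _ _ _ _ h₁ h₂ =>
    obtain ⟨g₁, h₁⟩ := h₁
    obtain ⟨g₂, h₂⟩ := h₂
    exact ⟨g₁ * g₂, fun ω => by simp [h₁, h₂]⟩
  | inv _ _ h =>
    obtain ⟨g, h⟩ := h
    exact ⟨g⁻¹, fun ω => by rw [Equiv.Perm.eq_inv_iff_eq, ← h, ← Equiv.Perm.mul_apply, ← map_mul,
      mul_inv_cancel, map_one, Equiv.Perm.one_apply]⟩

theorem exists_polyFun_lift {ι M : Type*} [AddCommGroup M] [Module K M] {y : ι → M} {S : Set ι}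
    (hy : Submodule.span K (y '' S) = ⊤) (F : SymmetricAlgebra K M) :
    ∃ f ∈ polyFun K S, ∀ ω : Module.Dual K M, SymmetricAlgebra.lift ω F = f fun i => ω (y i) := by
  let pull : ((ι → K) → K) →ₐ[K] (Module.Dual K M → K) :=
    AlgHom.pi fun ω => Pi.evalAlgHom K _ fun i => ω (y i)
  let evals : SymmetricAlgebra K M →ₐ[K] (Module.Dual K M → K) :=
    AlgHom.pi fun ω => SymmetricAlgebra.lift ω
  have hι (v : M) : evals (SymmetricAlgebra.ι K M v) = fun ω => ω v :=
    funext fun ω => SymmetricAlgebra.lift_ι_apply ω v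
  suffices evals F ∈ (polyFun K S).map pull by
    obtain ⟨f, hf, h⟩ := this
    exact ⟨f, hf, fun ω => (congrFun h ω).symm⟩
  induction F using SymmetricAlgebra.induction with
  | algebraMap r => rw [AlgHom.commutes]; exact Subalgebra.algebraMap_mem _ r
  | ι v =>
    have hv : v ∈ Submodule.span K (y '' S) := hy ▸ Submodule.mem_top
    have hspan : Submodule.span K (y '' S) ≤ ((polyFun K S).map pull).toSubmodule.comap
        (evals.toLinearMap ∘ₗ SymmetricAlgebra.ι K M) := by
      rw [Submodule.span_le]
      rintro _ ⟨i, hi, rfl⟩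
      exact ⟨_, coord_mem_polyFun hi, (hι (y i)).symm⟩
    exact hspan hv
  | mul _ _ h₁ h₂ => rw [map_mul]; exact mul_mem h₁ h₂
  | add _ _ h₁ h₂ => rw [map_add]; exact add_mem h₁ h₂

variable (K) in
/-- The polynomial functions on the dual infinite wedge. -/
def dualFun : Set (Module.Dual K (InfWedge K) → K) :=
  Set.range fun (F : CoordRing K) ω => evalAt ω F

theorem noetherianUpTo_dual [Infinite K] {n : ℕ} (hn : 2 ≤ n) {f : MvPolynomial (Finset Idx) K}
    (hf : f ∈ MvPolynomial.supported K (levelSet n 2)) (hf0 : f ≠ 0) :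
    NoetherianUpTo (dualPerm K).range (dualFun K)
      (stableZeros (dualPerm K).range fun ω => MvPolynomial.eval (coords ω) f) := by
  obtain ⟨ε, hε, hlift⟩ := exists_transvectionGroup_lift K
  refine (noetherianUpTo_stableZeros hε hn hf hf0).comap coords ?_ ?_ ?_
  · intro ω hω e he
    obtain ⟨g, h⟩ := hlift e he
    rw [← h]
    exact hω _ ⟨g, rfl⟩
  · intro e he
    obtain ⟨g, h⟩ := hlift e he
    exact ⟨dualPerm K g, ⟨g, rfl⟩, fun ω hω =>
      ⟨apply_mem_stableZeros (MonoidHom.mem_range.2 ⟨g, rfl⟩) hω, h ω⟩⟩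
  · rintro _ ⟨F, rfl⟩
    obtain ⟨f', hf', h⟩ := exists_polyFun_lift (span_monomial K) F
    exact ⟨f', hf', fun ω _ => (h ω).congr_left⟩

end DualWedge

section Pairing

universe u

variable {K : Type u} [Field K]
variable {V W : Type u} [AddCommGroup V] [Module K V] [AddCommGroup W] [Module K W]

open exteriorPower

/-- The product `wedge` as a bilinear map. -/
def wedgeHom (p n : ℕ) : ⋀[K]^p V →ₗ[K] ⋀[K]^n V →ₗ[K] ⋀[K]^(p + n) V :=
  LinearMap.mk₂ K wedge
    (fun _ _ _ => Subtype.ext (add_mul _ _ _)) (fun _ _ _ => Subtype.ext (smul_mul_assoc _ _ _))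
    (fun _ _ _ => Subtype.ext (mul_add _ _ _)) (fun _ _ _ => Subtype.ext (mul_smul_comm _ _ _))

theorem wedge_ιMulti_ιMulti {r s : ℕ} (v : Fin r → V) (w : Fin s → V) :
    wedge (ιMulti K r v) (ιMulti K s w) =
      ιMulti K (r + s) (Sum.elim v w ∘ finSumFinEquiv.symm) := by
  have happend : Fin.append v w = Sum.elim v w ∘ finSumFinEquiv.symm := by
    funext i
    refine Fin.addCases (fun i => ?_) (fun i => ?_) i <;> simp
  rw [← happend]
  exact Subtype.ext (ExteriorAlgebra.ιMulti_mul_ιMulti v w)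

theorem pairingDual_map_dualMap {n : ℕ} (f : V →ₗ[K] W) (η : ⋀[K]^n (Module.Dual K W))
    (m : ⋀[K]^n V) :
    pairingDual K V n (map n f.dualMap η) m = pairingDual K W n η (map n f m) := by
  have h : pairingDual K V n ∘ₗ map n f.dualMap = (map n f).dualMap ∘ₗ pairingDual K W n := by
    ext y v
    simp
  exact congr($h η m)

theorem pairingDual_map_eval {n : ℕ} (m : ⋀[K]^n V) (η : ⋀[K]^n (Module.Dual K V)) :
    pairingDual K (Module.Dual K V) n (map n (Module.Dual.eval K V) m) η =
      pairingDual K V n η m := by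
  have h : pairingDual K (Module.Dual K V) n ∘ₗ map n (Module.Dual.eval K V) =
      (pairingDual K V n).flip := by
    ext v y
    simp only [LinearMap.compAlternatingMap_apply, LinearMap.comp_apply, map_apply_ιMulti,
      pairingDual_ιMulti_ιMulti, LinearMap.flip_apply]
    rw [← Matrix.det_transpose]
    rfl
  exact congr($h m η)

theorem pairingDual_bijective [FiniteDimensional K V] (n : ℕ) :
    Function.Bijective (pairingDual K V n) := by
  have hsurj : Function.Surjective (pairingDual K V n) := by
    let b := Module.finBasis K V
    intro φ
    refine ⟨∑ s, φ (b.exteriorPower n s) • ιMulti_family K n b.coord s, ?_⟩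
    rw [map_sum]
    conv_rhs => rw [← (b.exteriorPower n).sum_dual_apply_smul_coord φ]
    exact Finset.sum_congr rfl fun s _ => by rw [map_smul, basis_coord]; rfl
  refine ⟨(LinearMap.injective_iff_surjective_of_finrank_eq_finrank ?_).2 hsurj, hsurj⟩
  rw [Subspace.dual_finrank_eq, finrank_eq, finrank_eq, Subspace.dual_finrank_eq]

theorem exists_hodgeDual [FiniteDimensional K V] {p n : ℕ} (hV : Module.finrank K V = p + n)
    (ψ : ⋀[K]^(p + n) V ≃ₗ[K] K) :
    ∃ star : ⋀[K]^p V →ₗ[K] ⋀[K]^n (Module.Dual K V), IsHodgeDual star ∧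
      ∀ ω η, pairingDual K V n (star ω) η = ψ (wedge ω η) := by
  let pairing := LinearEquiv.ofBijective (pairingDual K V n) (pairingDual_bijective n)
  let star := pairing.symm.toLinearMap ∘ₗ (wedgeHom p n).compr₂ ψ.toLinearMap
  have hstar (ω η) : pairingDual K V n (star ω) η = ψ (wedge ω η) :=
    LinearMap.congr_fun (pairing.apply_symm_apply ((wedgeHom p n).compr₂ ψ.toLinearMap ω)) η
  exact ⟨star, ⟨hV, ψ, hstar⟩, hstar⟩

section Volume

variable {ι : Type*} [Fintype ι] [DecidableEq ι]

/-- The isomorphism `⋀^d V ≃ K` taking the value `1` on the wedge product of the basis `b`, in the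
order given by `κ`. -/
def volume {d : ℕ} (b : Module.Basis ι K V) (κ : Fin d ≃ ι) : ⋀[K]^d V ≃ₗ[K] K :=
  have hone : alternatingMapLinearEquiv (b.det.domDomCongr κ.symm) (ιMulti K d (b ∘ κ)) = 1 := by
    simp [Function.comp_assoc, b.det_self]
  have : FiniteDimensional K V := b.finiteDimensional_of_finite
  have hfinrank : Module.finrank K (⋀[K]^d V) = Module.finrank K K := by
    rw [finrank_eq, Module.finrank_eq_card_basis b, ← Fintype.card_congr κ, Fintype.card_fin,
      Nat.choose_self, Module.finrank_self]
  have hsurj := LinearMap.surjective (f := alternatingMapLinearEquiv (b.det.domDomCongr κ.symm))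
    fun h => one_ne_zero (hone.symm.trans congr($h _))
  LinearEquiv.ofBijective _
    ⟨(LinearMap.injective_iff_surjective_of_finrank_eq_finrank hfinrank).2 hsurj, hsurj⟩

theorem volume_ιMulti {d : ℕ} (b : Module.Basis ι K V) (κ : Fin d ≃ ι) (v : Fin d → V) :
    volume b κ (ιMulti K d v) = b.det (v ∘ κ.symm) :=
  alternatingMapLinearEquiv_apply_ιMulti _ v

theorem det_sumElim {ι' : Type*} [Fintype ι'] [DecidableEq ι'] (b : Module.Basis (ι ⊕ ι') K V)
    (v : ι → V) :
    b.det (Sum.elim v (b ∘ Sum.inr)) =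
      (Matrix.of fun i j => b.coord (Sum.inl j) (v i)).det := by
  have h : b.toMatrix (Sum.elim v (b ∘ Sum.inr)) = Matrix.fromBlocks
      (Matrix.of fun j i => b.coord (Sum.inl j) (v i)) 0
      (Matrix.of fun j i => b.coord (Sum.inr j) (v i)) 1 := by
    ext (i | i) (j | j) <;>
      simp [Module.Basis.toMatrix_apply, Finsupp.single_apply, Matrix.one_apply, eq_comm]
  rw [b.det_apply, h, Matrix.det_fromBlocks_zero₁₂, Matrix.det_one, mul_one,
    ← Matrix.det_transpose]
  rfl

theorem volume_wedge {r s : ℕ} (b : Module.Basis ι K V) (κ : Fin r ⊕ Fin s ≃ ι)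
    (σ : Equiv.Perm ι) (η : ⋀[K]^r V) :
    volume b (finSumFinEquiv.symm.trans κ) (wedge η (ιMulti K s (b ∘ σ ∘ κ ∘ Sum.inr))) =
      Equiv.Perm.sign σ • pairingDual K V r (ιMulti K r (b.coord ∘ σ ∘ κ ∘ Sum.inl)) η := by
  suffices (volume b (finSumFinEquiv.symm.trans κ)).toLinearMap ∘ₗ
      (wedgeHom r s).flip (ιMulti K s (b ∘ σ ∘ κ ∘ Sum.inr)) =
        Equiv.Perm.sign σ • pairingDual K V r (ιMulti K r (b.coord ∘ σ ∘ κ ∘ Sum.inl)) from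
    congr($this η)
  ext v
  change volume b _ (wedge (ιMulti K r v) _) =
    Equiv.Perm.sign σ • pairingDual K V r _ (ιMulti K r v)
  let b' := b.reindex (κ.trans σ).symm
  have hinr : b ∘ σ ∘ κ ∘ Sum.inr = b' ∘ Sum.inr := by
    funext j
    simp [b']
  calc volume b _ (wedge (ιMulti K r v) (ιMulti K s (b ∘ σ ∘ κ ∘ Sum.inr)))
      = b.det ((Sum.elim v (b' ∘ Sum.inr) ∘ (κ.trans σ).symm) ∘ σ) := by
        rw [wedge_ιMulti_ιMulti, volume_ιMulti, hinr]
        congr 1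
        funext i
        simp
    _ = Equiv.Perm.sign σ • b'.det (Sum.elim v (b' ∘ Sum.inr)) := by
        rw [AlternatingMap.map_perm, b.det_reindex]
    _ = _ := by
        rw [det_sumElim, pairingDual_ιMulti_ιMulti]
        simp only [b', Module.Basis.coord_apply, Module.Basis.repr_reindex_apply, Equiv.symm_symm,
          Equiv.trans_apply, Function.comp_apply]

end Volume

end Pairing

section Contraction

universe u

variable {K : Type u} [Field K]
variable {V W : Type u} [AddCommGroup V] [Module K V] [AddCommGroup W] [Module K W]

open exteriorPower

/-- The vector `ζ` is the image under `⋀^n π` of a Hodge dual of `η`, and `η'` is a Hodge dual of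
`ζ`. -/
theorem PluckerVariety.exists_double_hodgeDual [FiniteDimensional K V] [FiniteDimensional K W]
    (X : PluckerVariety K) {q n p : ℕ} (π : W →ₗ[K] V)
    (hW : Module.finrank K (Module.Dual K W) = q + n) (hV : Module.finrank K V = n + p)
    (ψ : ⋀[K]^(q + n) (Module.Dual K W) ≃ₗ[K] K) (ψ' : ⋀[K]^(n + p) V ≃ₗ[K] K)
    {η : ⋀[K]^q (Module.Dual K W)} (hη : η ∈ X.inst q (Module.Dual K W)) :
    ∃ ζ : ⋀[K]^n V, (∀ θ, pairingDual K V n θ ζ = ψ (wedge η (map n π.dualMap θ))) ∧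
      ∃ η' ∈ X.inst p (Module.Dual K V), ∀ m, pairingDual K V p η' m = ψ' (wedge ζ m) := by
  obtain ⟨star, hstar, star_apply⟩ := exists_hodgeDual hW ψ
  obtain ⟨star', hstar', star'_apply⟩ := exists_hodgeDual hV ψ'
  obtain ⟨ρ, hρ⟩ : ∃ ρ : Module.Dual K (Module.Dual K W) →ₗ[K] V,
      Module.Dual.eval K V ∘ₗ ρ = π.dualMap.dualMap := by
    refine ⟨π ∘ₗ (Module.evalEquiv K W).symm.toLinearMap, ?_⟩
    ext y θ
    obtain ⟨w, rfl⟩ := (Module.evalEquiv K W).surjective y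
    simp
  refine ⟨map n ρ (star η), fun θ => ?_, star' (map n ρ (star η)),
    X.hodge_mem _ _ _ star' hstar' (X.map_mem _ _ _ ρ (X.hodge_mem _ _ _ star hstar hη)),
    star'_apply _⟩
  rw [← star_apply, ← pairingDual_map_eval, ← pairingDual_map_dualMap, ← hρ,
    exteriorPower.map_comp]
  rfl

/-- The equivalence moving the first block of `(Fin n ⊕ Fin p) ⊕ Fin l` to the end. -/
def rotateBlocks (n p l : ℕ) : Fin (p + l) ⊕ Fin n ≃ (Fin n ⊕ Fin p) ⊕ Fin l :=
  (Equiv.sumCongr finSumFinEquiv.symm (Equiv.refl _)).trans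
    ((Equiv.sumComm _ _).trans (Equiv.sumAssoc _ _ _).symm)

theorem volume_wedge_eq_pairingDual {n p l : ℕ}
    (e : Module.Basis (Fin n ⊕ Fin p) K V) (E : Module.Basis ((Fin n ⊕ Fin p) ⊕ Fin l) K W)
    {i : V →ₗ[K] W} (hi : ∀ j, i (e j) = E (Sum.inl j))
    {π : W →ₗ[K] V} (hπ : ∀ j, π.dualMap (e.coord j) = E.dualBasis (Sum.inl j))
    {η : ⋀[K]^(p + l) (Module.Dual K W)} {ζ : ⋀[K]^n V}
    (hζ : ∀ θ, pairingDual K V n θ ζ =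
      volume E.dualBasis (finSumFinEquiv.symm.trans (rotateBlocks n p l))
        (wedge η (map n π.dualMap θ))) (m : ⋀[K]^p V) :
    volume e (finSumFinEquiv.symm.trans (Equiv.refl _)) (wedge ζ m) =
      pairingDual K W (p + l) η (wedge (map p i m) (ιMulti K l (E ∘ Sum.inr))) := by
  suffices (volume e (finSumFinEquiv.symm.trans (Equiv.refl _))).toLinearMap ∘ₗ wedgeHom n p ζ =
      pairingDual K W (p + l) η ∘ₗ (wedgeHom p l).flip (ιMulti K l (E ∘ Sum.inr)) ∘ₗ map p i from
    congr($this m)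
  refine linearMap_ext (e.ext_alternating fun k hk => ?_)
  obtain ⟨σ, hσ⟩ := Equiv.Perm.exists_extending_pair Sum.inr k Sum.inr_injective hk
  obtain rfl : σ ∘ Sum.inr = k := funext hσ
  let τ : Equiv.Perm ((Fin n ⊕ Fin p) ⊕ Fin l) := Equiv.sumCongr σ (Equiv.refl _)
  have hτ : Equiv.Perm.sign τ = Equiv.Perm.sign σ := by
    rw [Equiv.Perm.sign_sumCongr, Equiv.Perm.sign_refl, mul_one]
  have hcoord (f : Fin (p + l) → (Fin n ⊕ Fin p) ⊕ Fin l) :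
      E.dualBasis.coord ∘ f = Module.Dual.eval K W ∘ E ∘ f := by
    funext j
    ext θ
    simp
  calc volume e (finSumFinEquiv.symm.trans (Equiv.refl _))
        (wedge ζ (ιMulti K p (e ∘ σ ∘ Sum.inr)))
      = Equiv.Perm.sign σ • pairingDual K V n (ιMulti K n (e.coord ∘ σ ∘ Sum.inl)) ζ :=
        volume_wedge e (Equiv.refl _) σ ζ
    _ = Equiv.Perm.sign σ • volume E.dualBasis (finSumFinEquiv.symm.trans (rotateBlocks n p l))
          (wedge η (ιMulti K n (E.dualBasis ∘ τ ∘ rotateBlocks n p l ∘ Sum.inr))) := by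
        rw [hζ, map_apply_ιMulti]
        congr 4
        funext j
        simp [hπ, rotateBlocks, τ]
    _ = pairingDual K (Module.Dual K W) (p + l) (ιMulti K (p + l)
          (Module.Dual.eval K W ∘ E ∘ τ ∘ rotateBlocks n p l ∘ Sum.inl)) η := by
        rw [volume_wedge, hτ, smul_smul, Int.units_mul_self, one_smul, hcoord]
    _ = pairingDual K W (p + l) η (wedge (map p i (ιMulti K p (e ∘ σ ∘ Sum.inr)))
          (ιMulti K l (E ∘ Sum.inr))) := by
        rw [← map_apply_ιMulti, pairingDual_map_eval, map_apply_ιMulti, wedge_ιMulti_ιMulti]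
        congr 2
        funext j
        obtain ⟨j | j, rfl⟩ := finSumFinEquiv.surjective j <;> simp [rotateBlocks, τ, hi]

/-- Contraction with the wedge product of a part of a basis is a composition of two Hodge duals
and a linear map, so Plücker varieties are stable under it. -/
theorem PluckerVariety.exists_contraction [FiniteDimensional K V] [FiniteDimensional K W]
    (X : PluckerVariety K) {n p l : ℕ}
    (e : Module.Basis (Fin n ⊕ Fin p) K V) (E : Module.Basis ((Fin n ⊕ Fin p) ⊕ Fin l) K W)
    {i : V →ₗ[K] W} (hi : ∀ j, i (e j) = E (Sum.inl j)) {η : ⋀[K]^(p + l) (Module.Dual K W)}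
    (hη : η ∈ X.inst (p + l) (Module.Dual K W)) :
    ∃ η' ∈ X.inst p (Module.Dual K V), ∀ m, pairingDual K V p η' m =
      pairingDual K W (p + l) η (wedge (map p i m) (ιMulti K l (E ∘ Sum.inr))) := by
  have hV : Module.finrank K V = n + p := by
    rw [Module.finrank_eq_card_basis e]
    simp
  have hW : Module.finrank K (Module.Dual K W) = p + l + n := by
    rw [Subspace.dual_finrank_eq, Module.finrank_eq_card_basis E,
      ← Fintype.card_congr (rotateBlocks n p l)]
    simp
  let π : W →ₗ[K] V := E.constr K (Sum.elim e 0)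
  have hπ (j) : π.dualMap (e.coord j) = E.dualBasis (Sum.inl j) := by
    refine E.ext fun k => ?_
    rcases k with k | k <;> simp [π, Finsupp.single_apply]
  obtain ⟨ζ, hζ, η', hη', hη'_apply⟩ := X.exists_double_hodgeDual π hW hV
    (volume E.dualBasis (finSumFinEquiv.symm.trans (rotateBlocks n p l)))
    (volume e (finSumFinEquiv.symm.trans (Equiv.refl _))) hη
  exact ⟨η', hη', fun m =>
    (hη'_apply m).trans (volume_wedge_eq_pairingDual e E hi hπ hζ m)⟩

end Contraction

section Restriction

universe u

variable {K : Type u} [Field K] {n p : ℕ}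

open exteriorPower

/-- The basis vectors of `V_{n,p}`, listed as `x_{-1}, …, x_{-n}` and `x_1, …, x_p`. -/
def levelIdxEquiv (n p : ℕ) : Fin n ⊕ Fin p ≃ {k : Idx | -(n : ℤ) ≤ k ∧ (k : ℤ) ≤ p} where
  toFun := Sum.elim (fun i => ⟨⟨-((i : ℤ) + 1), by omega⟩, by simp only [Set.mem_ofPred_eq]; omega⟩)
    (fun j => ⟨posIdx j, by simp only [Set.mem_ofPred_eq, posIdx]; omega⟩)
  invFun k := if h : (k : Idx).1 < 0 then .inl ⟨(-(k : Idx).1).toNat - 1, by have := k.2.1; omega⟩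
    else .inr ⟨(k : Idx).1.toNat - 1, by have := k.1.2; have := k.2.2; omega⟩
  left_inv k := by rcases k with i | j <;> simp [posIdx] <;> omega
  right_inv k := by
    have := k.1.2
    ext
    dsimp only
    split_ifs with h <;> simp [posIdx] <;> omega

variable (K) in
theorem linearIndependent_x : LinearIndependent K (x K) :=
  Finsupp.linearIndependent_single_one K Idx

variable (K n p) in
/-- The basis of `V_{n,p}` formed by the `x_i`. -/
def levelBasis : Module.Basis {k : Idx | -(n : ℤ) ≤ k ∧ (k : ℤ) ≤ p} K (Vnp K n p) :=
  (Module.Basis.span ((linearIndependent_x K).comp _ Subtype.val_injective)).map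
    (LinearEquiv.ofEq _ _ (by rw [Vnp, Set.image_eq_range]; rfl))

theorem levelBasis_apply (k : {k : Idx | -(n : ℤ) ≤ k ∧ (k : ℤ) ≤ p}) :
    levelBasis K n p k = ⟨x K k, x_mem_Vnp k.2.1 k.2.2⟩ := by
  ext1
  rw [levelBasis, Module.Basis.map_apply, LinearEquiv.coe_ofEq_apply, Module.Basis.coe_span_apply]
  rfl

theorem finrank_Vnp (n p : ℕ) : Module.finrank K (Vnp K n p) = n + p := by
  rw [Module.finrank_eq_card_basis ((levelBasis K n p).reindex (levelIdxEquiv n p).symm)]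
  simp

theorem trans_eq_wedge {n' l : ℕ} (hn : n ≤ n') (m : ⋀[K]^p (Vnp K n p)) :
    trans K (n, p) (n', p + l) ⟨hn, Nat.le_add_right p l⟩ m =
      wedge (map p (Submodule.inclusion (Vnp_mono K hn (Nat.le_add_right p l))) m)
        (ιMulti K l fun k => xpos K n' (p + l) (p + k) (by omega)) := by
  apply Subtype.ext
  simp only [trans, wedge, LinearMap.coe_mk, AddHom.coe_mk, ιMulti_apply_coe,
    ExteriorAlgebra.ιMulti_apply]
  congr 2
  exact List.ext_getElem (by simp) fun _ _ _ => by simp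

theorem PluckerVariety.exists_restrict (X : PluckerVariety K) {a b : ℕ × ℕ} (hab : a ≤ b)
    {η : ⋀[K]^b.2 (Module.Dual K (Vnp K b.1 b.2))}
    (hη : η ∈ X.inst b.2 (Module.Dual K (Vnp K b.1 b.2))) :
    ∃ η' ∈ X.inst a.2 (Module.Dual K (Vnp K a.1 a.2)), ∀ m,
      pairingDual K (Vnp K a.1 a.2) a.2 η' m =
        pairingDual K (Vnp K b.1 b.2) b.2 η (trans K a b hab m) := by
  obtain ⟨n, p⟩ := a
  obtain ⟨n', p'⟩ := b
  obtain ⟨hn, hp⟩ : n ≤ n' ∧ p ≤ p' := hab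
  obtain ⟨l, rfl⟩ := Nat.exists_eq_add_of_le hp
  let e := (levelBasis K n' p).reindex (levelIdxEquiv n' p).symm
  let E := (levelBasis K n' (p + l)).reindex
    ((Equiv.sumAssoc _ _ _).trans ((Equiv.sumCongr (Equiv.refl _) finSumFinEquiv).trans
      (levelIdxEquiv n' (p + l)))).symm
  let i := Submodule.inclusion (Vnp_mono K (le_refl n') (Nat.le_add_right p l))
  have hi (j) : i (e j) = E (Sum.inl j) := by
    rcases j with j | j <;> simp [i, e, E, levelBasis_apply, levelIdxEquiv] <;> rfl
  have hE : E ∘ Sum.inr = fun k : Fin l => xpos K n' (p + l) (p + k) (by omega) := by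
    funext k
    simp [E, levelBasis_apply, levelIdxEquiv, xpos]
  obtain ⟨η', hη', h⟩ := X.exists_contraction e E hi hη
  refine ⟨map p (Submodule.inclusion (Vnp_mono K hn (le_refl p))).dualMap η',
    X.map_mem _ _ _ _ hη', fun m => ?_⟩
  rw [pairingDual_map_dualMap, h, hE, trans_eq_wedge hn, ← LinearMap.comp_apply,
    ← exteriorPower.map_comp]
  rfl

theorem PluckerVariety.mem_limit {X : PluckerVariety K} {ω : Module.Dual K (InfWedge K)} :
    ω ∈ X.limit ↔ ∀ a : ℕ × ℕ, ∃ η ∈ X.inst a.2 (Module.Dual K (Vnp K a.1 a.2)),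
      ∀ m, pairingDual K (Vnp K a.1 a.2) a.2 η m = ω (toInfWedge K a m) := by
  simp only [limit, Set.mem_ofPred_eq, LinearMap.ext_iff, LinearMap.comp_apply, Prod.forall]

theorem PluckerVariety.dualPerm_mem_limit (X : PluckerVariety K) {ω : Module.Dual K (InfWedge K)}
    (hω : ω ∈ X.limit) (g : GInf K) : dualPerm K g ω ∈ X.limit := by
  rw [mem_limit] at hω ⊢
  intro a
  obtain ⟨c, hc⟩ := g⁻¹.2
  have hg : (g⁻¹ : GInf K).1 ∈ Gnp K (a ⊔ c) := Gnp_mono le_sup_right hc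
  obtain ⟨η, hη, h⟩ := hω (a ⊔ c)
  obtain ⟨η', hη', h'⟩ :=
    X.exists_restrict le_sup_left (X.map_mem _ _ _ (restr (a ⊔ c) _ hg).dualMap hη)
  refine ⟨η', hη', fun m => ?_⟩
  calc pairingDual K (Vnp K a.1 a.2) a.2 η' m
      = ω (toInfWedge K (a ⊔ c) (extAct (a ⊔ c) _ hg (trans K a (a ⊔ c) le_sup_left m))) := by
        rw [h', pairingDual_map_dualMap, h, extAct]
    _ = ω (act g⁻¹ (toInfWedge K (a ⊔ c) (trans K a (a ⊔ c) le_sup_left m))) := by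
        rw [act_toInfWedge]
    _ = dualPerm K g ω (toInfWedge K a m) := by
        rw [toInfWedge_trans]
        rfl

end Restriction

section Equations

universe u

variable {K : Type u} [Field K]

open exteriorPower

theorem IsZariskiClosed.exists_polynomials {V : Type u} [AddCommGroup V] [Module K V]
    [FiniteDimensional K V] {n : ℕ} {Z : Set (⋀[K]^n (Module.Dual K V))}
    (hZ : IsZariskiClosed K Z) {ι : Type*} (y : ι → ⋀[K]^n V) {S : Set ι}
    (hy : Submodule.span K (y '' S) = ⊤) :
    ∃ T : Set (MvPolynomial ι K), (∀ f ∈ T, f ∈ MvPolynomial.supported K S) ∧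
      ∀ η, η ∈ Z ↔ ∀ f ∈ T, MvPolynomial.eval (fun i => pairingDual K V n η (y i)) f = 0 := by
  obtain ⟨R, rfl⟩ := hZ
  have hspan : Submodule.span K ((fun i => (pairingDual K V n).flip (y i)) '' S) = ⊤ := by
    have hflip := (LinearMap.flip_bijective_iff₁.2 (pairingDual_bijective (K := K) (V := V) n)).2
    have h := congr(Submodule.map (pairingDual K V n).flip $hy)
    rwa [Submodule.map_span, Submodule.map_top, ← Set.image_comp,
      LinearMap.range_eq_top.2 hflip] at h
  have hR (F : SymmetricAlgebra K (Module.Dual K (⋀[K]^n (Module.Dual K V)))) :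
      ∃ f ∈ MvPolynomial.supported K S, ∀ η, SymmetricAlgebra.lift (Module.Dual.eval K _ η) F =
        MvPolynomial.eval (fun i => pairingDual K V n η (y i)) f := by
    obtain ⟨_, hf, hF⟩ := exists_polyFun_lift hspan F
    obtain ⟨f, hf, h⟩ := mem_polyFun.1 hf
    exact ⟨f, hf, fun η => (hF _).trans (h _)⟩
  choose φ hφ hφR using hR
  refine ⟨φ '' R, ?_, fun η => ?_⟩
  · rintro _ ⟨F, -, rfl⟩
    exact hφ F
  · simp [← hφR]

theorem eval_pairingDual_levelMonomial {a : ℕ × ℕ} {ω : Module.Dual K (InfWedge K)}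
    {η : ⋀[K]^a.2 (Module.Dual K (Vnp K a.1 a.2))}
    (h : ∀ m, pairingDual K _ _ η m = ω (toInfWedge K a m)) {f : MvPolynomial (Finset Idx) K}
    (hf : f ∈ MvPolynomial.supported K (levelSet a.1 a.2)) :
    MvPolynomial.eval (fun D => pairingDual K _ _ η (levelMonomial K a D)) f =
      MvPolynomial.eval (coords ω) f :=
  eval_congr_of_mem_supported hf fun D hD => by rw [h, toInfWedge_levelMonomial hD, coords]

theorem exists_evalAt_eq_eval_coords (f : MvPolynomial (Finset Idx) K) :
    ∃ F : CoordRing K, ∀ ω, evalAt ω F = MvPolynomial.eval (coords ω) f := by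
  refine ⟨MvPolynomial.aeval (fun D => SymmetricAlgebra.ι K _ (monomial K D)) f, fun ω => ?_⟩
  have h : (evalAt ω).comp (MvPolynomial.aeval fun D => SymmetricAlgebra.ι K _ (monomial K D)) =
      MvPolynomial.aeval (coords ω) := by
    ext D
    simp [evalAt, coords]
  rw [← MvPolynomial.coe_aeval_eq_eval]
  exact congr($h f)

variable (X : PluckerVariety K)

theorem PluckerVariety.exists_levelEquations (a : ℕ × ℕ) :
    ∃ T : Set (MvPolynomial (Finset Idx) K),
      (∀ f ∈ T, f ∈ MvPolynomial.supported K (levelSet a.1 a.2)) ∧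
      (∀ η, η ∈ X.inst a.2 (Module.Dual K (Vnp K a.1 a.2)) ↔ ∀ f ∈ T,
        MvPolynomial.eval (fun D => pairingDual K _ _ η (levelMonomial K a D)) f = 0) ∧
      ∀ f ∈ T, ∀ ω ∈ X.limit, MvPolynomial.eval (coords ω) f = 0 := by
  obtain ⟨T, hT, hTX⟩ :=
    (X.isZariskiClosed _ _).exists_polynomials (levelMonomial K a) (span_levelMonomial K a)
  refine ⟨T, hT, hTX, fun f hf ω hω => ?_⟩
  obtain ⟨η, hη, h⟩ := mem_limit.1 hω a
  rw [← eval_pairingDual_levelMonomial h (hT f hf)]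
  exact (hTX η).1 hη f hf

theorem PluckerVariety.mem_limit_of_forall_evalAt_eq_zero {ω : Module.Dual K (InfWedge K)}
    (h : ∀ F : CoordRing K, (∀ ω' ∈ X.limit, evalAt ω' F = 0) → evalAt ω F = 0) :
    ω ∈ X.limit := by
  rw [mem_limit]
  intro a
  obtain ⟨η, hη⟩ := (pairingDual_bijective (K := K) (V := Vnp K a.1 a.2) a.2).2
    (ω ∘ₗ toInfWedge K a)
  have hη (m) : pairingDual K _ _ η m = ω (toInfWedge K a m) := congr($hη m)
  obtain ⟨T, hT, hTX, hT0⟩ := X.exists_levelEquations a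
  refine ⟨η, (hTX η).2 fun f hf => ?_, hη⟩
  obtain ⟨F, hF⟩ := exists_evalAt_eq_eval_coords f
  rw [eval_pairingDual_levelMonomial hη (hT f hf), ← hF]
  exact h F fun ω' hω' => (hF ω').trans (hT0 f hf ω' hω')

theorem exists_surjective_of_finrank_le {V W : Type*} [AddCommGroup V] [Module K V]
    [AddCommGroup W] [Module K W] [FiniteDimensional K V] [FiniteDimensional K W]
    (h : Module.finrank K W ≤ Module.finrank K V) :
    ∃ f : V →ₗ[K] W, Function.Surjective f := by
  obtain ⟨i, hi⟩ := finrank_le_iff_exists_linearMap.1 h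
  obtain ⟨f, hf⟩ := i.exists_leftInverse_of_injective (LinearMap.ker_eq_bot.2 hi)
  exact ⟨f, fun w => ⟨i w, congr($hf w)⟩⟩

theorem PluckerVariety.IsBounded.exists_polynomial {X : PluckerVariety K} (hX : X.IsBounded) :
    ∃ n, 2 ≤ n ∧ ∃ f ∈ MvPolynomial.supported K (levelSet n 2), f ≠ 0 ∧
      ∀ ω ∈ X.limit, MvPolynomial.eval (coords ω) f = 0 := by
  obtain ⟨V, _, _, _, hV⟩ := hX
  let n := Module.finrank K V + 2
  obtain ⟨v, hv⟩ := (Set.ne_univ_iff_exists_notMem _).1 hV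
  obtain ⟨g, hg⟩ : ∃ g : Module.Dual K (Vnp K n 2) →ₗ[K] V, Function.Surjective g :=
    exists_surjective_of_finrank_le (by rw [Subspace.dual_finrank_eq, finrank_Vnp]; omega)
  obtain ⟨η, rfl⟩ := exteriorPower.map_surjective (n := 2) hg v
  obtain ⟨T, hT, hTX, hT0⟩ := X.exists_levelEquations (n, 2)
  obtain ⟨f, hf, hfη⟩ : ∃ f ∈ T,
      MvPolynomial.eval (fun D => pairingDual K _ _ η (levelMonomial K (n, 2) D)) f ≠ 0 := by
    by_contra! h
    exact hv (X.map_mem _ _ _ g ((hTX η).2 h))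
  exact ⟨n, by omega, f, hT f hf, fun h => hfη (by rw [h, map_zero]), hT0 f hf⟩

theorem PluckerVariety.IsBounded.exists_noetherianUpTo [Infinite K] {X : PluckerVariety K}
    (hX : X.IsBounded) :
    ∃ F : CoordRing K, (∀ ω ∈ X.limit, evalAt ω F = 0) ∧
      NoetherianUpTo (dualPerm K).range (dualFun K)
        (stableZeros (dualPerm K).range fun ω => evalAt ω F) := by
  obtain ⟨n, hn, f, hf, hf0, hfX⟩ := hX.exists_polynomial
  obtain ⟨F, hF⟩ := exists_evalAt_eq_eval_coords f
  exact ⟨F, by simpa only [hF] using hfX, by simpa only [hF] using noetherianUpTo_dual hn hf hf0⟩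

theorem NoetherianUpTo.exists_finset_coordRing {Z : Set (Module.Dual K (InfWedge K))}
    (hZ : NoetherianUpTo (dualPerm K).range (dualFun K) Z)
    (hmaps : ∀ g ∈ (dualPerm K).range, Set.MapsTo g Z Z) (I : Set (CoordRing K)) :
    ∃ T : Finset (CoordRing K), ↑T ⊆ I ∧ ∀ ω ∈ Z,
      (∀ F ∈ T, ω ∈ stableZeros (dualPerm K).range fun ω => evalAt ω F) →
        ∀ F ∈ I, evalAt ω F = 0 := by
  classical
  obtain ⟨T', hT', h⟩ := hZ.exists_finset hmaps (S := (fun F ω => evalAt ω F) '' I)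
    (Set.image_subset_range _ _)
  obtain ⟨T, hT, rfl⟩ := Finset.subset_set_image_iff.1 hT'
  refine ⟨T, hT, fun ω hω hωT F hF => ?_⟩
  exact h ω hω (Finset.forall_mem_image.2 hωT) _ ⟨F, hF, rfl⟩ 1 (one_mem _)

end Equations

end PluckerLimit

end

theorem corollary6p5 {K : Type*} [Field K] [Infinite K]
    (X : PluckerLimit.PluckerVariety K) (hX : X.IsBounded) :
    ∃ S : Finset (PluckerLimit.CoordRing K),
      X.limit =
        PluckerLimit.zeroSet (⋃ f ∈ S, MulAction.orbit (PluckerLimit.GInf K) f) := by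
  classical
  obtain ⟨F₀, hF₀, hnoeth⟩ := hX.exists_noetherianUpTo
  obtain ⟨T, hTX, hT⟩ := hnoeth.exists_finset_coordRing
    (fun g hg ω hω => PluckerLimit.apply_mem_stableZeros hg hω)
    {F | ∀ ω ∈ X.limit, PluckerLimit.evalAt ω F = 0}
  refine ⟨insert F₀ T, Set.Subset.antisymm (fun ω hω => ?_) fun ω hω => ?_⟩
  · refine PluckerLimit.mem_zeroSet_orbit.2 fun F hF => ?_
    have hFX : ∀ ω ∈ X.limit, PluckerLimit.evalAt ω F = 0 := by
      rcases Finset.mem_insert.1 hF with rfl | hF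
      exacts [hF₀, hTX hF]
    rintro _ ⟨g, rfl⟩
    exact hFX _ (X.dualPerm_mem_limit hω g)
  · have horbit := PluckerLimit.mem_zeroSet_orbit.1 hω
    exact X.mem_limit_of_forall_evalAt_eq_zero (hT ω (horbit F₀ (Finset.mem_insert_self _ _))
      fun F hF => horbit F (Finset.mem_insert_of_mem hF))
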